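/- **Setting.** Let $I=[0,1]$ with Lebesgue measure $m$. For $f\in L^1(m)$ let $Vf=\inf\{\operatorname{var}\bar f:\bar f=f\ \text{a.e.}\}$, where $\operatorname{var}$ is the total variation on $[0,1]$; let $BV=\{f\in L^1: Vf<\infty\}$ with $\|f\|_{BV}=Vf+\|f\|_1$. Let $T:I\to I$ be Borel measurable, piecewise $C^2$ and expanding: there are at most countably many pairwise disjoint open subintervals of $I$ covering $I$ up to a null set, on each of which $T$ is $C^2$, and $|T'|\ge\beta$ on all of them for some $\beta>1$. Its transfer operator $P:L^1\to L^1$ is given by $\int f\cdot g\circ T\,dm=\int Pf\cdot g\,dm$ for $f\in L^1$, $g\in L^\infty$. Assume: * **(A1)** $\alpha\in(0,1)$ and $B_0\ge 0$ are such that $V(Pf)\le\alpha Vf+B_0\|f\|_1$ for all $f\in BV$; * **(A2)** on (complex) $BV$, $1$ is a simple eigenvalue of $P$, and $P$ has no other eigenvalue of modulus $1$. Let $\psi\in BV$ be real valued, and write $\|\psi\|_\infty$ for its $L^\infty(m)$ norm. For a partition $\eta$ of $[0,1]$ into finitely many intervals let $\mathfrak B_\eta$ be the $\sigma$-algebra it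 generates, $\Pi_\eta f=E(f|\mathfrak B_\eta)$, $P_\eta=\Pi_\eta P\,\Pi_\eta$ and $|||P_\eta-P|||=\sup_{\|f\|_{BV}\le1}\|P_\eta f-Pf\|_1$; its mesh is the largest length of its intervals. **Theorem.** 1. $T$ has a unique absolutely continuous invariant probability measure $\nu=h\,m$, and $h\in BV$. With $\hat\psi=\psi-\int\psi\,d\nu$, the limit $$\sigma^2:=\lim_{n\to\infty}\frac1n\int_I\Big(\sum_{i=0}^{n-1}\psi\circ T^i-n\int_I\psi\,d\nu\Big)^2d\nu=\int_I\hat\psi^2h\,dm+2\sum_{i=1}^\infty\int_I P^i(\hat\psi h)\,\hat\psi\,dm$$ exists and the series converges absolutely. For every $\eta$, $P_\eta$ fixes a probability density $h_\eta$, and every integrable fixed function of $P_\eta$ is a multiple of it. Put $\hat\psi_\eta=\psi-\int\psi h_\eta\,dm$ and $$\sigma^2_{\eta,l}:=\int_I\hat\psi_\eta^2h_\eta\,dm+2\sum_{i=1}^{l-1}\int_I P_\eta^i(\hat\psi_\eta h_\eta)\,\hat\psi_\eta\,dm .$$ 2. For every $\tau>0$ there are an integer $l_*\ge1$ and $\varepsilon_*>0$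 such that $|\sigma^2_{\eta,l_*}-\sigma^2|\le\tau$ for every partition $\eta$ of mesh at most $\varepsilon_*$. 3. (Explicit choices.) Let $$E(l)=4\|\psi\|_\infty\sum_{i=l}^\infty\|P^i(\hat\psi h)\|_1,$$ $$D(\eta,l)=(16(l-1)+8)\|\psi\|_\infty^2\|h_\eta-h\|_1+4\|\psi\|_\infty\sum_{i=1}^{l-1}\sum_{j=0}^{i-1}\Big(2\|\psi\|_\infty\big(B_j+1+\tfrac{\alpha^jB_0}{1-\alpha}\big)+\tfrac{\alpha^j(B_0+1-\alpha)}{1-\alpha}V\psi\Big)|||P_\eta-P|||,$$ with $B_j=\sum_{k=0}^{j-1}\alpha^kB_0$. The series in $E(l)$ converges. There are $C_*>0$ and $\rho_*\in(\alpha,1)$ with $\|P^nf\|_{BV}\le C_*\rho_*^n\|f\|_{BV}$ for all $n\ge0$ and all $f\in BV$ with $\int f\,dm=0$; for any such $C_*,\rho_*$ and any $\tau>0$, the integer $$l_*=\max\left\{1,\left\lceil\frac{\log(\tau/2)-\log\Big(4\|\psi\|_\infty(2\|\psi\|_\infty+V\psi)\frac{B_0+1-\alpha}{(1-\alpha)(1-\rho_*)}C_*\Big)}{\log\rho_*}\right\rceil\right\}$$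 (with $\log 0:=0$ in the trivial case $\psi=0$ a.e.) satisfies $E(l_*)\le\tau/2$. For every $\tau>0$ and $l\ge1$ there is $\varepsilon>0$ such that $D(\eta,l)\le\tau/2$ for every $\eta$ of mesh at most $\varepsilon$. Finally, for all $\tau>0$, $l\ge1$ and $\eta$, if $E(l)\le\tau/2$ and $D(\eta,l)\le\tau/2$, then $|\sigma^2_{\eta,l}-\sigma^2|\le\tau$. -/

import Mathlib

open MeasureTheory Filter Topology Set

/-- Lebesgue measure `m` on the unit interval `I = [0,1]`, as a measure on `ℝ`. -/
noncomputable abbrev lebI : Measure ℝ := volume.restrict (Icc (0 : ℝ) 1)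

/-- `T` maps `[0,1]` to itself, is Borel measurable, and is piecewise `C²` and expanding: up to a
null set, `[0,1]` is a disjoint union of countably many (finitely many is allowed) open intervals on
each of which `T` is `C²`, and `|T'| ≥ β` on all of them for a single `β > 1`. -/
structure IsPiecewiseC2Expanding (T : ℝ → ℝ) : Prop where
  measurable : Measurable T
  mapsTo : MapsTo T (Icc 0 1) (Icc 0 1)
  branches : ∃ (J : Set (ℝ × ℝ)) (β : ℝ), J.Countable ∧ 1 < β ∧
    (∀ p ∈ J, p.1 < p.2 ∧ Ioo p.1 p.2 ⊆ Icc 0 1) ∧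
    J.PairwiseDisjoint (fun p => Ioo p.1 p.2) ∧
    volume (Icc (0 : ℝ) 1 \ ⋃ p ∈ J, Ioo p.1 p.2) = 0 ∧
    ∀ p ∈ J, ContDiffOn ℝ 2 T (Ioo p.1 p.2) ∧ ∀ x ∈ Ioo p.1 p.2, β ≤ |deriv T x|

/-- `V f`: the infimum, over all functions equal to `f` almost everywhere on `[0,1]`, of the total
variation on `[0,1]`. -/
noncomputable def essVar {E : Type*} [NormedAddCommGroup E] (f : ℝ → E) : ENNReal :=
  ⨅ (g : ℝ → E) (_ : f =ᵐ[lebI] g), eVariationOn g (Icc 0 1)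

/-- `f ∈ BV`. Functions are identified when they agree almost everywhere on `[0,1]`. -/
def IsBV {E : Type*} [NormedAddCommGroup E] (f : ℝ → E) : Prop :=
  Integrable f lebI ∧ essVar f < ⊤

/-- `‖f‖_BV = V f + ‖f‖₁`. -/
noncomputable def bvNorm (f : ℝ → ℝ) : ENNReal := essVar f + eLpNorm f 1 lebI

/-- `‖f‖₁`. -/
noncomputable def l1Norm (f : ℝ → ℝ) : ℝ := ∫ x, |f x| ∂lebI

/-- `‖f‖_∞`, the essential supremum of `|f|` on `[0,1]`. -/
noncomputable def supNorm (f : ℝ → ℝ) : ℝ := (eLpNorm f ⊤ lebI).toReal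

/-- The duality relation `∫ f · (g ∘ T) dm = ∫ u · g dm` for all `g ∈ L^∞`, which determines
`u = P f ∈ L¹` almost everywhere. -/
def IsTransferOf (T f u : ℝ → ℝ) : Prop :=
  Integrable u lebI ∧
    ∀ g : ℝ → ℝ, MemLp g ⊤ lebI → ∫ x, f x * g (T x) ∂lebI = ∫ x, u x * g x ∂lebI

open Classical in
/-- The transfer (Perron–Frobenius) operator `P` of `T`, defined by duality. -/
noncomputable def transfer (T f : ℝ → ℝ) : ℝ → ℝ :=
  if H : ∃ u, IsTransferOf T f u then H.choose else 0

/-- The complex-linear extension of `P` to complex-valued functions. -/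
noncomputable def transferC (T : ℝ → ℝ) (f : ℝ → ℂ) : ℝ → ℂ := fun x =>
  (transfer T (fun y => (f y).re) x : ℂ) + (transfer T (fun y => (f y).im) x : ℂ) * Complex.I

/-- The Lasota–Yorke inequality `V (P f) ≤ α V f + B₀ ‖f‖₁` on `BV`. -/
def LasotaYorke (T : ℝ → ℝ) (α B₀ : ℝ) : Prop :=
  ∀ f : ℝ → ℝ, IsBV f →
    essVar (transfer T f) ≤ ENNReal.ofReal α * essVar f + ENNReal.ofReal B₀ * eLpNorm f 1 lebI

/-- On (complex) `BV`, `1` is a simple eigenvalue of `P` (the generalized eigenspace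
`⋃ₖ ker (P - 1)ᵏ` is spanned by one nonzero eigenfunction), and `P` has no other eigenvalue of
modulus one. -/
structure SimpleDominantEigenvalue (T : ℝ → ℝ) : Prop where
  simple : ∃ f : ℝ → ℂ, IsBV f ∧ ¬ (f =ᵐ[lebI] 0) ∧ transferC T f =ᵐ[lebI] f ∧
    ∀ (k : ℕ) (g : ℝ → ℂ), IsBV g →
      (fun u : ℝ → ℂ => transferC T u - u)^[k] g =ᵐ[lebI] 0 → ∃ c : ℂ, g =ᵐ[lebI] c • f
  no_other : ∀ z : ℂ, ‖z‖ = 1 → z ≠ 1 →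
    ∀ f : ℝ → ℂ, IsBV f → transferC T f =ᵐ[lebI] z • f → f =ᵐ[lebI] 0

/-- `ν` is an absolutely continuous `T`-invariant probability measure on `[0,1]`. -/
structure IsACIP (T : ℝ → ℝ) (ν : Measure ℝ) : Prop where
  prob : IsProbabilityMeasure ν
  absCont : ν ≪ lebI
  invariant : MeasurePreserving T ν ν

/-- `(1/n) ∫ (∑_{i<n} ψ ∘ Tⁱ - n ∫ ψ dν)² dν`. -/
noncomputable def birkhoffVariance (T : ℝ → ℝ) (ν : Measure ℝ) (ψ : ℝ → ℝ) (n : ℕ) : ℝ :=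
  (1 / (n : ℝ)) * ∫ x, ((∑ i ∈ Finset.range n, ψ (T^[i] x)) - n * ∫ y, ψ y ∂ν) ^ 2 ∂ν

/-- A finite partition `0 = x₀ < x₁ < ⋯ < x_d = 1` of the unit interval. -/
structure IntervalPartition where
  d : ℕ
  pt : Fin (d + 1) → ℝ
  strictMono : StrictMono pt
  pt_zero : pt 0 = 0
  pt_last : pt (Fin.last d) = 1

namespace IntervalPartition

/-- The cell between two consecutive points. (The cells cover `[0,1]` up to the null set `{1}`.) -/
def cell (η : IntervalPartition) (k : Fin η.d) : Set ℝ := Ico (η.pt k.castSucc) (η.pt k.succ)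

/-- Every interval of the partition has length at most `ε`. -/
def MeshLE (η : IntervalPartition) (ε : ℝ) : Prop :=
  ∀ k : Fin η.d, η.pt k.succ - η.pt k.castSucc ≤ ε

/-- The `σ`-algebra generated by the partition. -/
abbrev sigmaAlg (η : IntervalPartition) : MeasurableSpace ℝ :=
  MeasurableSpace.generateFrom (range η.cell)

/-- The projection `Π_η f = E(f | 𝔅_η)`. -/
noncomputable def proj (η : IntervalPartition) (f : ℝ → ℝ) : ℝ → ℝ :=
  condExp η.sigmaAlg lebI f

/-- Ulam's approximation `P_η = Π_η ∘ P ∘ Π_η`. -/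
noncomputable def ulam (η : IntervalPartition) (T f : ℝ → ℝ) : ℝ → ℝ :=
  η.proj (transfer T (η.proj f))

/-- `g` is a probability density fixed by `P_η`. -/
structure IsUlamDensity (η : IntervalPartition) (T g : ℝ → ℝ) : Prop where
  integrable : Integrable g lebI
  nonneg : 0 ≤ᵐ[lebI] g
  integral_eq_one : ∫ x, g x ∂lebI = 1
  fixed : η.ulam T g =ᵐ[lebI] g

end IntervalPartition

/-- `ψ - ∫ ψ h dm`. -/
noncomputable def centered (ψ h : ℝ → ℝ) : ℝ → ℝ := fun x => ψ x - ∫ y, ψ y * h y ∂lebI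

/-- `∫ Qⁱ(φ h) φ dm` with `φ = ψ - ∫ ψ h dm`, for an operator `Q`. -/
noncomputable def corr (Q : (ℝ → ℝ) → (ℝ → ℝ)) (h ψ : ℝ → ℝ) (i : ℕ) : ℝ :=
  ∫ x, (Q^[i] (fun y => centered ψ h y * h y)) x * centered ψ h x ∂lebI

/-- The truncated Ulam approximation `σ²_{η,l}` of the diffusion coefficient, computed from the
fixed density `hη` of `P_η`:
`∫ φ² hη dm + 2 ∑_{i=1}^{l-1} ∫ P_ηⁱ(φ hη) φ dm`, with `φ = ψ - ∫ ψ hη dm`. -/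
noncomputable def ulamDiffusion (T : ℝ → ℝ) (η : IntervalPartition) (hη ψ : ℝ → ℝ) (l : ℕ) : ℝ :=
  (∫ x, centered ψ hη x ^ 2 * hη x ∂lebI) + 2 * ∑ i ∈ Finset.Ico 1 l, corr (η.ulam T) hη ψ i

/-- The mixed norm `|||P_η - P||| = sup {‖P_η f - P f‖₁ : ‖f‖_BV ≤ 1}`. -/
noncomputable def ulamError (T : ℝ → ℝ) (η : IntervalPartition) : ℝ :=
  (⨆ (f : ℝ → ℝ) (_ : IsBV f) (_ : bvNorm f ≤ 1),
    eLpNorm (η.ulam T f - transfer T f) 1 lebI).toReal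

/-- The truncation error bound `4 ‖ψ‖_∞ ∑_{i ≥ l} ‖Pⁱ(φ h)‖₁`, with `φ = ψ - ∫ ψ h dm`. -/
noncomputable def tailBound (T h ψ : ℝ → ℝ) (l : ℕ) : ℝ :=
  4 * supNorm ψ * ∑' i : ℕ, l1Norm ((transfer T)^[l + i] (fun y => centered ψ h y * h y))

/-- The discretization error bound
`(16(l-1)+8) ‖ψ‖_∞² ‖hη - h‖₁ + 4 ‖ψ‖_∞ ∑_{i=1}^{l-1} ∑_{j=0}^{i-1}
  (2 ‖ψ‖_∞ (B_j + 1 + αʲ B₀/(1-α)) + αʲ (B₀+1-α)/(1-α) V ψ) |||P_η - P|||`,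
where `B_j = ∑_{k<j} αᵏ B₀`. -/
noncomputable def discretizationBound (T : ℝ → ℝ) (α B₀ : ℝ) (η : IntervalPartition)
    (hη h ψ : ℝ → ℝ) (l : ℕ) : ℝ :=
  (16 * ((l : ℝ) - 1) + 8) * supNorm ψ ^ 2 * l1Norm (fun x => hη x - h x) +
  4 * supNorm ψ *
    (∑ i ∈ Finset.Ico 1 l, ∑ j ∈ Finset.range i,
      (2 * supNorm ψ * ((∑ k ∈ Finset.range j, α ^ k * B₀) + 1 + α ^ j * B₀ / (1 - α)) +
        α ^ j * (B₀ + 1 - α) / (1 - α) * (essVar ψ).toReal)) *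
    ulamError T η

/-- `‖Pⁿ f‖_BV ≤ C ρⁿ ‖f‖_BV` for all `f ∈ BV` with `∫ f dm = 0`. -/
def DecayBound (T : ℝ → ℝ) (C ρ : ℝ) : Prop :=
  ∀ f : ℝ → ℝ, IsBV f → ∫ x, f x ∂lebI = 0 →
    ∀ n : ℕ, bvNorm ((transfer T)^[n] f) ≤ ENNReal.ofReal (C * ρ ^ n) * bvNorm f

/-- The explicit truncation length
`⌈(log (τ/2) - log (4 ‖ψ‖_∞ (2 ‖ψ‖_∞ + V ψ) (B₀+1-α)/((1-α)(1-ρ)) C)) / log ρ⌉`, made at least `1`. -/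
noncomputable def truncationLength (α B₀ C ρ : ℝ) (ψ : ℝ → ℝ) (τ : ℝ) : ℕ :=
  max 1 ⌈(Real.log (τ / 2) -
    Real.log (4 * supNorm ψ * (2 * supNorm ψ + (essVar ψ).toReal) *
      ((B₀ + 1 - α) / ((1 - α) * (1 - ρ))) * C)) / Real.log ρ⌉₊

/-! The transfer operator `P` is a Markov operator (positive and integral preserving), hence an `L¹`
contraction, and so is each Ulam operator `P_η`. Everything rests on three facts: `P` contracts
exponentially in `BV` on functions of mean zero, `Π_η` does not increase the variation, and `‖f -
Π_η f‖₁` is at most the mesh times `V f`.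

Decay. Bounded sets of `BV` are totally bounded in `L¹`, since functions of bounded variation are
uniformly approximated in `L¹` by step functions on a fine partition. With the Lasota–Yorke
inequality this gives a compact set of `L¹` that absorbs the orbit of every mean-zero `BV` function
in the unit ball of `L¹`. By `tendsto_pow_zero_of_compact_absorbing`, limits along an idempotent
ultrafilter live in a finite-dimensional invariant space carrying only unimodular eigenvalues. The
assumption on the spectrum leaves no such eigenvalue on mean-zero functions, so `Pⁿ f → 0` in `L¹`.
Total boundedness makes this uniform, Lasota–Yorke turns it into a contraction of an iterate in
`BV`, and `exists_decayBound` follows. Uniqueness of the invariant density, absolute convergence of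
the correlation series and the geometric bound on its tail are consequences. The variance formula is
a recursion for the second moment of Birkhoff sums followed by Cesàro averaging.

Ulam's method. Acting on the coefficients of step functions, `P_η` preserves mass in finite
dimension, so it has a nonzero fixed vector, and its absolute value is fixed too. If there were two
independent fixed functions, some nonzero mean-zero `w` would be fixed, and so would `|w| + w` and
`|w| - w`. The support of the invariant density is contained in the support of each of them, but
these supports are disjoint (`ulam_fixed_unique`).

Error. `P_η` satisfies Lasota–Yorke with the constants of `P`, so the densities `h_η` are bounded in
`BV` uniformly in `η`. As `|||P_η - P|||` is of the order of the mesh, `Pⁿ h_η` is close both to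
`h_η` and, by decay, to `h`. The correlations are compared by telescoping `P_ηⁱ - Pⁱ`. The neglected
tail of the series contributes `E(l)` and the rest is below `D(η,l)` (`abs_ulamDiffusion_sub_le`).
-/

/-! ### The `L¹` norm and Markov operators. -/

instance : IsFiniteMeasure lebI := ⟨by simp [lebI]⟩

instance : IsProbabilityMeasure lebI := ⟨by simp [lebI]⟩

/-- A positive, integral preserving linear operator on `L¹[0,1]`, acting on functions. -/
structure IsMarkov (Q : (ℝ → ℝ) → (ℝ → ℝ)) : Prop where
  integrable : ∀ f, Integrable f lebI → Integrable (Q f) lebI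
  congr : ∀ f g, f =ᵐ[lebI] g → Q f =ᵐ[lebI] Q g
  add : ∀ f g, Integrable f lebI → Integrable g lebI → Q (f + g) =ᵐ[lebI] Q f + Q g
  smul : ∀ (c : ℝ) f, Integrable f lebI → Q (c • f) =ᵐ[lebI] c • Q f
  nonneg : ∀ f, Integrable f lebI → 0 ≤ᵐ[lebI] f → 0 ≤ᵐ[lebI] Q f
  integral : ∀ f, Integrable f lebI → ∫ x, Q f x ∂lebI = ∫ x, f x ∂lebI

theorem l1Norm_nonneg (f : ℝ → ℝ) : 0 ≤ l1Norm f := integral_nonneg fun _ => abs_nonneg _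

theorem l1Norm_congr {f g : ℝ → ℝ} (h : f =ᵐ[lebI] g) : l1Norm f = l1Norm g :=
  integral_congr_ae (h.mono fun x hx => by simp only [hx])

theorem l1Norm_add_le {f g : ℝ → ℝ} (hf : Integrable f lebI) (hg : Integrable g lebI) :
    l1Norm (f + g) ≤ l1Norm f + l1Norm g := by
  unfold l1Norm
  rw [← integral_add hf.abs hg.abs]
  exact integral_mono (hf.add hg).abs (hf.abs.add hg.abs) fun x => abs_add_le _ _

theorem l1Norm_smul (c : ℝ) (f : ℝ → ℝ) : l1Norm (c • f) = |c| * l1Norm f := by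
  simp [l1Norm, abs_mul, integral_const_mul]

theorem l1Norm_neg (f : ℝ → ℝ) : l1Norm (-f) = l1Norm f := by simp [l1Norm]

theorem l1Norm_sub_comm (f g : ℝ → ℝ) : l1Norm (f - g) = l1Norm (g - f) := by
  rw [← l1Norm_neg, neg_sub]

theorem l1Norm_sub_le {f g : ℝ → ℝ} (hf : Integrable f lebI) (hg : Integrable g lebI) :
    l1Norm (f - g) ≤ l1Norm f + l1Norm g := by
  rw [sub_eq_add_neg, ← l1Norm_neg g]; exact l1Norm_add_le hf hg.neg

theorem l1Norm_sub_triangle {f g k : ℝ → ℝ} (hf : Integrable f lebI) (hg : Integrable g lebI)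
    (hk : Integrable k lebI) : l1Norm (f - k) ≤ l1Norm (f - g) + l1Norm (g - k) := by
  have := l1Norm_add_le (hf.sub hg) (hg.sub hk)
  rwa [sub_add_sub_cancel] at this

theorem l1Norm_eq_zero_iff {f : ℝ → ℝ} (hf : Integrable f lebI) :
    l1Norm f = 0 ↔ f =ᵐ[lebI] 0 := by
  unfold l1Norm
  rw [integral_eq_zero_iff_of_nonneg (fun _ => abs_nonneg _) hf.abs]
  exact ⟨fun h => h.mono fun _ hx => by simpa using hx, fun h => h.mono fun _ hx => by simp [hx]⟩

theorem abs_integral_le_l1Norm (f : ℝ → ℝ) : |∫ x, f x ∂lebI| ≤ l1Norm f :=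
  abs_integral_le_integral_abs

theorem eLpNorm_one_eq_ofReal_l1Norm {f : ℝ → ℝ} (hf : Integrable f lebI) :
    eLpNorm f 1 lebI = ENNReal.ofReal (l1Norm f) := by
  rw [eLpNorm_one_eq_lintegral_enorm, ← ofReal_integral_norm_eq_lintegral_enorm hf]; rfl

theorem l1Norm_of_nonneg {f : ℝ → ℝ} (hf : 0 ≤ᵐ[lebI] f) : l1Norm f = ∫ x, f x ∂lebI :=
  integral_congr_ae (hf.mono fun _ hx => abs_of_nonneg hx)

namespace IsMarkov

variable {Q R : (ℝ → ℝ) → (ℝ → ℝ)}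

theorem sub (hQ : IsMarkov Q) {f g : ℝ → ℝ} (hf : Integrable f lebI) (hg : Integrable g lebI) :
    Q (f - g) =ᵐ[lebI] Q f - Q g := by
  have h1 := hQ.add f ((-1 : ℝ) • g) hf (hg.smul _)
  have h2 := hQ.smul (-1) g hg
  rw [show f - g = f + (-1 : ℝ) • g by simp [sub_eq_add_neg]]
  filter_upwards [h1, h2] with x h1 h2
  rw [h1, Pi.add_apply, h2]
  simp [sub_eq_add_neg]

theorem mono (hQ : IsMarkov Q) {f g : ℝ → ℝ} (hf : Integrable f lebI) (hg : Integrable g lebI)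
    (h : f ≤ᵐ[lebI] g) : Q f ≤ᵐ[lebI] Q g := by
  have h1 := hQ.nonneg (g - f) (hg.sub hf) (h.mono fun x hx => by simpa using hx)
  filter_upwards [h1, hQ.sub hg hf] with x h1 h2
  simpa [h2] using h1

theorem abs_le (hQ : IsMarkov Q) {f : ℝ → ℝ} (hf : Integrable f lebI) :
    ∀ᵐ x ∂lebI, |Q f x| ≤ Q (fun y => |f y|) x := by
  have h1 := hQ.mono hf hf.abs (.of_forall fun x => le_abs_self _)
  have h2 := hQ.mono (hf.smul (-1 : ℝ)) hf.abs (.of_forall fun x => by simpa using neg_le_abs (f x))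
  filter_upwards [h1, h2, hQ.smul (-1) f hf] with x h1 h2 h3
  rw [h3] at h2
  exact abs_le'.2 ⟨h1, by simpa using h2⟩

theorem l1Norm_le (hQ : IsMarkov Q) {f : ℝ → ℝ} (hf : Integrable f lebI) :
    l1Norm (Q f) ≤ l1Norm f := by
  unfold l1Norm
  rw [← hQ.integral _ hf.abs]
  exact integral_mono_ae (hQ.integrable f hf).abs (hQ.integrable _ hf.abs) (hQ.abs_le hf)

theorem comp (hQ : IsMarkov Q) (hR : IsMarkov R) : IsMarkov (fun f => Q (R f)) where
  integrable f hf := hQ.integrable _ (hR.integrable f hf)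
  congr f g h := hQ.congr _ _ (hR.congr f g h)
  add f g hf hg := (hQ.congr _ _ (hR.add f g hf hg)).trans
    (hQ.add _ _ (hR.integrable f hf) (hR.integrable g hg))
  smul c f hf := (hQ.congr _ _ (hR.smul c f hf)).trans (hQ.smul c _ (hR.integrable f hf))
  nonneg f hf h := hQ.nonneg _ (hR.integrable f hf) (hR.nonneg f hf h)
  integral f hf := (hQ.integral _ (hR.integrable f hf)).trans (hR.integral f hf)

theorem iterate (hQ : IsMarkov Q) : ∀ n : ℕ, IsMarkov (Q^[n])
  | 0 => ⟨fun _ h => h, fun _ _ h => h, fun _ _ _ _ => .rfl, fun _ _ _ => .rfl, fun _ _ h => h,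
      fun _ _ => rfl⟩
  | n + 1 => (iterate hQ n).comp hQ

theorem iterate_of_fixed (hQ : IsMarkov Q) {f : ℝ → ℝ} (h : Q f =ᵐ[lebI] f) (n : ℕ) :
    Q^[n] f =ᵐ[lebI] f := by
  induction n with
  | zero => rfl
  | succ n ih => exact ((hQ.iterate n).congr _ _ h).trans ih

/-- From `|f| = |Q f| ≤ Q |f|` and equality of the integrals. This turns any fixed function into a
nonnegative one. -/
theorem fixed_abs (hQ : IsMarkov Q) {f : ℝ → ℝ} (hf : Integrable f lebI) (h : Q f =ᵐ[lebI] f) :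
    Q (fun x => |f x|) =ᵐ[lebI] fun x => |f x| := by
  have h1 : (fun x => |f x|) ≤ᵐ[lebI] Q (fun x => |f x|) := by
    filter_upwards [hQ.abs_le hf, h] with x h1 h2
    rwa [h2] at h1
  exact (((integral_eq_iff_of_ae_le hf.abs (hQ.integrable _ hf.abs) h1).1
    (hQ.integral _ hf.abs).symm)).symm

end IsMarkov

/-! ### Existence of the transfer operator. -/

/-- By Rolle, `T` is injective on the branch. For `A` the part of the preimage there, the change of
variables gives `vol A ≤ ∫_A |T'| = vol (T A) ≤ vol N = 0`. -/
theorem volume_preimage_inter_Ioo_eq_zero {T : ℝ → ℝ} {a b β : ℝ} (hTm : Measurable T) (hβ : 1 < β)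
    (hT : ContDiffOn ℝ 2 T (Ioo a b)) (hd : ∀ x ∈ Ioo a b, β ≤ |deriv T x|)
    {N : Set ℝ} (hN : volume N = 0) (hNm : MeasurableSet N) :
    volume (T ⁻¹' N ∩ Ioo a b) = 0 := by
  have hdiff : ∀ x ∈ Ioo a b, HasDerivAt T (deriv T x) x := fun x hx =>
    ((hT.differentiableOn (by norm_num)).differentiableAt (Ioo_mem_nhds hx.1 hx.2)).hasDerivAt
  have hinj : InjOn T (Ioo a b) := by
    intro x hx y hy hxy
    by_contra hne
    wlog hlt : x < y generalizing x y
    · exact this hy hx hxy.symm (Ne.symm hne) (lt_of_le_of_ne (not_lt.1 hlt) (Ne.symm hne))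
    have hsub : Icc x y ⊆ Ioo a b := fun z hz => ⟨hx.1.trans_le hz.1, hz.2.trans_lt hy.2⟩
    obtain ⟨c, hc, hc0⟩ := exists_hasDerivAt_eq_zero hlt
      (fun z hz => (hdiff z (hsub hz)).continuousAt.continuousWithinAt) hxy
      (fun z hz => hdiff z (hsub (Ioo_subset_Icc_self hz)))
    have := hd c (hsub (Ioo_subset_Icc_self hc))
    rw [hc0, abs_zero] at this
    linarith
  set A := T ⁻¹' N ∩ Ioo a b with hA
  have hAm : MeasurableSet A := (hTm hNm).inter measurableSet_Ioo
  have h1 := lintegral_abs_det_fderiv_eq_addHaar_image volume hAm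
    (f := T) (f' := fun x => ContinuousLinearMap.toSpanSingleton ℝ (deriv T x))
    (fun x hx => (hdiff x hx.2).hasFDerivAt.hasFDerivWithinAt) (hinj.mono inter_subset_right)
  have h2 : volume (T '' A) = 0 :=
    measure_mono_null (image_subset_iff.2 fun x hx => hx.1) hN
  rw [h2] at h1
  have h3 : volume A ≤ ∫⁻ x in A, ENNReal.ofReal
      |(ContinuousLinearMap.toSpanSingleton ℝ (deriv T x)).det| := by
    rw [← setLIntegral_one]
    refine setLIntegral_mono' hAm fun x hx => ?_
    rw [ContinuousLinearMap.det_toSpanSingleton]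
    exact ENNReal.one_le_ofReal.2 (hβ.le.trans (hd x hx.2))
  exact le_antisymm (h3.trans h1.le) zero_le

/-- This makes `g ∘ T` well defined for classes `g ∈ L^∞`, and makes push-forwards of absolutely
continuous measures absolutely continuous, so that Radon–Nikodym applies. -/
theorem IsPiecewiseC2Expanding.quasiMeasurePreserving {T : ℝ → ℝ} (hT : IsPiecewiseC2Expanding T) :
    Measure.QuasiMeasurePreserving T lebI lebI := by
  obtain ⟨J, β, hJc, hβ, hJ, -, hJ0, hJd⟩ := hT.branches
  refine ⟨hT.measurable, Measure.AbsolutelyContinuous.mk fun N hNm hN => ?_⟩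
  rw [Measure.map_apply hT.measurable hNm, Measure.restrict_apply (hT.measurable hNm)]
  rw [Measure.restrict_apply hNm] at hN
  refine measure_mono_null (t := (Icc (0 : ℝ) 1 \ ⋃ p ∈ J, Ioo p.1 p.2) ∪
    ⋃ p ∈ J, T ⁻¹' (N ∩ Icc 0 1) ∩ Ioo p.1 p.2) ?_ (measure_union_null hJ0 ?_)
  · intro x hx
    by_cases hxJ : x ∈ ⋃ p ∈ J, Ioo p.1 p.2
    · right
      simp only [mem_iUnion, exists_prop] at hxJ ⊢
      obtain ⟨p, hp, hxp⟩ := hxJ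
      exact ⟨p, hp, ⟨hx.1, hT.mapsTo hx.2⟩, hxp⟩
    · exact .inl ⟨hx.2, hxJ⟩
  · exact (measure_biUnion_null_iff hJc).2 fun p hp =>
      volume_preimage_inter_Ioo_eq_zero hT.measurable hβ (hJd p hp).1 (hJd p hp).2 hN
        (hNm.inter measurableSet_Icc)

theorem memLp_top_indicator_one {A : Set ℝ} (hA : MeasurableSet A) :
    MemLp (A.indicator fun _ => (1 : ℝ)) ⊤ lebI :=
  (memLp_const 1).indicator hA

theorem IsTransferOf.ae_eq {T f u v : ℝ → ℝ} (hu : IsTransferOf T f u) (hv : IsTransferOf T f v) :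
    u =ᵐ[lebI] v := by
  refine hu.1.ae_eq_of_forall_setIntegral_eq u v hv.1 fun A hA _ => ?_
  have h := (hu.2 _ (memLp_top_indicator_one hA)).symm.trans (hv.2 _ (memLp_top_indicator_one hA))
  have key : ∀ w : ℝ → ℝ, ∫ x in A, w x ∂lebI = ∫ x, w x * A.indicator (fun _ => (1 : ℝ)) x ∂lebI := by
    intro w
    rw [← integral_indicator hA]
    congr 1 with x
    by_cases hx : x ∈ A <;> simp [hx]
  rw [key, key, h]

theorem integrable_mul_memLp_top {f g : ℝ → ℝ} (hf : Integrable f lebI) (hg : MemLp g ⊤ lebI) :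
    Integrable (fun x => f x * g x) lebI :=
  hf.mul_of_top_left hg

/-- The function sought is the Radon–Nikodym density of the push-forward of `f m` under `T`. -/
theorem exists_nonneg_isTransferOf {T : ℝ → ℝ} (hT : IsPiecewiseC2Expanding T) {f : ℝ → ℝ}
    (hf : Integrable f lebI) (h0 : 0 ≤ᵐ[lebI] f) :
    ∃ u, 0 ≤ u ∧ IsTransferOf T f u := by
  have hq := hT.quasiMeasurePreserving
  set μ := lebI.withDensity fun x => ENNReal.ofReal (f x) with hμ
  have hfin : IsFiniteMeasure μ := isFiniteMeasure_withDensity_ofReal hf.2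
  have hac : μ.map T ≪ lebI :=
    ((withDensity_absolutelyContinuous _ _).map hT.measurable).trans hq.2
  have hμac : μ ≪ lebI := withDensity_absolutelyContinuous _ _
  refine ⟨fun x => ((μ.map T).rnDeriv lebI x).toReal, fun x => ENNReal.toReal_nonneg,
    Measure.integrable_toReal_rnDeriv, fun g hg => ?_⟩
  have h1 := integral_rnDeriv_smul (f := g) hac
  simp only [smul_eq_mul] at h1
  rw [h1, integral_map hT.measurable.aemeasurable (hg.1.mono_ac hac)]
  rw [hμ, integral_withDensity_eq_integral_toReal_smul₀ hf.1.aemeasurable.ennreal_ofReal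
    (.of_forall fun _ => ENNReal.ofReal_lt_top)]
  refine integral_congr_ae (h0.mono fun x hx => ?_)
  simp [ENNReal.toReal_ofReal hx]

theorem ae_abs_le_supNorm {g : ℝ → ℝ} (hg : MemLp g ⊤ lebI) : ∀ᵐ x ∂lebI, |g x| ≤ supNorm g := by
  filter_upwards [enorm_ae_le_eLpNormEssSup g lebI] with x hx
  rw [← eLpNorm_exponent_top] at hx
  have := ENNReal.toReal_mono hg.2.ne hx
  simpa [supNorm] using this

theorem MemLp.comp_transfer {T : ℝ → ℝ} (hT : IsPiecewiseC2Expanding T) {g : ℝ → ℝ}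
    (hg : MemLp g ⊤ lebI) : MemLp (fun x => g (T x)) ⊤ lebI := by
  exact memLp_top_of_bound (hg.1.comp_quasiMeasurePreserving hT.quasiMeasurePreserving) (supNorm g)
    (hT.quasiMeasurePreserving.ae (ae_abs_le_supNorm hg))

theorem IsTransferOf.add {T f g u v : ℝ → ℝ} (hT : IsPiecewiseC2Expanding T)
    (hf : Integrable f lebI) (hg : Integrable g lebI)
    (hu : IsTransferOf T f u) (hv : IsTransferOf T g v) : IsTransferOf T (f + g) (u + v) := by
  refine ⟨hu.1.add hv.1, fun k hk => ?_⟩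
  have hkT := MemLp.comp_transfer hT hk
  simp only [Pi.add_apply, add_mul]
  rw [integral_add (integrable_mul_memLp_top hf hkT) (integrable_mul_memLp_top hg hkT),
    integral_add (integrable_mul_memLp_top hu.1 hk) (integrable_mul_memLp_top hv.1 hk),
    hu.2 k hk, hv.2 k hk]

theorem IsTransferOf.smul {T f u : ℝ → ℝ} (c : ℝ) (hu : IsTransferOf T f u) :
    IsTransferOf T (c • f) (c • u) := by
  refine ⟨hu.1.smul c, fun k hk => ?_⟩
  simp only [Pi.smul_apply, smul_eq_mul, mul_assoc]
  rw [integral_const_mul, integral_const_mul, hu.2 k hk]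

theorem isTransferOf_transfer {T : ℝ → ℝ} (hT : IsPiecewiseC2Expanding T) {f : ℝ → ℝ}
    (hf : Integrable f lebI) : IsTransferOf T f (transfer T f) := by
  have H : ∃ u, IsTransferOf T f u := by
    obtain ⟨u, -, hu⟩ := exists_nonneg_isTransferOf hT hf.pos_part
      (.of_forall fun x => le_max_right _ _)
    obtain ⟨v, -, hv⟩ := exists_nonneg_isTransferOf hT hf.neg_part
      (.of_forall fun x => le_max_right _ _)
    refine ⟨u + (-1 : ℝ) • v, ?_⟩
    have := hu.add hT hf.pos_part (hf.neg_part.smul (-1 : ℝ)) (hv.smul (-1))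
    convert this using 1
    funext x
    rcases le_total 0 (f x) with h | h <;> simp [h]
  rw [transfer, dif_pos H]
  exact H.choose_spec

theorem transfer_ae_eq {T : ℝ → ℝ} (hT : IsPiecewiseC2Expanding T) {f u : ℝ → ℝ}
    (hf : Integrable f lebI) (hu : IsTransferOf T f u) : transfer T f =ᵐ[lebI] u :=
  (isTransferOf_transfer hT hf).ae_eq hu

/-- Equality is pointwise and not merely almost everywhere: the two defining predicates coincide, so
the same representative is chosen. -/
theorem transfer_congr (T : ℝ → ℝ) {f g : ℝ → ℝ} (h : f =ᵐ[lebI] g) :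
    transfer T f = transfer T g := by
  have : IsTransferOf T f = IsTransferOf T g := by
    funext u
    have key : ∀ k : ℝ → ℝ, ∫ x, f x * k (T x) ∂lebI = ∫ x, g x * k (T x) ∂lebI := fun k =>
      integral_congr_ae (h.mono fun x hx => by simp only [hx])
    simp only [IsTransferOf, key]
  unfold transfer
  rw [this]

theorem isMarkov_transfer {T : ℝ → ℝ} (hT : IsPiecewiseC2Expanding T) : IsMarkov (transfer T) where
  integrable f hf := (isTransferOf_transfer hT hf).1
  congr f g h := by rw [transfer_congr T h]
  add f g hf hg := transfer_ae_eq hT (hf.add hg)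
    ((isTransferOf_transfer hT hf).add hT hf hg (isTransferOf_transfer hT hg))
  smul c f hf := transfer_ae_eq hT (hf.smul c) ((isTransferOf_transfer hT hf).smul c)
  nonneg f hf h := by
    obtain ⟨u, hu0, hu⟩ := exists_nonneg_isTransferOf hT hf h
    exact (transfer_ae_eq hT hf hu).mono fun x hx => by rw [hx]; exact hu0 x
  integral f hf := by
    simpa using ((isTransferOf_transfer hT hf).2 (fun _ => 1) (memLp_const 1)).symm

/-! ### Essential variation and the class `BV`. -/

section EssVar

variable {E F G : Type*} [NormedAddCommGroup E] [NormedAddCommGroup F] [NormedAddCommGroup G]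

theorem essVar_congr {f g : ℝ → E} (h : f =ᵐ[lebI] g) : essVar f = essVar g := by
  unfold essVar
  congr 1 with k
  exact iInf_congr_Prop ⟨fun h' => h.symm.trans h', fun h' => h.trans h'⟩ fun _ => rfl

theorem essVar_le_of_ae_eq {f g : ℝ → E} (h : f =ᵐ[lebI] g) :
    essVar f ≤ eVariationOn g (Icc 0 1) := iInf₂_le g h

theorem exists_ae_eq_eVariationOn_lt {f : ℝ → E} {c : ENNReal} (h : essVar f < c) :
    ∃ g, f =ᵐ[lebI] g ∧ eVariationOn g (Icc 0 1) < c := by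
  simpa [essVar, iInf_lt_iff] using h

/-- Common source of the bounds for sums, multiples, absolute values, clippings and products. -/
theorem eVariationOn_le_of_edist_le {s : Set ℝ} {k : ℝ → E} {f : ℝ → F} {g : ℝ → G} {a b : ENNReal}
    (h : ∀ x ∈ s, ∀ y ∈ s, edist (k x) (k y) ≤ a * edist (f x) (f y) + b * edist (g x) (g y)) :
    eVariationOn k s ≤ a * eVariationOn f s + b * eVariationOn g s := by
  refine iSup_le fun p => ?_
  obtain ⟨n, u, hu, hus⟩ := p
  calc ∑ i ∈ Finset.range n, edist (k (u (i + 1))) (k (u i))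
      ≤ ∑ i ∈ Finset.range n, (a * edist (f (u (i + 1))) (f (u i)) +
          b * edist (g (u (i + 1))) (g (u i))) :=
        Finset.sum_le_sum fun i _ => h _ (hus _) _ (hus _)
    _ = a * ∑ i ∈ Finset.range n, edist (f (u (i + 1))) (f (u i)) +
          b * ∑ i ∈ Finset.range n, edist (g (u (i + 1))) (g (u i)) := by
        rw [Finset.sum_add_distrib, Finset.mul_sum, Finset.mul_sum]
    _ ≤ _ := by
        gcongr
        · exact eVariationOn.sum_le hu hus
        · exact eVariationOn.sum_le hu hus

theorem essVar_op_le (φ : F → G → E) {a b : ENNReal} (ha : a ≠ ⊤) (hb : b ≠ ⊤)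
    (h : ∀ x y x' y', edist (φ x y) (φ x' y') ≤ a * edist x x' + b * edist y y')
    (f : ℝ → F) (g : ℝ → G) :
    essVar (fun x => φ (f x) (g x)) ≤ a * essVar f + b * essVar g := by
  have key : ∀ f' g', f =ᵐ[lebI] f' → g =ᵐ[lebI] g' → essVar (fun x => φ (f x) (g x)) ≤
      a * eVariationOn f' (Icc 0 1) + b * eVariationOn g' (Icc 0 1) := by
    intro f' g' hf hg
    refine (essVar_le_of_ae_eq (g := fun x => φ (f' x) (g' x)) ?_).trans
      (eVariationOn_le_of_edist_le fun x _ y _ => h _ _ _ _)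
    filter_upwards [hf, hg] with x h1 h2
    rw [h1, h2]
  have : Nonempty {f' // f =ᵐ[lebI] f'} := ⟨f, .rfl⟩
  have : Nonempty {g' // g =ᵐ[lebI] g'} := ⟨g, .rfl⟩
  -- The two representatives vary independently, so the bound passes to the sum of the two infima;
  -- finite coefficients may be moved inside.
  conv_rhs => rw [essVar, essVar, iInf_subtype', iInf_subtype',
    ENNReal.mul_iInf fun h => absurd h ha, ENNReal.mul_iInf fun h => absurd h hb]
  exact ENNReal.le_iInf_add_iInf fun f' g' => key _ _ f'.2 g'.2

theorem essVar_comp_le (φ : F → E) {a : ENNReal} (ha : a ≠ ⊤)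
    (h : ∀ x x', edist (φ x) (φ x') ≤ a * edist x x') (f : ℝ → F) :
    essVar (fun x => φ (f x)) ≤ a * essVar f := by
  simpa using essVar_op_le (fun x _ => φ x) ha (b := 0) (by simp) (fun x y x' y' => by simpa using h x x') f f

theorem essVar_add_le (f g : ℝ → E) : essVar (f + g) ≤ essVar f + essVar g := by
  simpa using! essVar_op_le (fun x y : E => x + y) (a := 1) (b := 1) (by simp) (by simp)
    (fun x y x' y' => by simpa using edist_add_add_le x y x' y') f g

theorem essVar_smul_le (c : ℝ) (f : ℝ → ℝ) : essVar (c • f) ≤ ENNReal.ofReal |c| * essVar f :=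
  essVar_comp_le (fun x : ℝ => c * x) ENNReal.ofReal_ne_top (fun x y => by
    rw [edist_dist, edist_dist, ← ENNReal.ofReal_mul (abs_nonneg c), Real.dist_eq, Real.dist_eq,
      ← abs_mul, mul_sub]) f

theorem essVar_abs_le (f : ℝ → ℝ) : essVar (fun x => |f x|) ≤ essVar f := by
  simpa using essVar_comp_le (fun x : ℝ => |x|) (a := 1) (by simp) (fun x y => by
    rw [one_mul, edist_dist, edist_dist]
    exact ENNReal.ofReal_le_ofReal (abs_abs_sub_abs_le x y)) f

theorem essVar_sub_const (f : ℝ → E) (c : E) : essVar (fun x => f x - c) ≤ essVar f := by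
  simpa using essVar_comp_le (fun x : E => x - c) (a := 1) (by simp) (fun x y => by simp) f

theorem essVar_const (c : E) : essVar (fun _ : ℝ => c) = 0 :=
  le_antisymm ((essVar_le_of_ae_eq .rfl).trans
    (eVariationOn.constant_on (by rintro _ ⟨_, _, rfl⟩ _ ⟨_, _, rfl⟩; rfl)).le) zero_le

theorem essVar_re_le (f : ℝ → ℂ) : essVar (fun x => (f x).re) ≤ essVar f := by
  simpa using essVar_comp_le Complex.re (a := 1) (by simp) (fun x y => by
    rw [one_mul, edist_dist, edist_dist, Real.dist_eq, ← Complex.sub_re, dist_eq_norm]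
    exact ENNReal.ofReal_le_ofReal (Complex.abs_re_le_norm _)) f

theorem essVar_im_le (f : ℝ → ℂ) : essVar (fun x => (f x).im) ≤ essVar f := by
  simpa using essVar_comp_le Complex.im (a := 1) (by simp) (fun x y => by
    rw [one_mul, edist_dist, edist_dist, Real.dist_eq, ← Complex.sub_im, dist_eq_norm]
    exact ENNReal.ofReal_le_ofReal (Complex.abs_im_le_norm _)) f

theorem essVar_complex_le (f : ℝ → ℂ) :
    essVar f ≤ essVar (fun x => (f x).re) + essVar (fun x => (f x).im) := by
  have := essVar_op_le (fun x y : ℝ => (⟨x, y⟩ : ℂ)) (a := 1) (b := 1) (by simp) (by simp)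
    (fun x y x' y' => by
      rw [one_mul, one_mul, edist_dist, edist_dist, edist_dist,
        ← ENNReal.ofReal_add dist_nonneg dist_nonneg, dist_eq_norm, Real.dist_eq, Real.dist_eq]
      exact ENNReal.ofReal_le_ofReal (Complex.norm_le_abs_re_add_abs_im _))
    (fun x => (f x).re) (fun x => (f x).im)
  simpa using this

/-- Clipping to `[-A, A]` is 1-Lipschitz and changes `f` only on a null set. The Leibniz rule for
the variation needs bounds at every point. -/
theorem exists_ae_eq_bounded_eVariationOn_lt {f : ℝ → ℝ} {c : ENNReal} (h : essVar f < c) {A : ℝ}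
    (hA : 0 ≤ A) (hf : ∀ᵐ x ∂lebI, |f x| ≤ A) :
    ∃ g, f =ᵐ[lebI] g ∧ (∀ x, |g x| ≤ A) ∧ eVariationOn g (Icc 0 1) < c := by
  obtain ⟨g, hg, hgc⟩ := exists_ae_eq_eVariationOn_lt h
  refine ⟨fun x => max (-A) (min A (g x)), ?_, fun x => ?_, lt_of_le_of_lt ?_ hgc⟩
  · filter_upwards [hg, hf] with x h1 h2
    rw [abs_le] at h2
    rw [← h1, min_eq_right h2.2, max_eq_right h2.1]
  · rw [abs_le]
    exact ⟨le_max_left _ _, max_le (by linarith) (min_le_left _ _)⟩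
  · have := eVariationOn_le_of_edist_le (s := Icc 0 1) (k := fun x => max (-A) (min A (g x))) (f := g)
      (g := g) (a := 1) (b := 0) (fun x _ y _ => by
        rw [one_mul, zero_mul, add_zero, edist_dist, edist_dist]
        refine ENNReal.ofReal_le_ofReal ?_
        rw [Real.dist_eq, Real.dist_eq]
        calc |max (-A) (min A (g x)) - max (-A) (min A (g y))|
            ≤ max |(-A) - (-A)| |min A (g x) - min A (g y)| := abs_max_sub_max_le_max _ _ _ _
          _ ≤ max |(-A) - (-A)| (max |A - A| |g x - g y|) :=
              max_le_max le_rfl (abs_min_sub_min_le_max _ _ _ _)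
          _ = |g x - g y| := by simp)
    simpa using this

theorem essVar_mul_le {f g : ℝ → ℝ} {A B : ℝ} (hA : 0 ≤ A) (hB : 0 ≤ B)
    (hf : ∀ᵐ x ∂lebI, |f x| ≤ A) (hg : ∀ᵐ x ∂lebI, |g x| ≤ B) (hfv : essVar f < ⊤)
    (hgv : essVar g < ⊤) :
    essVar (fun x => f x * g x) ≤ ENNReal.ofReal A * essVar g + ENNReal.ofReal B * essVar f := by
  refine ENNReal.le_of_forall_pos_le_add fun ε hε _ => ?_
  -- Both representatives are chosen with excess variation `δ`; the total excess is `(A + B) δ ≤ ε`,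
  -- and the `+ 1` avoids division by zero.
  have hδ : (0 : ℝ) < ε / (A + B + 1) := by positivity
  set δ := ENNReal.ofReal (ε / (A + B + 1)) with hδd
  have hδ0 : δ ≠ 0 := by simpa [hδd] using hδ
  obtain ⟨f', hf', hfA, hfe⟩ := exists_ae_eq_bounded_eVariationOn_lt
    (ENNReal.lt_add_right hfv.ne hδ0) hA hf
  obtain ⟨g', hg', hgB, hge⟩ := exists_ae_eq_bounded_eVariationOn_lt
    (ENNReal.lt_add_right hgv.ne hδ0) hB hg
  have h1 : essVar (fun x => f x * g x) ≤ eVariationOn (fun x => f' x * g' x) (Icc 0 1) := by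
    refine essVar_le_of_ae_eq ?_
    filter_upwards [hf', hg'] with x h1 h2
    rw [h1, h2]
  have h2 := eVariationOn_le_of_edist_le (s := Icc 0 1) (k := fun x => f' x * g' x) (f := g')
    (g := f') (a := ENNReal.ofReal A) (b := ENNReal.ofReal B) (fun x _ y _ => by
      rw [edist_dist, edist_dist, edist_dist, ← ENNReal.ofReal_mul hA, ← ENNReal.ofReal_mul hB,
        ← ENNReal.ofReal_add (by positivity) (by positivity)]
      refine ENNReal.ofReal_le_ofReal ?_
      rw [Real.dist_eq, Real.dist_eq, Real.dist_eq]
      calc |f' x * g' x - f' y * g' y| = |f' x * (g' x - g' y) + g' y * (f' x - f' y)| := by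
            congr 1; ring
        _ ≤ |f' x| * |g' x - g' y| + |g' y| * |f' x - f' y| := by
            rw [← abs_mul, ← abs_mul]; exact abs_add_le _ _
        _ ≤ A * |g' x - g' y| + B * |f' x - f' y| := by
            gcongr
            · exact hfA x
            · exact hgB y)
  calc _ ≤ _ := h1.trans h2
    _ ≤ ENNReal.ofReal A * (essVar g + δ) + ENNReal.ofReal B * (essVar f + δ) := by gcongr
    _ = ENNReal.ofReal A * essVar g + ENNReal.ofReal B * essVar f +
        (ENNReal.ofReal A * δ + ENNReal.ofReal B * δ) := by ring
    _ ≤ _ := by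
        gcongr
        rw [hδd, ← ENNReal.ofReal_mul hA, ← ENNReal.ofReal_mul hB,
          ← ENNReal.ofReal_add (by positivity) (by positivity)]
        refine ENNReal.ofReal_le_of_le_toReal ?_
        have : A * (ε / (A + B + 1)) + B * (ε / (A + B + 1)) = ε * ((A + B) / (A + B + 1)) := by ring
        rw [this, ENNReal.coe_toReal]
        exact mul_le_of_le_one_right ε.2 ((div_le_one (by positivity)).2 (by linarith))

/-- For a good representative `|g x| ≤ |g y| + var g`; average over `y`, the interval having mass
one. -/
theorem ae_abs_le_essVar_add_l1Norm {f : ℝ → ℝ} (hf : IsBV f) :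
    ∀ᵐ x ∂lebI, |f x| ≤ (essVar f).toReal + l1Norm f := by
  suffices H : ∀ b, (essVar f).toReal + l1Norm f < b → ∀ᵐ x ∂lebI, |f x| ≤ b by
    have h1 := fun n : ℕ => H ((essVar f).toReal + l1Norm f + 1 / ((n : ℝ) + 1))
      (lt_add_of_pos_right _ Nat.one_div_pos_of_nat)
    filter_upwards [ae_all_iff.2 h1] with x hx
    have h2 := (tendsto_one_div_add_atTop_nhds_zero_nat (𝕜 := ℝ)).const_add
      ((essVar f).toReal + l1Norm f)
    rw [add_zero] at h2
    exact ge_of_tendsto' h2 hx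
  intro b hb
  have hlt : essVar f < ENNReal.ofReal (b - l1Norm f) :=
    (ENNReal.lt_ofReal_iff_toReal_lt hf.2.ne).2 (by linarith)
  obtain ⟨g, hg, hgv⟩ := exists_ae_eq_eVariationOn_lt hlt
  have hbv : BoundedVariationOn g (Icc 0 1) := hgv.ne_top
  have hv : (eVariationOn g (Icc 0 1)).toReal ≤ b - l1Norm f := by
    have h0 : 0 ≤ b - l1Norm f := by linarith [ENNReal.toReal_nonneg (a := essVar f)]
    exact ENNReal.toReal_le_of_le_ofReal h0 hgv.le
  have hgi : Integrable g lebI := hf.1.congr hg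
  filter_upwards [hg, ae_restrict_mem measurableSet_Icc] with x hx hxI
  rw [hx]
  have h1 : ∫ _y, |g x| ∂lebI ≤ ∫ y, (|g y| + (b - l1Norm f)) ∂lebI := by
    refine integral_mono_ae (integrable_const _) (hgi.abs.add (integrable_const _)) ?_
    filter_upwards [ae_restrict_mem measurableSet_Icc] with y hyI
    have h2 := hbv.dist_le hxI hyI
    rw [Real.dist_eq] at h2
    have h3 : |g x| ≤ |g y| + |g x - g y| := by
      calc |g x| = |g y + (g x - g y)| := by congr 1; ring
        _ ≤ _ := abs_add_le _ _
    linarith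
  rw [integral_add hgi.abs (integrable_const _)] at h1
  have h4 : ∫ y, |g y| ∂lebI = l1Norm f := (l1Norm_congr hg).symm
  simp only [integral_const, probReal_univ, one_smul] at h1
  linarith

/-- The class `BV` is closed under almost everywhere limits with bounded variation. -/
theorem essVar_lt_top_of_tendsto_ae {f : ℝ → ℝ} {F : ℕ → ℝ → ℝ} {c : ENNReal} (hc : c ≠ ⊤)
    (hF : ∀ n, essVar (F n) ≤ c)
    (hlim : ∀ᵐ x ∂lebI, Tendsto (fun n => F n x) atTop (𝓝 (f x))) : essVar f < ⊤ := by
  have h1 : ∀ n, ∃ g, F n =ᵐ[lebI] g ∧ eVariationOn g (Icc 0 1) < c + 1 := fun n =>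
    exists_ae_eq_eVariationOn_lt ((hF n).trans_lt (ENNReal.lt_add_right hc one_ne_zero))
  choose g hg hgv using h1
  set S : Set ℝ := {x | x ∈ Icc (0 : ℝ) 1 ∧ Tendsto (fun n => g n x) atTop (𝓝 (f x))} with hS
  have hSae : ∀ᵐ x ∂lebI, x ∈ S := by
    filter_upwards [hlim, ae_all_iff.2 hg, ae_restrict_mem measurableSet_Icc] with x h1 h2 h3
    exact ⟨h3, h1.congr fun n => h2 n⟩
  have hSne : S.Nonempty := hSae.exists
  -- Variation is lower semicontinuous under pointwise convergence on `S`. To bound `f` on the whole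
  -- interval, the two monotone parts of its Jordan decomposition on `S` are then extended
  -- monotonically off `S`.
  have hbv : BoundedVariationOn f S := by
    refine ne_top_of_le_ne_top (ENNReal.add_ne_top.2 ⟨hc, ENNReal.one_ne_top⟩) (b := c + 1) ?_
    by_contra hlt
    obtain ⟨n, hn⟩ := (eVariationOn.lowerSemicontinuous_aux (fun x hx => hx.2)
      (not_le.1 hlt)).exists
    exact absurd (hn.trans_le (eVariationOn.mono _ fun x hx => hx.1)) (not_lt.2 (hgv n).le)
  obtain ⟨a, ha⟩ := hSne
  set p := variationOnFromTo f S a with hp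
  have hpb : ∀ x, |p x| ≤ (eVariationOn f S).toReal := fun x =>
    variationOnFromTo.abs_le_eVariationOn hbv
  have hfb : ∀ x ∈ S, |f x| ≤ |f a| + (eVariationOn f S).toReal := fun x hx => by
    have h2 := hbv.dist_le hx ha
    rw [Real.dist_eq] at h2
    calc |f x| = |f a + (f x - f a)| := by congr 1; ring
      _ ≤ |f a| + |f x - f a| := abs_add_le _ _
      _ ≤ _ := by gcongr
  have hpm : MonotoneOn p S := variationOnFromTo.monotoneOn hbv.locallyBoundedVariationOn ha
  have hqm : MonotoneOn (p - f) S :=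
    variationOnFromTo.sub_self_monotoneOn hbv.locallyBoundedVariationOn ha
  have hext : ∀ q : ℝ → ℝ, MonotoneOn q S → ∀ C, (∀ x ∈ S, |q x| ≤ C) →
      ∃ q' : ℝ → ℝ, Monotone q' ∧ EqOn q q' S := fun q hq C hC =>
    hq.exists_monotone_extension
      ⟨-C, by rintro _ ⟨x, hx, rfl⟩; exact (abs_le.1 (hC x hx)).1⟩
      ⟨C, by rintro _ ⟨x, hx, rfl⟩; exact (abs_le.1 (hC x hx)).2⟩
  obtain ⟨p', hp'm, hp'⟩ := hext p hpm _ fun x _ => hpb x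
  obtain ⟨q', hq'm, hq'⟩ := hext (p - f) hqm
    ((eVariationOn f S).toReal + (|f a| + (eVariationOn f S).toReal)) fun x hx => by
      have h3 := abs_sub (p x) (f x)
      have h4 := hpb x
      have h5 := hfb x hx
      simp only [Pi.sub_apply]
      linarith
  have hmono : ∀ q : ℝ → ℝ, Monotone q → eVariationOn q (Icc 0 1) < ⊤ := fun q hq => by
    have := (hq.monotoneOn (Icc 0 1)).eVariationOn_eq (a := 0) (b := 1) (by simp) (by simp)
    rw [inter_self] at this
    exact this.trans_lt ENNReal.ofReal_lt_top
  have hle : essVar f ≤ eVariationOn (fun x => p' x - q' x) (Icc 0 1) := by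
    refine essVar_le_of_ae_eq (hSae.mono fun x hx => ?_)
    beta_reduce
    rw [← hp' hx, ← hq' hx]
    simp
  refine hle.trans_lt ((eVariationOn_le_of_edist_le (f := p') (g := q') (a := 1) (b := 1)
    fun x _ y _ => ?_).trans_lt (by simpa using ⟨hmono _ hp'm, hmono _ hq'm⟩))
  rw [one_mul, one_mul]
  rw [edist_dist, edist_dist, edist_dist, ← ENNReal.ofReal_add dist_nonneg dist_nonneg]
  exact ENNReal.ofReal_le_ofReal (dist_sub_sub_le _ _ _ _)

end EssVar

namespace IsBV

variable {f g : ℝ → ℝ}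

theorem congr {E : Type*} [NormedAddCommGroup E] {f g : ℝ → E} (hf : IsBV f) (h : f =ᵐ[lebI] g) :
    IsBV g := ⟨hf.1.congr h, essVar_congr h ▸ hf.2⟩

theorem add {E : Type*} [NormedAddCommGroup E] {f g : ℝ → E} (hf : IsBV f) (hg : IsBV g) :
    IsBV (f + g) :=
  ⟨hf.1.add hg.1, (essVar_add_le f g).trans_lt (ENNReal.add_lt_top.2 ⟨hf.2, hg.2⟩)⟩

theorem smul (c : ℝ) (hf : IsBV f) : IsBV (c • f) :=
  ⟨hf.1.smul c, (essVar_smul_le c f).trans_lt (ENNReal.mul_lt_top ENNReal.ofReal_lt_top hf.2)⟩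

theorem smul_complex {f : ℝ → ℂ} (c : ℂ) (hf : IsBV f) : IsBV (c • f) :=
  ⟨hf.1.smul c, (essVar_comp_le (fun z : ℂ => c * z) (a := ENNReal.ofReal ‖c‖)
    ENNReal.ofReal_ne_top (fun x y => by
      rw [edist_dist, edist_dist, ← ENNReal.ofReal_mul (norm_nonneg c), dist_eq_norm, dist_eq_norm,
        ← norm_mul, mul_sub]) f).trans_lt (ENNReal.mul_lt_top ENNReal.ofReal_lt_top hf.2)⟩

theorem const (c : ℝ) : IsBV fun _ : ℝ => c := ⟨integrable_const c, by simp [essVar_const]⟩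

theorem sub (hf : IsBV f) (hg : IsBV g) : IsBV (f - g) := by
  rw [show f - g = f + (-1 : ℝ) • g by simp [sub_eq_add_neg]]
  exact hf.add (hg.smul _)

theorem abs (hf : IsBV f) : IsBV fun x => |f x| := ⟨hf.1.abs, (essVar_abs_le f).trans_lt hf.2⟩

theorem sub_const (hf : IsBV f) (c : ℝ) : IsBV fun x => f x - c :=
  ⟨hf.1.sub (integrable_const c), (essVar_sub_const f c).trans_lt hf.2⟩

theorem memLp_top (hf : IsBV f) : MemLp f ⊤ lebI :=
  memLp_top_of_bound hf.1.1 _ (ae_abs_le_essVar_add_l1Norm hf)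

theorem mul (hf : IsBV f) (hg : IsBV g) : IsBV fun x => f x * g x :=
  ⟨integrable_mul_memLp_top hf.1 hg.memLp_top,
    (essVar_mul_le ENNReal.toReal_nonneg ENNReal.toReal_nonneg (ae_abs_le_supNorm hf.memLp_top)
      (ae_abs_le_supNorm hg.memLp_top) hf.2 hg.2).trans_lt (by
        finiteness [hf.2.ne, hg.2.ne])⟩

theorem bvNorm_eq (hf : IsBV f) : bvNorm f = ENNReal.ofReal ((essVar f).toReal + l1Norm f) := by
  rw [bvNorm, eLpNorm_one_eq_ofReal_l1Norm hf.1, ENNReal.ofReal_add ENNReal.toReal_nonneg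
    (l1Norm_nonneg f), ENNReal.ofReal_toReal hf.2.ne]

theorem re {f : ℝ → ℂ} (hf : IsBV f) : IsBV fun x => (f x).re :=
  ⟨hf.1.re, (essVar_re_le f).trans_lt hf.2⟩

theorem im {f : ℝ → ℂ} (hf : IsBV f) : IsBV fun x => (f x).im :=
  ⟨hf.1.im, (essVar_im_le f).trans_lt hf.2⟩

theorem of_re_im {f : ℝ → ℂ} (hr : IsBV fun x => (f x).re) (hi : IsBV fun x => (f x).im) : IsBV f :=
  ⟨by
    have := (hr.1.ofReal (𝕜 := ℂ)).add (hi.1.ofReal.mul_const Complex.I)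
    refine this.congr (.of_forall fun x => ?_)
    exact Complex.re_add_im (f x), (essVar_complex_le f).trans_lt (ENNReal.add_lt_top.2 ⟨hr.2, hi.2⟩)⟩

theorem ofReal (hf : IsBV f) : IsBV fun x => (f x : ℂ) :=
  of_re_im (by simpa using hf) (by simpa using const 0)

end IsBV

/-- Functions of bounded variation are dense in `L¹`. -/
theorem exists_isBV_l1Norm_sub_le {f : ℝ → ℝ} (hf : Integrable f lebI) {ε : ℝ} (hε : 0 < ε) :
    ∃ g, IsBV g ∧ l1Norm (f - g) ≤ ε := by
  obtain ⟨g, -, hg, hgc, hgi⟩ := hf.exists_hasCompactSupport_integral_sub_le (half_pos hε)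
  -- Weierstrass: polynomials are Lipschitz on `[0,1]`, hence of bounded variation.
  obtain ⟨p, hp⟩ := exists_polynomial_near_of_continuousOn 0 1 g hgc.continuousOn (ε / 2) (half_pos hε)
  have hpi : Integrable (fun x => p.eval x) lebI := p.continuous.continuousOn.integrableOn_Icc
  refine ⟨fun x => p.eval x, ⟨hpi, ?_⟩, ?_⟩
  · refine (essVar_le_of_ae_eq .rfl).trans_lt ?_
    obtain ⟨C, hC⟩ := isCompact_Icc.exists_bound_of_continuousOn
      (p.derivative.continuous.continuousOn (s := Icc (0 : ℝ) 1))
    have hl : LipschitzOnWith C.toNNReal (fun x => p.eval x) (Icc 0 1) :=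
      (convex_Icc 0 1).lipschitzOnWith_of_nnnorm_deriv_le (fun x _ => p.differentiableAt)
        fun x hx => by
          rw [← NNReal.coe_le_coe, coe_nnnorm, Polynomial.deriv]
          exact (hC x hx).trans (Real.le_coe_toNNReal C)
    have := hl.locallyBoundedVariationOn 0 1 (by simp) (by simp)
    rw [inter_self] at this
    exact lt_top_iff_ne_top.2 this
  · have h1 : l1Norm (f - g) ≤ ε / 2 := hg
    have h2 : l1Norm (g - fun x => p.eval x) ≤ ε / 2 := by
      unfold l1Norm
      calc _ ≤ ∫ _x, ε / 2 ∂lebI := by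
            refine integral_mono_ae (hgi.sub hpi).abs (integrable_const _) ?_
            filter_upwards [ae_restrict_mem measurableSet_Icc] with x hx
            rw [Pi.sub_apply, abs_sub_comm]
            exact (hp x hx).le
        _ = ε / 2 := by simp
    linarith [l1Norm_sub_triangle hf hgi hpi]

/-! ### Interval partitions and the projection onto step functions. -/

theorem lebI_eq_restrict_Ico : lebI = volume.restrict (Ico (0 : ℝ) 1) :=
  (Measure.restrict_congr_set Ico_ae_eq_Icc).symm

theorem ae_mem_Ico : ∀ᵐ x ∂lebI, x ∈ Ico (0 : ℝ) 1 := by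
  rw [lebI_eq_restrict_Ico]
  exact ae_restrict_mem measurableSet_Ico

namespace IntervalPartition

/-- The length of a cell. -/
noncomputable def len (η : IntervalPartition) (k : Fin η.d) : ℝ := η.pt k.succ - η.pt k.castSucc

/-- The average of a function over a cell. -/
noncomputable def avg (η : IntervalPartition) (f : ℝ → ℝ) (k : Fin η.d) : ℝ :=
  (η.len k)⁻¹ * ∫ x in η.pt k.castSucc..η.pt k.succ, f x

/-- The step function with prescribed values on the cells. -/
noncomputable def step (η : IntervalPartition) (c : Fin η.d → ℝ) : ℝ → ℝ :=
  fun x => ∑ k, (η.cell k).indicator (fun _ => c k) x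

variable (η : IntervalPartition)

theorem d_pos : 0 < η.d := by
  rcases Nat.eq_zero_or_pos η.d with h | h
  · have h1 := η.pt_last
    have h2 : Fin.last η.d = 0 := Fin.ext (by simp [h])
    rw [h2, η.pt_zero] at h1
    norm_num at h1
  · exact h

theorem len_pos (k : Fin η.d) : 0 < η.len k := sub_pos.2 (η.strictMono k.castSucc_lt_succ)

theorem pt_nonneg (i : Fin (η.d + 1)) : 0 ≤ η.pt i :=
  η.pt_zero ▸ η.strictMono.monotone (Fin.zero_le i)

theorem pt_le_one (i : Fin (η.d + 1)) : η.pt i ≤ 1 :=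
  η.pt_last ▸ η.strictMono.monotone (Fin.le_last i)

theorem cell_subset (k : Fin η.d) : η.cell k ⊆ Ico 0 1 := fun _ hx =>
  ⟨(η.pt_nonneg _).trans hx.1, hx.2.trans_le (η.pt_le_one _)⟩

theorem measurableSet_cell (k : Fin η.d) : MeasurableSet (η.cell k) := measurableSet_Ico

theorem disjoint_cell : Pairwise (Function.onFun Disjoint η.cell) := by
  intro j k hjk
  wlog hlt : j < k generalizing j k
  · exact (this hjk.symm (lt_of_le_of_ne (not_lt.1 hlt) hjk.symm)).symm
  refine Set.disjoint_left.2 fun x hx hy => ?_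
  have h1 : j.succ ≤ k.castSucc := by simpa [Fin.le_def, Nat.succ_le_iff] using hlt
  exact absurd (hx.2.trans_le (η.strictMono.monotone h1)) (not_lt.2 hy.1)

/-- The half-open cells miss the point `1`, which is assigned to the last one. Variation on the
closed interval sees this point. -/
theorem exists_idx {x : ℝ} (hx : x ∈ Icc (0 : ℝ) 1) : ∃ k : Fin η.d, η.pt k.castSucc ≤ x ∧
    (x < η.pt k.succ ∨ (x = 1 ∧ k.succ = Fin.last η.d)) := by
  rcases hx.2.eq_or_lt with h1 | h1
  · refine ⟨⟨η.d - 1, by have := η.d_pos; omega⟩, ?_, .inr ⟨h1, ?_⟩⟩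
    · rw [h1]; exact η.pt_le_one _
    · ext; simp; have := η.d_pos; omega
  · classical
    set S : Finset (Fin (η.d + 1)) := Finset.univ.filter fun k => η.pt k ≤ x with hS
    have hne : S.Nonempty := ⟨0, by simp [hS, η.pt_zero, hx.1]⟩
    have hm : η.pt (S.max' hne) ≤ x := by
      have := S.max'_mem hne
      simpa [hS] using this
    have hml : S.max' hne ≠ Fin.last η.d := fun h => by
      rw [h, η.pt_last] at hm; linarith
    obtain ⟨k, hk⟩ := Fin.exists_castSucc_eq.2 hml
    refine ⟨k, hk ▸ hm, .inl ?_⟩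
    by_contra hlt
    have h2 : k.succ ∈ S := by simpa [hS] using hlt
    have h3 := S.le_max' _ h2
    rw [← hk] at h3
    exact absurd h3 (not_le.2 k.castSucc_lt_succ)

theorem iUnion_cell : ⋃ k, η.cell k = Ico 0 1 := by
  refine subset_antisymm (iUnion_subset η.cell_subset) fun x hx => ?_
  obtain ⟨k, h1, h2⟩ := η.exists_idx (Ico_subset_Icc_self hx)
  exact mem_iUnion.2 ⟨k, h1, h2.resolve_right fun h => absurd h.1 hx.2.ne⟩

theorem integral_eq_sum {f : ℝ → ℝ} (hf : Integrable f lebI) :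
    ∫ x, f x ∂lebI = ∑ k, ∫ x in η.cell k, f x := by
  rw [lebI_eq_restrict_Ico] at hf ⊢
  rw [← η.iUnion_cell] at hf ⊢
  exact integral_iUnion_fintype η.measurableSet_cell η.disjoint_cell
    fun i => hf.mono_measure (Measure.restrict_mono (subset_iUnion _ i) le_rfl)

theorem restrict_cell (k : Fin η.d) : lebI.restrict (η.cell k) = volume.restrict (η.cell k) :=
  Measure.restrict_restrict_of_subset ((η.cell_subset k).trans Ico_subset_Icc_self)

theorem setIntegral_cell (k : Fin η.d) (f : ℝ → ℝ) :
    ∫ x in η.cell k, f x = ∫ x in η.pt k.castSucc..η.pt k.succ, f x := by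
  rw [intervalIntegral.integral_of_le (η.strictMono k.castSucc_lt_succ).le, cell,
    integral_Ico_eq_integral_Ioo, integral_Ioc_eq_integral_Ioo]

theorem volume_real_cell (k : Fin η.d) : volume.real (η.cell k) = η.len k := by
  rw [cell, Real.volume_real_Ico_of_le (η.strictMono k.castSucc_lt_succ).le, len]

theorem integrableOn_cell {f : ℝ → ℝ} (hf : Integrable f lebI) (k : Fin η.d) :
    IntegrableOn f (η.cell k) :=
  hf.mono_measure (Measure.restrict_mono ((η.cell_subset k).trans Ico_subset_Icc_self) le_rfl)

theorem setIntegral_cell_eq_len_mul_avg (k : Fin η.d) (f : ℝ → ℝ) :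
    ∫ x in η.cell k, f x = η.len k * η.avg f k := by
  rw [avg, setIntegral_cell, mul_inv_cancel_left₀ (η.len_pos k).ne']

theorem step_apply (c : Fin η.d → ℝ) {k : Fin η.d} {x : ℝ} (hx : x ∈ η.cell k) :
    η.step c x = c k := by
  rw [step, Finset.sum_eq_single k]
  · simp [hx]
  · intro j _ hj
    exact indicator_of_notMem (Set.disjoint_right.1 (η.disjoint_cell hj) hx) _
  · simp

theorem step_add (c c' : Fin η.d → ℝ) : η.step (c + c') = η.step c + η.step c' := by
  funext x
  simp only [step, Pi.add_apply, ← Finset.sum_add_distrib]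
  exact Finset.sum_congr rfl fun k _ => by by_cases hx : x ∈ η.cell k <;> simp [hx]

theorem step_smul (a : ℝ) (c : Fin η.d → ℝ) : η.step (a • c) = a • η.step c := by
  funext x
  simp only [step, Pi.smul_apply, Finset.smul_sum]
  exact Finset.sum_congr rfl fun k _ => by by_cases hx : x ∈ η.cell k <;> simp [hx]

theorem integrable_step (c : Fin η.d → ℝ) : Integrable (η.step c) lebI :=
  integrable_finsetSum _ fun k _ => (integrable_const (c k)).indicator (η.measurableSet_cell k)

theorem ae_eq_of_eqOn_cell {f g : ℝ → ℝ} (h : ∀ k, ∀ x ∈ η.cell k, f x = g x) : f =ᵐ[lebI] g := by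
  filter_upwards [ae_mem_Ico] with x hx
  rw [← η.iUnion_cell, mem_iUnion] at hx
  obtain ⟨k, hk⟩ := hx
  exact h k x hk

theorem avg_congr {f g : ℝ → ℝ} (h : f =ᵐ[lebI] g) (k : Fin η.d) : η.avg f k = η.avg g k := by
  rw [avg, avg, ← setIntegral_cell, ← setIntegral_cell, ← restrict_cell]
  congr 1
  exact integral_congr_ae (ae_restrict_of_ae h)

theorem avg_step (c : Fin η.d → ℝ) (k : Fin η.d) : η.avg (η.step c) k = c k := by
  have h : ∫ x in η.cell k, η.step c x = ∫ x in η.cell k, c k :=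
    setIntegral_congr_fun (η.measurableSet_cell k) fun x hx => η.step_apply c hx
  rw [setIntegral_cell_eq_len_mul_avg, setIntegral_const, volume_real_cell, smul_eq_mul] at h
  exact mul_left_cancel₀ (η.len_pos k).ne' h

theorem sigmaAlg_le_borel : η.sigmaAlg ≤ (inferInstance : MeasurableSpace ℝ) := by
  refine MeasurableSpace.generateFrom_le ?_
  rintro _ ⟨k, rfl⟩
  exact η.measurableSet_cell k

/-- Cells are atoms of the `σ`-algebra, so the conditional expectation is constant on each of them
at every point. -/
theorem mem_iff_of_measurableSet {A : Set ℝ} (hA : MeasurableSet[η.sigmaAlg] A) {k : Fin η.d}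
    {x y : ℝ} (hx : x ∈ η.cell k) (hy : y ∈ η.cell k) : x ∈ A ↔ y ∈ A := by
  induction A, hA using MeasurableSpace.generateFrom_induction with
  | hC t ht =>
    obtain ⟨j, rfl⟩ := ht
    rcases eq_or_ne j k with rfl | hjk
    · exact ⟨fun _ => hy, fun _ => hx⟩
    · have := Set.disjoint_right.1 (η.disjoint_cell hjk)
      exact ⟨fun h => absurd h (this hx), fun h => absurd h (this hy)⟩
  | empty => simp
  | compl t _ ih => exact not_congr ih
  | iUnion s _ ih => simp only [mem_iUnion, ih]

theorem proj_eq_proj (f : ℝ → ℝ) {k : Fin η.d} {x y : ℝ} (hx : x ∈ η.cell k) (hy : y ∈ η.cell k) :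
    η.proj f x = η.proj f y := by
  have h : MeasurableSet[η.sigmaAlg] (η.proj f ⁻¹' {η.proj f y}) :=
    (stronglyMeasurable_condExp (m := η.sigmaAlg)).measurable (measurableSet_singleton _)
  exact (η.mem_iff_of_measurableSet h hx hy).2 rfl

theorem proj_apply {f : ℝ → ℝ} (hf : Integrable f lebI) {k : Fin η.d} {x : ℝ} (hx : x ∈ η.cell k) :
    η.proj f x = η.avg f k := by
  have h1 : ∫ y in η.cell k, η.proj f y ∂lebI = ∫ y in η.cell k, f y ∂lebI :=
    setIntegral_condExp η.sigmaAlg_le_borel hf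
      (MeasurableSpace.measurableSet_generateFrom (mem_range_self k))
  rw [restrict_cell, setIntegral_cell_eq_len_mul_avg _ k f,
    setIntegral_congr_fun (η.measurableSet_cell k) (g := fun _ => η.proj f x)
      (fun y hy => η.proj_eq_proj f hy hx), setIntegral_const, volume_real_cell, smul_eq_mul] at h1
  exact mul_left_cancel₀ (η.len_pos k).ne' h1

theorem proj_ae_eq_step {f : ℝ → ℝ} (hf : Integrable f lebI) :
    η.proj f =ᵐ[lebI] η.step (η.avg f) :=
  η.ae_eq_of_eqOn_cell fun _ _ hx => by rw [η.proj_apply hf hx, η.step_apply _ hx]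

theorem isMarkov_proj : IsMarkov η.proj where
  integrable _ _ := integrable_condExp
  congr _ _ h := condExp_congr_ae h
  add _ _ hf hg := condExp_add hf hg _
  smul c f _ := condExp_smul c f _
  nonneg _ _ h := condExp_nonneg h
  integral _ _ := integral_condExp η.sigmaAlg_le_borel

/-- The variations over the cells add up to the total variation. -/
theorem sum_eVariationOn_cell (g : ℝ → ℝ) :
    ∑ k : Fin η.d, eVariationOn g (Icc (η.pt k.castSucc) (η.pt k.succ)) =
      eVariationOn g (Icc 0 1) := by
  -- The points are continued constantly past `d`, because `eVariationOn.sum'` takes a monotone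
  -- sequence indexed by `ℕ`.
  set E : ℕ → ℝ := fun i => η.pt ⟨min i η.d, by omega⟩ with hE
  have hmono : Monotone E := fun i j hij =>
    η.strictMono.monotone (Fin.mk_le_mk.2 (min_le_min_right _ hij))
  have h := eVariationOn.sum' g hmono (n := η.d)
  have h0 : E 0 = 0 := (congrArg η.pt (Fin.ext (by simp))).trans η.pt_zero
  have h1 : E η.d = 1 := (congrArg η.pt (Fin.ext (by simp))).trans η.pt_last
  rw [h0, h1] at h
  rw [← h, Finset.sum_range]
  refine Finset.sum_congr rfl fun k _ => ?_
  have h2 : E k = η.pt k.castSucc := congrArg η.pt (Fin.ext (by simp [k.2.le]))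
  have h3 : E (k + 1) = η.pt k.succ := congrArg η.pt (Fin.ext (by simp [Nat.succ_le_of_lt k.2]))
  rw [h2, h3]

theorem abs_sub_avg_le {g : ℝ → ℝ} (hg : Integrable g lebI) {k : Fin η.d}
    (hv : BoundedVariationOn g (Icc (η.pt k.castSucc) (η.pt k.succ))) {x : ℝ} (hx : x ∈ η.cell k) :
    |g x - η.avg g k| ≤ (eVariationOn g (Icc (η.pt k.castSucc) (η.pt k.succ))).toReal := by
  set v := (eVariationOn g (Icc (η.pt k.castSucc) (η.pt k.succ))).toReal
  have hb : ∀ y ∈ η.cell k, ‖g x - g y‖ ≤ v := fun y hy =>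
    hv.dist_le (Ico_subset_Icc_self hx) (Ico_subset_Icc_self hy)
  have h1 : ‖∫ y in η.cell k, (g x - g y)‖ ≤ v * volume.real (η.cell k) :=
    norm_setIntegral_le_of_norm_le_const measure_Ico_lt_top hb
  have hc : IntegrableOn (fun _ => g x) (η.cell k) :=
    integrableOn_const measure_Ico_lt_top.ne
  rw [integral_sub hc (η.integrableOn_cell hg k), setIntegral_const, volume_real_cell,
    setIntegral_cell_eq_len_mul_avg, smul_eq_mul, ← mul_sub, norm_mul, Real.norm_eq_abs,
    Real.norm_eq_abs, abs_of_pos (η.len_pos k), mul_comm] at h1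
  exact le_of_mul_le_mul_right h1 (η.len_pos k)

/-- On a cell `|g - avg g|` is at most the variation of `g` there; multiply by the length and sum
over the cells. The slack `δ` pays for a representative `g` of nearly minimal variation. -/
theorem l1Norm_sub_proj_le {f : ℝ → ℝ} (hf : IsBV f) {ε : ℝ} (hη : η.MeshLE ε) :
    l1Norm (f - η.proj f) ≤ ε * (essVar f).toReal := by
  have hε : 0 < ε := (η.len_pos ⟨0, η.d_pos⟩).trans_le (hη _)
  refine le_of_forall_pos_le_add fun δ hδ => ?_
  have hδ' : 0 < δ / ε := by positivity
  obtain ⟨g, hg, hgv⟩ := exists_ae_eq_eVariationOn_lt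
    (ENNReal.lt_add_right hf.2.ne (by simpa using hδ' : ENNReal.ofReal (δ / ε) ≠ 0))
  have hgi := hf.1.congr hg
  have hgt : eVariationOn g (Icc 0 1) ≠ ⊤ := hgv.ne_top
  have hk : ∀ k : Fin η.d, eVariationOn g (Icc (η.pt k.castSucc) (η.pt k.succ)) ≠ ⊤ := fun k =>
    ne_top_of_le_ne_top hgt (eVariationOn.mono _ (Icc_subset_Icc (η.pt_nonneg _) (η.pt_le_one _)))
  have h1 : l1Norm (f - η.proj f) = l1Norm (g - η.step (η.avg g)) := by
    refine l1Norm_congr (hg.sub ?_)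
    exact (η.isMarkov_proj.congr _ _ hg).trans (η.proj_ae_eq_step hgi)
  have hint : Integrable (g - η.step (η.avg g)) lebI := hgi.sub (η.integrable_step _)
  rw [h1, l1Norm, η.integral_eq_sum hint.abs]
  have h2 : ∀ k : Fin η.d, ∫ x in η.cell k, |(g - η.step (η.avg g)) x| ≤
      ε * (eVariationOn g (Icc (η.pt k.castSucc) (η.pt k.succ))).toReal := by
    intro k
    have h3 : ‖∫ x in η.cell k, |(g - η.step (η.avg g)) x|‖ ≤
        (eVariationOn g (Icc (η.pt k.castSucc) (η.pt k.succ))).toReal * volume.real (η.cell k) := by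
      refine norm_setIntegral_le_of_norm_le_const measure_Ico_lt_top fun x hx => ?_
      rw [Real.norm_eq_abs, abs_abs, Pi.sub_apply, η.step_apply _ hx]
      exact η.abs_sub_avg_le hgi (hk k) hx
    rw [volume_real_cell] at h3
    calc _ ≤ _ := (le_abs_self _).trans h3
      _ ≤ _ := by
        rw [mul_comm]
        exact mul_le_mul_of_nonneg_right (hη k) ENNReal.toReal_nonneg
  calc _ ≤ ∑ k : Fin η.d, ε * (eVariationOn g (Icc (η.pt k.castSucc) (η.pt k.succ))).toReal :=
        Finset.sum_le_sum fun k _ => h2 k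
    _ = ε * (eVariationOn g (Icc 0 1)).toReal := by
        rw [← Finset.mul_sum, ← η.sum_eVariationOn_cell, ENNReal.toReal_sum fun k _ => hk k]
    _ ≤ ε * ((essVar f).toReal + δ / ε) := by
        gcongr
        have := ENNReal.toReal_mono (by finiteness [hf.2.ne]) hgv.le
        rwa [ENNReal.toReal_add hf.2.ne ENNReal.ofReal_ne_top, ENNReal.toReal_ofReal hδ'.le] at this
    _ = _ := by field_simp

theorem intervalIntegrable_cell {g : ℝ → ℝ} (hg : Integrable g lebI) (k : Fin η.d) :
    IntervalIntegrable g volume (η.pt k.castSucc) (η.pt k.succ) := by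
  rw [intervalIntegrable_iff_integrableOn_Ico_of_le (η.strictMono k.castSucc_lt_succ).le]
  exact η.integrableOn_cell hg k

theorem intervalIntegrable_rescale {g : ℝ → ℝ} (hg : Integrable g lebI) (k : Fin η.d) :
    IntervalIntegrable (fun s => g (η.pt k.castSucc + η.len k * s)) volume 0 1 := by
  have h := ((η.intervalIntegrable_cell hg k).comp_add_left (η.pt k.castSucc)).comp_mul_left
    (c := η.len k)
  rwa [sub_self, zero_div, ← len, div_self (η.len_pos k).ne'] at h

/-- Writes the averages over all cells as integrals over one common parameter interval, so that
averages over different cells can be compared under a single integral. -/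
theorem avg_eq_integral_rescale (g : ℝ → ℝ) (k : Fin η.d) :
    η.avg g k = ∫ s in (0 : ℝ)..1, g (η.pt k.castSucc + η.len k * s) := by
  rw [intervalIntegral.integral_comp_add_mul _ (η.len_pos k).ne', avg, smul_eq_mul, mul_zero,
    add_zero, mul_one, len, add_sub_cancel]

/-- For `s ∈ [0,1]` let `φ s x` be the point at relative position `s` in the cell of `x`. Then `Π_η
f = ∫ g ∘ φ s ds`. Each `φ s` is monotone, so each `g ∘ φ s` has variation at most that of `g`, and
so has the average. -/
theorem essVar_proj_le {f : ℝ → ℝ} (hf : Integrable f lebI) : essVar (η.proj f) ≤ essVar f := by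
  refine le_iInf₂ fun g hg => ?_
  have hgi := hf.congr hg
  rcases eq_or_ne (eVariationOn g (Icc 0 1)) ⊤ with htop | htop
  · rw [htop]; exact le_top
  have hidx : ∀ x : ℝ, ∃ k : Fin η.d, x ∈ Icc (0 : ℝ) 1 → η.pt k.castSucc ≤ x ∧
      (x < η.pt k.succ ∨ (x = 1 ∧ k.succ = Fin.last η.d)) := fun x => by
    by_cases hx : x ∈ Icc (0 : ℝ) 1
    · obtain ⟨k, hk⟩ := η.exists_idx hx
      exact ⟨k, fun _ => hk⟩
    · exact ⟨⟨0, η.d_pos⟩, fun h => absurd h hx⟩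
  choose idx hidx using hidx
  have hidxm : MonotoneOn idx (Icc 0 1) := by
    intro x hx y hy hxy
    by_contra hlt
    have h1 : (idx y).succ ≤ (idx x).castSucc := by
      simpa [Fin.le_def, Nat.succ_le_iff] using not_le.1 hlt
    have h2 := (η.strictMono.monotone h1).trans ((hidx x hx).1.trans hxy)
    rcases (hidx y hy).2 with h3 | ⟨-, h3⟩
    · exact absurd h3 (not_lt.2 h2)
    · rw [h3] at h1
      exact absurd h1 (not_le.2 (Fin.castSucc_lt_last _))
  have hcell : ∀ k, ∀ x ∈ η.cell k, idx x = k := by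
    intro k x hx
    have hxI := η.cell_subset k hx
    have h1 := hidx x (Ico_subset_Icc_self hxI)
    by_contra hne
    refine Set.disjoint_left.1 (η.disjoint_cell hne) ⟨h1.1, h1.2.resolve_right fun h => ?_⟩ hx
    exact absurd h.1 hxI.2.ne
  have hae : η.proj f =ᵐ[lebI] fun x => η.avg g (idx x) := by
    refine η.ae_eq_of_eqOn_cell fun k x hx => ?_
    rw [η.proj_apply hf hx, hcell k x hx, η.avg_congr hg]
  refine (essVar_le_of_ae_eq hae).trans (iSup_le ?_)
  rintro ⟨n, u, hu, hus⟩
  set φ : ℝ → ℝ → ℝ := fun s x => η.pt (idx x).castSucc + η.len (idx x) * s with hφ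
  have hφm : ∀ s ∈ Icc (0 : ℝ) 1, MonotoneOn (φ s) (Icc 0 1) := by
    intro s hs x hx y hy hxy
    rcases (hidxm hx hy hxy).eq_or_lt with h | h
    · simp only [hφ, h, le_refl]
    · have h1 : (idx x).succ ≤ (idx y).castSucc := by
        simpa [Fin.le_def, Nat.succ_le_iff] using h
      have h2 := η.strictMono.monotone h1
      have h3 : η.len (idx x) * s ≤ η.len (idx x) := mul_le_of_le_one_right (η.len_pos _).le hs.2
      have h4 : 0 ≤ η.len (idx y) * s := mul_nonneg (η.len_pos _).le hs.1
      have h5 : η.len (idx x) = η.pt (idx x).succ - η.pt (idx x).castSucc := rfl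
      simp only [hφ]
      linarith
  have hφI : ∀ s ∈ Icc (0 : ℝ) 1, MapsTo (φ s) (Icc 0 1) (Icc 0 1) := by
    intro s hs x hx
    have h3 : η.len (idx x) * s ≤ η.len (idx x) := mul_le_of_le_one_right (η.len_pos _).le hs.2
    have h4 : 0 ≤ η.len (idx x) * s := mul_nonneg (η.len_pos _).le hs.1
    have h5 : η.len (idx x) = η.pt (idx x).succ - η.pt (idx x).castSucc := rfl
    have h6 := η.pt_nonneg (idx x).castSucc
    have h7 := η.pt_le_one (idx x).succ
    exact ⟨by simp only [hφ]; linarith, by simp only [hφ]; linarith⟩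
  have hint : ∀ x, IntervalIntegrable (fun s => g (φ s x)) volume 0 1 := fun x =>
    η.intervalIntegrable_rescale hgi (idx x)
  have hsum : ∑ i ∈ Finset.range n, |η.avg g (idx (u (i + 1))) - η.avg g (idx (u i))| ≤
      (eVariationOn g (Icc 0 1)).toReal := by
    calc ∑ i ∈ Finset.range n, |η.avg g (idx (u (i + 1))) - η.avg g (idx (u i))|
        ≤ ∑ i ∈ Finset.range n, ∫ s in (0 : ℝ)..1, |g (φ s (u (i + 1))) - g (φ s (u i))| := by
          refine Finset.sum_le_sum fun i _ => ?_
          rw [avg_eq_integral_rescale, avg_eq_integral_rescale,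
            ← intervalIntegral.integral_sub (hint _) (hint _)]
          exact intervalIntegral.abs_integral_le_integral_abs zero_le_one
      _ = ∫ s in (0 : ℝ)..1, ∑ i ∈ Finset.range n, |g (φ s (u (i + 1))) - g (φ s (u i))| :=
          (intervalIntegral.integral_finsetSum fun i _ => ((hint _).sub (hint _)).abs).symm
      _ ≤ ∫ s in (0 : ℝ)..1, (eVariationOn g (Icc 0 1)).toReal := by
          refine intervalIntegral.integral_mono_on zero_le_one
            ?_ (by simp) fun s hs => ?_
          · have := IntervalIntegrable.sum (Finset.range n)
              (f := fun i s => |g (φ s (u (i + 1))) - g (φ s (u i))|)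
              fun i _ => ((hint (u (i + 1))).sub (hint (u i))).abs
            simpa only [Finset.sum_fn] using this
          -- Monotonicity of `φ s` enters here, separately for each `s`.
          have h1 : ∑ i ∈ Finset.range n, edist (g (φ s (u (i + 1)))) (g (φ s (u i))) ≤
              eVariationOn g (Icc 0 1) :=
            (eVariationOn.sum_le (f := g ∘ φ s) hu hus).trans
              (eVariationOn.comp_le_of_monotoneOn g (φ s) (hφm s hs) (hφI s hs))
          have h2 := ENNReal.toReal_mono htop h1
          rw [ENNReal.toReal_sum fun i _ => edist_ne_top _ _] at h2
          simpa [edist_dist, Real.dist_eq] using h2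
      _ = _ := by simp
  calc ∑ i ∈ Finset.range n, edist (η.avg g (idx (u (i + 1)))) (η.avg g (idx (u i)))
      = ENNReal.ofReal (∑ i ∈ Finset.range n,
          |η.avg g (idx (u (i + 1))) - η.avg g (idx (u i))|) := by
        rw [ENNReal.ofReal_sum_of_nonneg fun i _ => abs_nonneg _]
        simp [edist_dist, Real.dist_eq]
    _ ≤ _ := ENNReal.ofReal_le_of_le_toReal hsum

theorem isBV_step (c : Fin η.d → ℝ) : IsBV (η.step c) := by
  refine ⟨η.integrable_step c, ?_⟩
  have : ∀ s : Finset (Fin η.d), essVar (fun x => ∑ k ∈ s, (η.cell k).indicator (fun _ => c k) x) < ⊤ := by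
    intro s
    classical
    induction s using Finset.induction_on with
    | empty => simp [essVar_const]
    | insert k s hk ih =>
      simp only [Finset.sum_insert hk]
      refine (essVar_add_le _ _).trans_lt (ENNReal.add_lt_top.2 ⟨?_, ih⟩)
      -- The indicator of a cell is a difference of two indicators of half-lines, which are
      -- monotone.
      have h1 : (η.cell k).indicator (fun _ => c k) = fun x =>
          (Ici (η.pt k.castSucc)).indicator (fun _ => c k) x -
            (Ici (η.pt k.succ)).indicator (fun _ => c k) x := by
        funext x
        have := η.strictMono k.castSucc_lt_succ
        simp only [cell, indicator, mem_Ico, mem_Ici]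
        split_ifs <;> grind
      have h2 : ∀ a : ℝ, IsBV ((Ici a).indicator fun _ => c k) := by
        intro a
        have h3 : (Ici a).indicator (fun _ => c k) = c k • (Ici a).indicator (fun _ => (1 : ℝ)) := by
          funext x; by_cases hx : x ∈ Ici a <;> simp [hx]
        rw [h3]
        refine IsBV.smul _ ⟨(integrable_const 1).indicator measurableSet_Ici, ?_⟩
        refine (essVar_le_of_ae_eq .rfl).trans_lt ?_
        have hm : Monotone ((Ici a).indicator fun _ => (1 : ℝ)) := by
          intro x y hxy
          simp only [indicator, mem_Ici]
          split_ifs <;> grind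
        have := (hm.monotoneOn (Icc 0 1)).eVariationOn_eq (a := 0) (b := 1) (by simp) (by simp)
        rw [inter_self] at this
        exact this.trans_lt ENNReal.ofReal_lt_top
      rw [h1]
      exact ((h2 _).sub (h2 _)).2
  exact this Finset.univ

end IntervalPartition

/-! ### Convergence to zero of a power-bounded operator. -/

/-- There is a nonprincipal ultrafilter on the positive integers that is idempotent for addition. -/
theorem exists_idempotent_ultrafilter_pnat :
    ∃ p : Ultrafilter ℕ+, (p : Filter ℕ+) ≤ cofinite ∧
      ∀ s : ℕ+ → Prop, (∀ᶠ n in (p : Filter ℕ+), s n) →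
        ∀ᶠ m in (p : Filter ℕ+), ∀ᶠ n in (p : Filter ℕ+), s (m + n) := by
  let _ := @Ultrafilter.addSemigroup ℕ+ _
  obtain ⟨p, hp⟩ := exists_idempotent_of_compact_t2_of_continuous_add_left
    (@Ultrafilter.continuous_add_left ℕ+ _)
  refine ⟨p, ?_, fun s hs => ?_⟩
  -- A principal idempotent ultrafilter would give `a + a = a`, impossible for positive integers; on
  -- `ℕ` the point `0` would be an exception.
  · rcases p.le_cofinite_or_eq_pure with h | ⟨a, rfl⟩
    · exact h
    · have h := Ultrafilter.eventually_add (pure a) (pure a) (fun n : ℕ+ => n = a)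
      rw [hp] at h
      have h' : a + a = a := by simpa using h
      exact absurd (congrArg PNat.val h') (by have := a.pos; simp only [PNat.add_coe]; omega)
  · rw [← Ultrafilter.eventually_add]
    rwa [hp]

/-- A power bounded operator `P` for which one compact set eventually absorbs the orbit of every
unit vector of a subspace `M`, and without eigenvectors of unimodular eigenvalue in `M`, satisfies
`Pⁿ x → 0` on `M`. -/
theorem tendsto_pow_zero_of_compact_absorbing {E : Type*} [NormedAddCommGroup E] [NormedSpace ℂ E]
    (P : E →ₗ[ℂ] E) (C : ℝ) (hC : ∀ (n : ℕ) (x : E), ‖(P ^ n) x‖ ≤ C * ‖x‖)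
    (M : Submodule ℂ E) (hPM : ∀ x ∈ M, P x ∈ M) (K : Set E) (hK : IsCompact K) (hKM : K ⊆ M)
    (habs : ∀ x ∈ M, ‖x‖ ≤ 1 → ∀ᶠ n : ℕ in atTop, (P ^ n) x ∈ K)
    (heig : ∀ x ∈ M, ∀ z : ℂ, ‖z‖ = 1 → P x = z • x → x = 0) (x : E) (hx : x ∈ M) :
    Tendsto (fun n : ℕ => (P ^ n) x) atTop (𝓝 0) := by
  obtain ⟨p, hpc, hpi⟩ := exists_idempotent_ultrafilter_pnat
  have hcoe : Tendsto (fun n : ℕ+ => (n : ℕ)) p atTop := by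
    have : Tendsto (fun n : ℕ+ => (n : ℕ)) cofinite cofinite :=
      PNat.coe_injective.tendsto_cofinite
    rw [Nat.cofinite_eq_atTop] at this
    exact this.mono_left hpc
  have hcont : ∀ n : ℕ, Continuous fun y => (P ^ n) y := fun n =>
    ((P ^ n).mkContinuous C (hC n)).continuous
  have hlim1 : ∀ x ∈ M, ‖x‖ ≤ 1 →
      ∃ y ∈ K, Tendsto (fun n : ℕ+ => (P ^ (n : ℕ)) x) p (𝓝 y) := by
    intro x hx hx1
    have h := hK.ultrafilter_le_nhds (p.map fun n : ℕ+ => (P ^ (n : ℕ)) x)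
      (le_principal_iff.2 (hcoe.eventually (habs x hx hx1)))
    obtain ⟨y, hy, hle⟩ := h
    exact ⟨y, hy, hle⟩
  have hlim : ∀ x ∈ M, ∃ y ∈ M, Tendsto (fun n : ℕ+ => (P ^ (n : ℕ)) x) p (𝓝 y) := by
    intro x hx
    rcases eq_or_ne x 0 with rfl | hx0
    · exact ⟨0, M.zero_mem, by simp⟩
    have hn : ‖x‖ ≠ 0 := norm_ne_zero_iff.2 hx0
    obtain ⟨y, hy, h⟩ := hlim1 (((‖x‖⁻¹ : ℝ) : ℂ) • x) (M.smul_mem _ hx)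
      (by rw [norm_smul]; simp [hn])
    refine ⟨((‖x‖ : ℝ) : ℂ) • y, M.smul_mem _ (hKM hy), ?_⟩
    refine (h.const_smul ((‖x‖ : ℝ) : ℂ)).congr fun n => ?_
    rw [map_smul, smul_smul, ← Complex.ofReal_mul, mul_inv_cancel₀ hn]
    simp
  -- The vectors of `M` fixed by the limit of `Pⁿ` along `p`.
  let Y : Submodule ℂ E :=
    { carrier := {y | y ∈ M ∧ Tendsto (fun n : ℕ+ => (P ^ (n : ℕ)) y) p (𝓝 y)}
      add_mem' := fun {a b} ha hb => ⟨M.add_mem ha.1 hb.1, by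
        simpa only [map_add] using ha.2.add hb.2⟩
      zero_mem' := ⟨M.zero_mem, by simp⟩
      smul_mem' := fun c a ha => ⟨M.smul_mem c ha.1, by
        simpa only [map_smul] using ha.2.const_smul c⟩ }
  have hPY : ∀ y ∈ Y, P y ∈ Y := by
    refine fun y hy => ⟨hPM y hy.1, ?_⟩
    have h := (hcont 1).continuousAt.tendsto.comp hy.2
    simp only [pow_one] at h
    refine h.congr fun n => ?_
    simp only [Function.comp_apply]
    rw [← Module.End.mul_apply, ← Module.End.mul_apply, (Commute.refl P).pow_right _ |>.eq]
  have hYK : ∀ y ∈ Y, ‖y‖ ≤ 1 → y ∈ K := fun y hy hy1 => by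
    obtain ⟨z, hz, h⟩ := hlim1 y hy.1 hy1
    rwa [tendsto_nhds_unique hy.2 h]
  -- The unit ball of `Y` lies in the compact set `K`. In infinite dimension Riesz's lemma gives
  -- vectors of norm at most 3 at mutual distance at least 1; scaled by `1/3` they lie in `K` and
  -- have no Cauchy subsequence.
  have hfin : FiniteDimensional ℂ Y := by
    by_contra hinf
    obtain ⟨f, hf1, hf2⟩ := exists_seq_norm_le_one_le_norm_sub' (𝕜 := ℂ) (E := Y) (c := 2)
      (by simp) (R := 3) (by norm_num) hinf
    let g : ℕ → E := fun n => (3⁻¹ : ℂ) • (f n : E)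
    have hg : ∀ n, g n ∈ K := fun n => hYK _ (Y.smul_mem _ (f n).2) (by
      have : ‖(f n : E)‖ ≤ 3 := hf1 n
      rw [norm_smul]; norm_num; linarith)
    obtain ⟨a, -, φ, hφ, ha⟩ := hK.tendsto_subseq hg
    have hc := ha.cauchySeq
    obtain ⟨N, hN⟩ := Metric.cauchySeq_iff'.1 hc (1 / 3) (by norm_num)
    have h1 := hN (N + 1) (by simp)
    have h2 : 1 ≤ ‖(f (φ (N + 1)) : E) - f (φ N)‖ :=
      hf2 (fun h => by have := hφ.injective h; omega)
    rw [dist_eq_norm] at h1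
    simp only [Function.comp_apply, g, ← smul_sub, norm_smul] at h1
    norm_num at h1
    linarith
  obtain ⟨y, hyM, hy⟩ := hlim x hx
  -- Idempotence of `p`: for `p`-many `m` and then `p`-many `n`, `P^(m+n) x` is close to `y`. The
  -- limit in `n` makes `P^m y` close to `y`.
  have hyY : y ∈ Y := by
    refine ⟨hyM, ?_⟩
    rw [Metric.tendsto_nhds]
    intro ε hε
    have h1 := hpi _ ((Metric.tendsto_nhds.1 hy) (ε / 2) (half_pos hε))
    filter_upwards [h1] with m hm
    have h2 : Tendsto (fun n : ℕ+ => dist ((P ^ ((m + n : ℕ+) : ℕ)) x) y) p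
        (𝓝 (dist ((P ^ (m : ℕ)) y) y)) := by
      refine Tendsto.dist ?_ tendsto_const_nhds
      refine ((hcont m).continuousAt.tendsto.comp hy).congr fun n => ?_
      simp [pow_add, Module.End.mul_apply]
    have h3 := le_of_tendsto h2 (hm.mono fun n hn => hn.le)
    linarith
  have hY0 : Y = ⊥ := by
    by_contra hne
    have : Nontrivial Y := Submodule.nontrivial_iff_ne_bot.2 hne
    obtain ⟨z, hz⟩ := Module.End.exists_eigenvalue (P.restrict hPY)
    obtain ⟨v, hv⟩ := hz.exists_hasEigenvector
    have hv0 : (v : E) ≠ 0 := fun h => hv.2 (Subtype.ext h)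
    have hPv : P (v : E) = z • (v : E) := congrArg Subtype.val hv.apply_eq_smul
    have hpow : ∀ n : ℕ, (P ^ n) (v : E) = z ^ n • (v : E) := by
      intro n
      induction n with
      | zero => simp
      | succ n ih => rw [pow_succ', Module.End.mul_apply, ih, map_smul, hPv, smul_smul, pow_succ]
    -- An eigenvector in `Y` satisfies `zⁿ v → v` along `p`, which forces `‖z‖ = 1`.
    have h1 : Tendsto (fun n : ℕ+ => ‖z‖ ^ (n : ℕ)) p (𝓝 1) := by
      have h2 := v.2.2.norm
      have h3 := h2.div_const ‖(v : E)‖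
      rw [div_self (norm_ne_zero_iff.2 hv0)] at h3
      refine h3.congr fun n => ?_
      rw [hpow, norm_smul, norm_pow, mul_div_cancel_right₀ _ (norm_ne_zero_iff.2 hv0)]
    have hz1 : ‖z‖ = 1 := by
      rcases lt_trichotomy ‖z‖ 1 with h | h | h
      · exact absurd (tendsto_nhds_unique h1
          ((tendsto_pow_atTop_nhds_zero_of_lt_one (norm_nonneg z) h).comp hcoe)) (by norm_num)
      · exact h
      · exact absurd ((tendsto_pow_atTop_atTop_of_one_lt h).comp hcoe) (not_tendsto_atTop_of_tendsto_nhds h1)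
    exact hv0 (heig v v.2.1 z hz1 hPv)
  have hy0 : y = 0 := by rw [hY0] at hyY; simpa using hyY
  subst hy0
  -- Power boundedness upgrades the limit along `p` to a full limit: once one iterate is small, all
  -- later ones are.
  rw [Metric.tendsto_atTop]
  intro ε hε
  have hCpos : 0 < |C| + 1 := by positivity
  obtain ⟨k, hk⟩ := ((Metric.tendsto_nhds.1 hy) (ε / (|C| + 1)) (div_pos hε hCpos)).exists
  refine ⟨k, fun n hn => ?_⟩
  obtain ⟨m, rfl⟩ := Nat.exists_eq_add_of_le' hn
  rw [dist_zero_right] at hk ⊢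
  rw [pow_add, Module.End.mul_apply]
  calc _ ≤ C * ‖(P ^ (k : ℕ)) x‖ := hC _ _
    _ ≤ (|C| + 1) * ‖(P ^ (k : ℕ)) x‖ := by
        gcongr; linarith [le_abs_self C]
    _ < (|C| + 1) * (ε / (|C| + 1)) := by gcongr
    _ = ε := by field_simp

/-! ### Complexification of Markov operators. -/

/-- The standing assumptions: `T` is piecewise `C²` and expanding, its transfer operator satisfies
a Lasota–Yorke inequality, and `1` is its simple dominant eigenvalue. -/
structure SpectralSetting (T : ℝ → ℝ) (α B₀ : ℝ) : Prop where
  expanding : IsPiecewiseC2Expanding T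
  pos : 0 < α
  lt_one : α < 1
  nonneg : 0 ≤ B₀
  lasotaYorke : LasotaYorke T α B₀
  dominant : SimpleDominantEigenvalue T

/-- The complex-linear extension of an operator on real functions. -/
noncomputable def complexify (Q : (ℝ → ℝ) → (ℝ → ℝ)) (f : ℝ → ℂ) : ℝ → ℂ := fun x =>
  (Q (fun y => (f y).re) x : ℂ) + (Q (fun y => (f y).im) x : ℂ) * Complex.I

theorem complexify_re (Q : (ℝ → ℝ) → (ℝ → ℝ)) (f : ℝ → ℂ) :
    (fun x => (complexify Q f x).re) = Q fun y => (f y).re := by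
  funext x; simp [complexify]

theorem complexify_im (Q : (ℝ → ℝ) → (ℝ → ℝ)) (f : ℝ → ℂ) :
    (fun x => (complexify Q f x).im) = Q fun y => (f y).im := by
  funext x; simp [complexify]

theorem complex_ae_ext {f g : ℝ → ℂ} (hr : (fun x => (f x).re) =ᵐ[lebI] fun x => (g x).re)
    (hi : (fun x => (f x).im) =ᵐ[lebI] fun x => (g x).im) : f =ᵐ[lebI] g := by
  filter_upwards [hr, hi] with x h1 h2 using Complex.ext h1 h2

theorem integrable_complex_of_re_im {f : ℝ → ℂ} (hr : Integrable (fun x => (f x).re) lebI)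
    (hi : Integrable (fun x => (f x).im) lebI) : Integrable f lebI := by
  have := (hr.ofReal (𝕜 := ℂ)).add (hi.ofReal.mul_const Complex.I)
  refine this.congr (.of_forall fun x => ?_)
  exact Complex.re_add_im (f x)

namespace IsMarkov

variable {Q : (ℝ → ℝ) → (ℝ → ℝ)}

theorem integrable_complexify (hQ : IsMarkov Q) {f : ℝ → ℂ} (hf : Integrable f lebI) :
    Integrable (complexify Q f) lebI :=
  integrable_complex_of_re_im (by rw [complexify_re]; exact hQ.integrable _ hf.re)
    (by rw [complexify_im]; exact hQ.integrable _ hf.im)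

theorem complexify_congr (hQ : IsMarkov Q) {f g : ℝ → ℂ} (h : f =ᵐ[lebI] g) :
    complexify Q f =ᵐ[lebI] complexify Q g :=
  complex_ae_ext
    (by rw [complexify_re, complexify_re]
        exact hQ.congr _ _ (h.mono fun x hx => by simp only [hx]))
    (by rw [complexify_im, complexify_im]
        exact hQ.congr _ _ (h.mono fun x hx => by simp only [hx]))

theorem complexify_add (hQ : IsMarkov Q) {f g : ℝ → ℂ} (hf : Integrable f lebI)
    (hg : Integrable g lebI) :
    complexify Q (f + g) =ᵐ[lebI] complexify Q f + complexify Q g := by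
  refine complex_ae_ext ?_ ?_
  · rw [complexify_re]
    refine (hQ.add (fun x => (f x).re) (fun x => (g x).re) hf.re hg.re).trans (.of_eq ?_)
    funext x; simp [complexify]
  · rw [complexify_im]
    refine (hQ.add (fun x => (f x).im) (fun x => (g x).im) hf.im hg.im).trans (.of_eq ?_)
    funext x; simp [complexify]

theorem complexify_smul (hQ : IsMarkov Q) {f : ℝ → ℂ} (c : ℂ) (hf : Integrable f lebI) :
    complexify Q (c • f) =ᵐ[lebI] c • complexify Q f := by
  have hr : Integrable (fun x => (f x).re) lebI := hf.re
  have hi : Integrable (fun x => (f x).im) lebI := hf.im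
  have key : ∀ a b : ℝ, Q (a • (fun x => (f x).re) + b • fun x => (f x).im) =ᵐ[lebI]
      a • Q (fun x => (f x).re) + b • Q fun x => (f x).im := fun a b =>
    (hQ.add _ _ (hr.smul a) (hi.smul b)).trans ((hQ.smul a _ hr).add (hQ.smul b _ hi))
  refine complex_ae_ext ?_ ?_
  · rw [complexify_re]
    have h1 : (fun y => ((c • f) y).re) =
        c.re • (fun x => (f x).re) + (-c.im) • fun x => (f x).im := by
      funext x; simp [sub_eq_add_neg]
    rw [h1]
    refine (key _ _).trans (.of_eq ?_)
    funext x; simp [complexify, sub_eq_add_neg]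
  · rw [complexify_im]
    have h1 : (fun y => ((c • f) y).im) =
        c.im • (fun x => (f x).re) + c.re • fun x => (f x).im := by
      funext x; simp [add_comm]
    rw [h1]
    refine (key _ _).trans (.of_eq ?_)
    funext x; simp [complexify, add_comm]

/-- The complexification of a Markov operator as a linear operator on complex `L¹`. -/
noncomputable def complexL1 (hQ : IsMarkov Q) : (ℝ →₁[lebI] ℂ) →ₗ[ℂ] (ℝ →₁[lebI] ℂ) where
  toFun u := (hQ.integrable_complexify (L1.integrable_coeFn u)).toL1 _
  map_add' u v := by
    rw [← Integrable.toL1_add]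
    exact (Integrable.toL1_eq_toL1_iff _ _ _ _).2 ((hQ.complexify_congr (Lp.coeFn_add u v)).trans
      (hQ.complexify_add (L1.integrable_coeFn u) (L1.integrable_coeFn v)))
  map_smul' c u := by
    rw [RingHom.id_apply, ← Integrable.toL1_smul]
    exact (Integrable.toL1_eq_toL1_iff _ _ _ _).2 ((hQ.complexify_congr (Lp.coeFn_smul c u)).trans
      (hQ.complexify_smul c (L1.integrable_coeFn u)))

theorem complexL1_coe (hQ : IsMarkov Q) (u : ℝ →₁[lebI] ℂ) :
    hQ.complexL1 u =ᵐ[lebI] complexify Q u :=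
  (hQ.integrable_complexify (L1.integrable_coeFn u)).coeFn_toL1

theorem complexL1_pow_coe (hQ : IsMarkov Q) (n : ℕ) (u : ℝ →₁[lebI] ℂ) :
    (hQ.complexL1 ^ n) u =ᵐ[lebI] complexify Q^[n] u := by
  induction n with
  | zero => exact .of_eq (by funext x; simp [complexify])
  | succ n ih =>
    rw [pow_succ', Module.End.mul_apply]
    refine (hQ.complexL1_coe _).trans ((hQ.complexify_congr ih).trans (.of_eq ?_))
    funext x
    simp only [complexify, Function.iterate_succ_apply']
    simp

/-- Real and imaginary parts are contracted separately, at the price of the factor 2; only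
uniformity in `n` matters. -/
theorem norm_complexL1_pow_le (hQ : IsMarkov Q) (n : ℕ) (u : ℝ →₁[lebI] ℂ) :
    ‖(hQ.complexL1 ^ n) u‖ ≤ 2 * ‖u‖ := by
  have hu : Integrable u lebI := L1.integrable_coeFn u
  have hre : Integrable (fun x => (u x).re) lebI := hu.re
  have him : Integrable (fun x => (u x).im) lebI := hu.im
  have hr : l1Norm (fun x => (u x).re) ≤ ‖u‖ := by
    rw [L1.norm_eq_integral_norm]
    exact integral_mono hre.abs hu.norm fun x => Complex.abs_re_le_norm _
  have hi : l1Norm (fun x => (u x).im) ≤ ‖u‖ := by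
    rw [L1.norm_eq_integral_norm]
    exact integral_mono him.abs hu.norm fun x => Complex.abs_im_le_norm _
  have hn := hQ.iterate n
  have h1 : ‖(hQ.complexL1 ^ n) u‖ ≤
      l1Norm (Q^[n] fun x => (u x).re) + l1Norm (Q^[n] fun x => (u x).im) := by
    rw [L1.norm_eq_integral_norm, integral_congr_ae
      ((hQ.complexL1_pow_coe n u).mono fun x hx => congrArg norm hx)]
    unfold l1Norm
    rw [← integral_add (hn.integrable _ hre).abs (hn.integrable _ him).abs]
    refine integral_mono (hn.integrable_complexify hu).norm
      ((hn.integrable _ hre).abs.add (hn.integrable _ him).abs) fun x => ?_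
    refine (norm_add_le _ _).trans (le_of_eq ?_)
    simp
  linarith [hn.l1Norm_le hre, hn.l1Norm_le him]

end IsMarkov

/-! ### Total boundedness in `L¹` of bounded sets of `BV`. -/

/-- The partition of the unit interval into `n + 1` cells of equal length. -/
noncomputable def uniformPartition (n : ℕ) : IntervalPartition where
  d := n + 1
  pt i := (i : ℕ) / (n + 1)
  strictMono i j hij := by
    have : ((i : ℕ) : ℝ) < (j : ℕ) := by exact_mod_cast hij
    exact div_lt_div_of_pos_right this (by positivity)
  pt_zero := by simp
  pt_last := by
    simp only [Fin.val_last]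
    push_cast
    exact div_self (by positivity)

theorem uniformPartition_meshLE (n : ℕ) : (uniformPartition n).MeshLE (1 / (n + 1)) := by
  intro k
  change (((k : ℕ) + 1 : ℕ) : ℝ) / (n + 1) - ((k : ℕ) : ℝ) / (n + 1) ≤ 1 / (n + 1)
  push_cast
  rw [← sub_div, add_sub_cancel_left]

/-- Step functions as a linear map into `L¹`. -/
noncomputable def IntervalPartition.stepL1 (η : IntervalPartition) :
    (Fin η.d → ℝ) →ₗ[ℝ] (ℝ →₁[lebI] ℝ) where
  toFun c := (η.integrable_step c).toL1 _
  map_add' c c' := by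
    rw [← Integrable.toL1_add]
    exact (Integrable.toL1_eq_toL1_iff _ _ _ _).2 (.of_eq (η.step_add c c'))
  map_smul' a c := by
    rw [RingHom.id_apply, ← Integrable.toL1_smul]
    exact (Integrable.toL1_eq_toL1_iff _ _ _ _).2 (.of_eq (η.step_smul a c))

theorem norm_toL1_eq_l1Norm {f : ℝ → ℝ} (hf : Integrable f lebI) : ‖hf.toL1 f‖ = l1Norm f := by
  rw [L1.norm_of_fun_eq_integral_norm]; rfl

theorem norm_L1_eq_l1Norm (u : ℝ →₁[lebI] ℝ) : ‖u‖ = l1Norm u := by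
  rw [L1.norm_eq_integral_norm]; rfl

/-- Sets that are bounded in `BV` are totally bounded in `L¹`. -/
theorem totallyBounded_essVar_le (R : ℝ) :
    TotallyBounded {u : ℝ →₁[lebI] ℝ | essVar u ≤ ENNReal.ofReal R ∧ ‖u‖ ≤ R} := by
  rw [Metric.totallyBounded_iff]
  intro ε hε
  -- With mesh `1/(n+1)` every element of the set is within `ε/2` of its projection. The projections
  -- have coefficients in a ball of radius `A` in a finite-dimensional space, where a finite
  -- `ε/2`-net exists.
  obtain ⟨n, hn⟩ := exists_nat_one_div_lt (show 0 < ε / 2 / (|R| + 1) by positivity)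
  set η := uniformPartition n with hη
  set A : ℝ := ∑ k, (η.len k)⁻¹ * |R| with hA
  have hcomp : IsCompact (η.stepL1 '' Metric.closedBall 0 A) :=
    (isCompact_closedBall 0 A).image η.stepL1.continuous_of_finiteDimensional
  obtain ⟨t, ht, hcov⟩ := Metric.totallyBounded_iff.1 hcomp.totallyBounded (ε / 2) (half_pos hε)
  refine ⟨t, ht, fun u hu => ?_⟩
  have hui : Integrable u lebI := L1.integrable_coeFn u
  have hubv : IsBV u := ⟨hui, hu.1.trans_lt ENNReal.ofReal_lt_top⟩
  have hR : 0 ≤ R := (norm_nonneg u).trans hu.2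
  have hmem : η.stepL1 (η.avg u) ∈ η.stepL1 '' Metric.closedBall 0 A := by
    refine mem_image_of_mem _ ?_
    have hterm : ∀ k, 0 ≤ (η.len k)⁻¹ * |R| := fun k =>
      mul_nonneg (inv_nonneg.2 (η.len_pos k).le) (abs_nonneg R)
    rw [mem_closedBall_zero_iff, pi_norm_le_iff_of_nonneg (Finset.sum_nonneg fun k _ => hterm k)]
    intro k
    refine le_trans ?_ (Finset.single_le_sum (f := fun k => (η.len k)⁻¹ * |R|)
      (fun k _ => hterm k) (Finset.mem_univ k))
    rw [IntervalPartition.avg, norm_mul, norm_inv, Real.norm_eq_abs, abs_of_pos (η.len_pos k)]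
    refine mul_le_mul_of_nonneg_left ?_ (inv_nonneg.2 (η.len_pos k).le)
    rw [← IntervalPartition.setIntegral_cell, ← IntervalPartition.restrict_cell]
    calc _ ≤ ∫ x in η.cell k, ‖u x‖ ∂lebI := norm_integral_le_integral_norm _
      _ ≤ ∫ x, ‖u x‖ ∂lebI := setIntegral_le_integral hui.norm (.of_forall fun _ => norm_nonneg _)
      _ = ‖u‖ := (L1.norm_eq_integral_norm u).symm
      _ ≤ |R| := hu.2.trans (le_abs_self R)
  have hdist : ‖u - η.stepL1 (η.avg u)‖ < ε / 2 := by
    rw [norm_L1_eq_l1Norm]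
    have h1 : l1Norm (u - η.stepL1 (η.avg u) : ℝ →₁[lebI] ℝ) = l1Norm (u - η.proj u) := by
      refine l1Norm_congr ((Lp.coeFn_sub _ _).trans ((ae_eq_refl _).sub ?_))
      exact (η.integrable_step _).coeFn_toL1.trans (η.proj_ae_eq_step hui).symm
    rw [h1]
    calc _ ≤ 1 / ((n : ℝ) + 1) * (essVar u).toReal :=
          η.l1Norm_sub_proj_le hubv (uniformPartition_meshLE n)
      _ ≤ 1 / ((n : ℝ) + 1) * R := by
          gcongr
          exact ENNReal.toReal_le_of_le_ofReal hR hu.1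
      _ ≤ 1 / ((n : ℝ) + 1) * (|R| + 1) := by
          gcongr; linarith [le_abs_self R]
      _ < ε / 2 / (|R| + 1) * (|R| + 1) := by gcongr
      _ = ε / 2 := by field_simp
  obtain ⟨y, hy, hy2⟩ := mem_iUnion₂.1 (hcov hmem)
  refine mem_iUnion₂.2 ⟨y, hy, ?_⟩
  rw [Metric.mem_ball] at hy2 ⊢
  rw [← dist_eq_norm] at hdist
  linarith [dist_triangle u (η.stepL1 (η.avg u)) y]

open scoped Pointwise in
-- The set is contained in `K + iK` with `K` the compact closure of its real analogue.
theorem totallyBounded_complex_essVar_le (R : ℝ) :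
    TotallyBounded {u : ℝ →₁[lebI] ℂ | essVar (fun x => (u x).re) ≤ ENNReal.ofReal R ∧
      essVar (fun x => (u x).im) ≤ ENNReal.ofReal R ∧ ‖u‖ ≤ R} := by
  set S := {u : ℝ →₁[lebI] ℝ | essVar u ≤ ENNReal.ofReal R ∧ ‖u‖ ≤ R}
  have hS := totallyBounded_essVar_le R
  let L : (ℝ →₁[lebI] ℝ) →L[ℝ] (ℝ →₁[lebI] ℂ) := Complex.ofRealCLM.compLpL 1 lebI
  have hK : IsCompact (closure S) :=
    hS.closure.isCompact_of_isClosed isClosed_closure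
  have h1 : IsCompact (L '' closure S) := hK.image L.continuous
  have h2 : IsCompact ((fun z => Complex.I • z) '' (L '' closure S)) :=
    h1.image (continuous_const_smul Complex.I)
  have h3 : TotallyBounded (L '' closure S + (fun z => Complex.I • z) '' (L '' closure S)) :=
    (h1.add h2).totallyBounded
  refine h3.subset fun u hu => ?_
  have hui : Integrable u lebI := L1.integrable_coeFn u
  have hr : Integrable (fun x => (u x).re) lebI := hui.re
  have hi : Integrable (fun x => (u x).im) lebI := hui.im
  refine Set.mem_add.2 ⟨L (hr.toL1 _), ⟨_, subset_closure ⟨?_, ?_⟩, rfl⟩,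
    Complex.I • L (hi.toL1 _), ⟨_, ⟨_, subset_closure ⟨?_, ?_⟩, rfl⟩, rfl⟩, ?_⟩
  · rw [essVar_congr (Integrable.coeFn_toL1 _)]; exact hu.1
  · rw [norm_toL1_eq_l1Norm]
    refine le_trans ?_ hu.2.2
    rw [L1.norm_eq_integral_norm]
    exact integral_mono hr.abs hui.norm fun x => Complex.abs_re_le_norm _
  · rw [essVar_congr (Integrable.coeFn_toL1 _)]; exact hu.2.1
  · rw [norm_toL1_eq_l1Norm]
    refine le_trans ?_ hu.2.2
    rw [L1.norm_eq_integral_norm]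
    exact integral_mono hi.abs hui.norm fun x => Complex.abs_im_le_norm _
  · refine Lp.ext ?_
    filter_upwards [Lp.coeFn_add (L (hr.toL1 _)) (Complex.I • L (hi.toL1 _)),
      Lp.coeFn_smul Complex.I (L (hi.toL1 _)), Complex.ofRealCLM.coeFn_compLpL (hr.toL1 _),
      Complex.ofRealCLM.coeFn_compLpL (hi.toL1 _), hr.coeFn_toL1, hi.coeFn_toL1]
      with x e1 e2 e3 e4 e5 e6
    rw [e1, Pi.add_apply, e2, Pi.smul_apply, e3, e4, e5, e6]
    simp [mul_comm Complex.I, Complex.re_add_im]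

/-! ### Lasota–Yorke iteration and convergence on mean-zero functions. -/

/-- A Lasota–Yorke inequality for an operator on functions, in terms of real numbers. -/
def SatisfiesLY (Q : (ℝ → ℝ) → (ℝ → ℝ)) (α B₀ : ℝ) : Prop :=
  ∀ f, IsBV f → IsBV (Q f) ∧ (essVar (Q f)).toReal ≤ α * (essVar f).toReal + B₀ * l1Norm f

namespace SatisfiesLY

variable {Q : (ℝ → ℝ) → (ℝ → ℝ)} {α B₀ : ℝ}

theorem isBV_iterate (h : SatisfiesLY Q α B₀) {f : ℝ → ℝ} (hf : IsBV f) (n : ℕ) :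
    IsBV (Q^[n] f) := by
  induction n with
  | zero => exact hf
  | succ n ih => rw [Function.iterate_succ_apply']; exact (h _ ih).1

theorem iterate_le (h : SatisfiesLY Q α B₀) (hQ : IsMarkov Q) (hα : 0 ≤ α) (hB : 0 ≤ B₀)
    {f : ℝ → ℝ} (hf : IsBV f) (n : ℕ) :
    (essVar (Q^[n] f)).toReal ≤
      α ^ n * (essVar f).toReal + (∑ k ∈ Finset.range n, α ^ k * B₀) * l1Norm f := by
  induction n with
  | zero => simp
  | succ n ih =>
    rw [Function.iterate_succ_apply']
    have h1 := (h _ (h.isBV_iterate hf n)).2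
    have h2 := (hQ.iterate n).l1Norm_le hf.1
    have h3 := mul_le_mul_of_nonneg_left ih hα
    have h4 := mul_le_mul_of_nonneg_left h2 hB
    have h5 : ∑ k ∈ Finset.range (n + 1), α ^ k * B₀ =
        α * (∑ k ∈ Finset.range n, α ^ k * B₀) + B₀ := by
      rw [Finset.sum_range_succ', Finset.mul_sum]
      simp only [pow_succ, pow_zero, one_mul]
      congr 1
      exact Finset.sum_congr rfl fun k _ => by ring
    rw [h5]
    calc _ ≤ _ := h1
      _ ≤ α * (α ^ n * (essVar f).toReal + (∑ k ∈ Finset.range n, α ^ k * B₀) * l1Norm f) +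
          B₀ * l1Norm f := add_le_add h3 h4
      _ = _ := by ring

theorem geom_sum_le (hα : 0 ≤ α) (hα1 : α < 1) (hB : 0 ≤ B₀) (n : ℕ) :
    ∑ k ∈ Finset.range n, α ^ k * B₀ ≤ B₀ / (1 - α) := by
  rw [← Finset.sum_mul, div_eq_inv_mul]
  gcongr
  have := (summable_geometric_of_lt_one hα hα1).sum_le_tsum (Finset.range n)
    (fun i _ => pow_nonneg hα i)
  rwa [tsum_geometric_of_lt_one hα hα1] at this

theorem iterate_le' (h : SatisfiesLY Q α B₀) (hQ : IsMarkov Q) (hα : 0 ≤ α) (hα1 : α < 1)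
    (hB : 0 ≤ B₀) {f : ℝ → ℝ} (hf : IsBV f) (n : ℕ) :
    (essVar (Q^[n] f)).toReal ≤ α ^ n * (essVar f).toReal + B₀ / (1 - α) * l1Norm f :=
  (h.iterate_le hQ hα hB hf n).trans (add_le_add_right (mul_le_mul_of_nonneg_right
    (geom_sum_le hα hα1 hB n) (l1Norm_nonneg f)) _)

/-- For a fixed function the term `α V f` can be absorbed on the left, as `V f` is finite. Applied
to both `P` and `P_η`. -/
theorem essVar_fixed_le (h : SatisfiesLY Q α B₀) (hα1 : α < 1) {f : ℝ → ℝ} (hf : IsBV f)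
    (hfix : Q f =ᵐ[lebI] f) : (essVar f).toReal ≤ B₀ / (1 - α) * l1Norm f := by
  have h1 := (h f hf).2
  rw [essVar_congr hfix] at h1
  rw [div_mul_eq_mul_div, le_div_iff₀ (by linarith)]
  linarith

end SatisfiesLY

namespace SpectralSetting

variable {T : ℝ → ℝ} {α B₀ : ℝ}

theorem isMarkov (hS : SpectralSetting T α B₀) : IsMarkov (transfer T) :=
  isMarkov_transfer hS.expanding

theorem satisfiesLY (hS : SpectralSetting T α B₀) : SatisfiesLY (transfer T) α B₀ := by
  intro f hf
  have h := hS.lasotaYorke f hf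
  have hl := eLpNorm_one_eq_ofReal_l1Norm hf.1
  have hlt : ENNReal.ofReal α * essVar f + ENNReal.ofReal B₀ * eLpNorm f 1 lebI ≠ ⊤ := by
    rw [hl]; finiteness [hf.2.ne]
  refine ⟨⟨hS.isMarkov.integrable f hf.1, h.trans_lt hlt.lt_top⟩, ?_⟩
  refine (ENNReal.toReal_mono hlt h).trans (le_of_eq ?_)
  rw [hl, ENNReal.toReal_add (by finiteness [hf.2.ne]) (by finiteness), ENNReal.toReal_mul,
    ENNReal.toReal_mul, ENNReal.toReal_ofReal hS.pos.le, ENNReal.toReal_ofReal hS.nonneg,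
    ENNReal.toReal_ofReal (l1Norm_nonneg f)]

/-- There is an invariant probability density of bounded variation. -/
theorem exists_density (hS : SpectralSetting T α B₀) : ∃ h : ℝ → ℝ, IsBV h ∧ 0 ≤ h ∧
    ∫ x, h x ∂lebI = 1 ∧ transfer T h =ᵐ[lebI] h := by
  obtain ⟨f, hf, hf0, hfix, -⟩ := hS.dominant.simple
  have hre : transfer T (fun x => (f x).re) =ᵐ[lebI] fun x => (f x).re := by
    -- `transferC T` unfolds to `complexify (transfer T)`.
    have := complexify_re (transfer T) f
    rw [← this]
    exact hfix.mono fun x hx => congrArg Complex.re hx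
  have him : transfer T (fun x => (f x).im) =ᵐ[lebI] fun x => (f x).im := by
    have := complexify_im (transfer T) f
    rw [← this]
    exact hfix.mono fun x hx => congrArg Complex.im hx
  obtain ⟨u, hu, hufix, hu0⟩ : ∃ u : ℝ → ℝ, IsBV u ∧ transfer T u =ᵐ[lebI] u ∧ ¬ u =ᵐ[lebI] 0 := by
    by_cases h0 : (fun x => (f x).re) =ᵐ[lebI] 0
    · refine ⟨_, hf.im, him, fun h1 => hf0 ?_⟩
      exact complex_ae_ext h0 h1
    · exact ⟨_, hf.re, hre, h0⟩
  have hpos : 0 < l1Norm u := lt_of_le_of_ne (l1Norm_nonneg u)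
    fun h => hu0 ((l1Norm_eq_zero_iff hu.1).1 h.symm)
  refine ⟨(l1Norm u)⁻¹ • fun x => |u x|, hu.abs.smul _,
    fun x => mul_nonneg (inv_nonneg.2 hpos.le) (abs_nonneg _), ?_, ?_⟩
  · simp only [Pi.smul_apply, smul_eq_mul, integral_const_mul]
    exact inv_mul_cancel₀ hpos.ne'
  · exact (hS.isMarkov.smul _ _ hu.1.abs).trans
      ((hS.isMarkov.fixed_abs hu.1 hufix).const_smul _)

/-- For `z = 1`, both `u` and the invariant density are multiples of the eigenfunction `f`. The
density has integral 1, so `∫ f ≠ 0`, and a multiple of `f` with mean zero vanishes. -/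
theorem eq_zero_of_unimodular_eigenfunction (hS : SpectralSetting T α B₀) {u : ℝ → ℂ} (hu : IsBV u)
    (hint : ∫ x, u x ∂lebI = 0) {z : ℂ} (hz : ‖z‖ = 1)
    (hfix : complexify (transfer T) u =ᵐ[lebI] z • u) : u =ᵐ[lebI] 0 := by
  rcases eq_or_ne z 1 with rfl | hz1
  · obtain ⟨f, -, -, -, hsimple⟩ := hS.dominant.simple
    have key : ∀ g : ℝ → ℂ, IsBV g → complexify (transfer T) g =ᵐ[lebI] g →
        ∃ c : ℂ, g =ᵐ[lebI] c • f := fun g hg hgfix =>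
      hsimple 1 g hg (by
        rw [Function.iterate_one]
        exact hgfix.mono fun x hx => sub_eq_zero.2 hx)
    obtain ⟨c, hc⟩ := key u hu (by simpa using hfix)
    obtain ⟨h, hh, -, hh1, hhfix⟩ := hS.exists_density
    obtain ⟨c', hc'⟩ := key (fun x => (h x : ℂ)) hh.ofReal (by
      refine complex_ae_ext ?_ ?_
      · rw [complexify_re]; simpa using hhfix
      · have h0 : transfer T 0 =ᵐ[lebI] 0 := by
          simpa using hS.isMarkov.smul 0 0 (integrable_zero _ _ _)
        rw [complexify_im]
        simp only [Complex.ofReal_im]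
        exact h0)
    have h1 : c' * ∫ x, f x ∂lebI = 1 := by
      rw [← integral_const_mul]
      calc _ = ∫ x, (h x : ℂ) ∂lebI := integral_congr_ae hc'.symm
        _ = 1 := by rw [integral_complex_ofReal, hh1, Complex.ofReal_one]
    have h2 : c * ∫ x, f x ∂lebI = 0 := by
      rw [← integral_const_mul, ← hint]
      exact integral_congr_ae hc.symm
    have hc0 : c = 0 := by
      rcases mul_eq_zero.1 h2 with h | h
      · exact h
      · rw [h, mul_zero] at h1; exact absurd h1 zero_ne_one
    simpa [hc0] using hc
  · exact hS.dominant.no_other z hz hz1 u hu hfix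

/-- On functions of bounded variation with zero mean, `Pⁿ f → 0` in `L¹`. -/
theorem tendsto_l1Norm_iterate (hS : SpectralSetting T α B₀) {f : ℝ → ℝ} (hf : IsBV f)
    (hint : ∫ x, f x ∂lebI = 0) :
    Tendsto (fun n => l1Norm ((transfer T)^[n] f)) atTop (𝓝 0) := by
  have hQ := hS.isMarkov
  have hα := hS.pos.le
  -- Large enough for the limiting variation `B₀/(1-α)` plus a remainder `αⁿ V g ≤ 1`, and for the
  -- bound 2 on the norms of the complexified iterates.
  set R : ℝ := B₀ / (1 - α) + 2 with hR
  have hR2 : 2 ≤ R := by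
    have : 0 ≤ B₀ / (1 - α) := div_nonneg hS.nonneg (by linarith [hS.lt_one])
    linarith
  let M : Submodule ℂ (ℝ →₁[lebI] ℂ) :=
    { carrier := {u | IsBV u ∧ ∫ x, u x ∂lebI = 0}
      add_mem' := fun {a b} ha hb => ⟨(ha.1.add hb.1).congr (Lp.coeFn_add a b).symm, by
        rw [integral_congr_ae (Lp.coeFn_add a b)]
        simp only [Pi.add_apply]
        rw [integral_add ha.1.1 hb.1.1, ha.2, hb.2, add_zero]⟩
      zero_mem' := ⟨(IsBV.of_re_im (f := 0) (by simpa using IsBV.const 0)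
        (by simpa using IsBV.const 0)).congr (Lp.coeFn_zero ℂ 1 lebI).symm, by
        rw [integral_congr_ae (Lp.coeFn_zero ℂ 1 lebI)]; simp⟩
      smul_mem' := fun c a ha => ⟨(ha.1.smul_complex c).congr (Lp.coeFn_smul c a).symm, by
        rw [integral_congr_ae (Lp.coeFn_smul c a)]
        simp only [Pi.smul_apply, integral_smul, ha.2, smul_zero]⟩ }
  set S : Set (ℝ →₁[lebI] ℂ) := {u | essVar (fun x => (u x).re) ≤ ENNReal.ofReal R ∧
      essVar (fun x => (u x).im) ≤ ENNReal.ofReal R ∧ ‖u‖ ≤ R} with hSdef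
  set S' : Set (ℝ →₁[lebI] ℂ) := {u | u ∈ S ∧ ∫ x, u x ∂lebI = 0} with hS'def
  have hK : IsCompact (closure S') :=
    ((totallyBounded_complex_essVar_le R).subset fun u hu => hu.1).closure.isCompact_of_isClosed
      isClosed_closure
  -- `BV` is not closed in `L¹`, but an `L¹` limit of functions with bounded variations is an almost
  -- everywhere limit along a subsequence, hence in `BV`.
  have hKM : closure S' ⊆ M := by
    intro u hu
    obtain ⟨v, hv, hlim⟩ := mem_closure_iff_seq_limit.1 hu
    obtain ⟨ns, -, hae⟩ := (tendstoInMeasure_of_tendsto_Lp hlim).exists_seq_tendsto_ae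
    have hui : Integrable u lebI := L1.integrable_coeFn u
    refine ⟨IsBV.of_re_im ⟨hui.re, ?_⟩ ⟨hui.im, ?_⟩, ?_⟩
    · exact essVar_lt_top_of_tendsto_ae (F := fun n x => (v (ns n) x).re) ENNReal.ofReal_ne_top
        (fun n => (hv (ns n)).1.1)
        (hae.mono fun x hx => (Complex.continuous_re.tendsto _).comp hx)
    · exact essVar_lt_top_of_tendsto_ae (F := fun n x => (v (ns n) x).im) ENNReal.ofReal_ne_top
        (fun n => (hv (ns n)).1.2.1)
        (hae.mono fun x hx => (Complex.continuous_im.tendsto _).comp hx)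
    · have h1 := (continuous_integral (μ := lebI) (G := ℂ)).continuousAt.tendsto.comp hlim
      refine tendsto_nhds_unique h1 ?_
      refine tendsto_const_nhds.congr fun n => ?_
      exact ((hv n).2).symm
  have hiterint : ∀ (n : ℕ) (u : ℝ →₁[lebI] ℂ), ∫ x, u x ∂lebI = 0 →
      ∫ x, ((hQ.complexL1 ^ n) u) x ∂lebI = 0 := by
    intro n u hu
    have hui : Integrable u lebI := L1.integrable_coeFn u
    have hr : Integrable (fun x => (u x).re) lebI := hui.re
    have hi : Integrable (fun x => (u x).im) lebI := hui.im
    have h1 : ∫ x, (u x).re ∂lebI = 0 := by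
      have := congrArg Complex.re hu
      rwa [← RCLike.re_eq_complex_re, ← integral_re hui, RCLike.re_eq_complex_re] at this
    have h2 : ∫ x, (u x).im ∂lebI = 0 := by
      have := congrArg Complex.im hu
      rwa [← RCLike.im_eq_complex_im, ← integral_im hui, RCLike.im_eq_complex_im] at this
    rw [integral_congr_ae (hQ.complexL1_pow_coe n u)]
    simp only [complexify]
    rw [integral_add ((hQ.iterate n).integrable _ hr).ofReal
      (((hQ.iterate n).integrable _ hi).ofReal.mul_const _), integral_mul_const,
      integral_complex_ofReal, integral_complex_ofReal, (hQ.iterate n).integral _ hr,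
      (hQ.iterate n).integral _ hi, h1, h2]
    simp
  have hiterBV : ∀ (n : ℕ) (u : ℝ →₁[lebI] ℂ), IsBV u → IsBV ((hQ.complexL1 ^ n) u) := by
    intro n u hu
    refine (IsBV.of_re_im ?_ ?_ : IsBV (complexify (transfer T)^[n] u)).congr
      (hQ.complexL1_pow_coe n u).symm
    · rw [complexify_re]; exact hS.satisfiesLY.isBV_iterate hu.re n
    · rw [complexify_im]; exact hS.satisfiesLY.isBV_iterate hu.im n
  have habs1 : ∀ g : ℝ → ℝ, IsBV g → l1Norm g ≤ 1 →
      ∀ᶠ n in atTop, essVar ((transfer T)^[n] g) ≤ ENNReal.ofReal R := by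
    intro g hg hg1
    have h1 : Tendsto (fun n => α ^ n * (essVar g).toReal) atTop (𝓝 0) := by
      simpa using (tendsto_pow_atTop_nhds_zero_of_lt_one hα hS.lt_one).mul_const (essVar g).toReal
    filter_upwards [h1.eventually_le_const zero_lt_one] with n hn
    have h2 := hS.satisfiesLY.iterate_le' hQ hα hS.lt_one hS.nonneg hg n
    have h3 : B₀ / (1 - α) * l1Norm g ≤ B₀ / (1 - α) :=
      mul_le_of_le_one_right (div_nonneg hS.nonneg (by linarith [hS.lt_one])) hg1
    rw [← ENNReal.ofReal_toReal (hS.satisfiesLY.isBV_iterate hg n).2.ne]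
    exact ENNReal.ofReal_le_ofReal (by linarith)
  have habs : ∀ u ∈ M, ‖u‖ ≤ 1 → ∀ᶠ n : ℕ in atTop, (hQ.complexL1 ^ n) u ∈ closure S' := by
    intro u hu hu1
    have hui : Integrable u lebI := L1.integrable_coeFn u
    have hr : l1Norm (fun x => (u x).re) ≤ 1 := by
      refine le_trans ?_ hu1
      rw [L1.norm_eq_integral_norm]
      exact integral_mono hu.1.re.1.abs hui.norm fun x => Complex.abs_re_le_norm _
    have hi : l1Norm (fun x => (u x).im) ≤ 1 := by
      refine le_trans ?_ hu1
      rw [L1.norm_eq_integral_norm]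
      exact integral_mono hu.1.im.1.abs hui.norm fun x => Complex.abs_im_le_norm _
    filter_upwards [habs1 _ hu.1.re hr, habs1 _ hu.1.im hi] with n h1 h2
    have hc := hQ.complexL1_pow_coe n u
    refine subset_closure ⟨⟨?_, ?_, ?_⟩, hiterint n u hu.2⟩
    · rw [essVar_congr (hc.mono fun x hx => congrArg Complex.re hx), complexify_re]; exact h1
    · rw [essVar_congr (hc.mono fun x hx => congrArg Complex.im hx), complexify_im]; exact h2
    · have := hQ.norm_complexL1_pow_le n u
      linarith
  have hPM : ∀ u ∈ M, hQ.complexL1 u ∈ M := fun u hu =>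
    ⟨by simpa using hiterBV 1 u hu.1, by simpa using hiterint 1 u hu.2⟩
  have heig : ∀ u ∈ M, ∀ z : ℂ, ‖z‖ = 1 → hQ.complexL1 u = z • u → u = 0 := by
    intro u hu z hz hzu
    have h1 : complexify (transfer T) u =ᵐ[lebI] z • u := by
      refine (hQ.complexL1_coe u).symm.trans ?_
      rw [hzu]; exact Lp.coeFn_smul z u
    have h2 := hS.eq_zero_of_unimodular_eigenfunction hu.1 hu.2 hz h1
    exact (Lp.eq_zero_iff_ae_eq_zero).2 h2
  have hfi : Integrable (fun x => (f x : ℂ)) lebI := hf.ofReal.1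
  have hfM : hfi.toL1 _ ∈ M := by
    refine ⟨hf.ofReal.congr hfi.coeFn_toL1.symm, ?_⟩
    rw [integral_congr_ae hfi.coeFn_toL1, integral_complex_ofReal, hint, Complex.ofReal_zero]
  have hlim := (tendsto_pow_zero_of_compact_absorbing hQ.complexL1 2 hQ.norm_complexL1_pow_le M hPM
    (closure S') hK hKM habs heig _ hfM).norm
  rw [norm_zero] at hlim
  refine squeeze_zero (fun n => l1Norm_nonneg _) (fun n => ?_) hlim
  rw [L1.norm_eq_integral_norm]
  refine integral_mono_ae ((hQ.iterate n).integrable f hf.1).abs (L1.integrable_coeFn _).norm ?_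
  have hcong := (hQ.iterate n).congr (fun x => ((hfi.toL1 _ : ℝ →₁[lebI] ℂ) x).re) f
    (hfi.coeFn_toL1.mono fun x hx => by simp only [hx, Complex.ofReal_re])
  filter_upwards [hQ.complexL1_pow_coe n (hfi.toL1 _), hcong] with x hx hx2
  rw [← hx2, hx]
  refine le_trans (le_of_eq ?_) (Complex.abs_re_le_norm _)
  simp [complexify]

end SpectralSetting

/-! ### Exponential decay in `BV`. -/

/-- The `BV` norm as a real number. -/
noncomputable def bvSize (f : ℝ → ℝ) : ℝ := (essVar f).toReal + l1Norm f

theorem bvSize_nonneg (f : ℝ → ℝ) : 0 ≤ bvSize f :=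
  add_nonneg ENNReal.toReal_nonneg (l1Norm_nonneg f)

theorem l1Norm_le_bvSize (f : ℝ → ℝ) : l1Norm f ≤ bvSize f :=
  le_add_of_nonneg_left ENNReal.toReal_nonneg

theorem bvSize_congr {f g : ℝ → ℝ} (h : f =ᵐ[lebI] g) : bvSize f = bvSize g := by
  rw [bvSize, bvSize, essVar_congr h, l1Norm_congr h]

theorem essVar_toReal_smul_le {f : ℝ → ℝ} (hf : IsBV f) (c : ℝ) :
    (essVar (c • f)).toReal ≤ |c| * (essVar f).toReal := by
  have h := ENNReal.toReal_mono (by finiteness [hf.2.ne]) (essVar_smul_le c f)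
  rwa [ENNReal.toReal_mul, ENNReal.toReal_ofReal (abs_nonneg c)] at h

theorem bvSize_smul_le {f : ℝ → ℝ} (hf : IsBV f) (c : ℝ) : bvSize (c • f) ≤ |c| * bvSize f := by
  rw [bvSize, bvSize, l1Norm_smul, mul_add]
  gcongr
  exact essVar_toReal_smul_le hf c

/-- Homogeneity. A function of size zero cannot be normalised; the crude bound `hC` settles that
case. -/
theorem IsMarkov.bvSize_le_of_bvSize_le_one {Q : (ℝ → ℝ) → (ℝ → ℝ)} (hQ : IsMarkov Q)
    (hBV : ∀ f, IsBV f → IsBV (Q f)) {c C : ℝ} (hC : ∀ f, IsBV f → bvSize (Q f) ≤ C * bvSize f)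
    (h : ∀ f, IsBV f → ∫ x, f x ∂lebI = 0 → bvSize f ≤ 1 → bvSize (Q f) ≤ c)
    {f : ℝ → ℝ} (hf : IsBV f) (hint : ∫ x, f x ∂lebI = 0) : bvSize (Q f) ≤ c * bvSize f := by
  rcases (bvSize_nonneg f).eq_or_lt with h0 | h0
  · have := hC f hf
    rw [← h0] at this ⊢
    linarith
  · set w := bvSize f
    have hg : IsBV (w⁻¹ • f) := hf.smul _
    have h1 : bvSize (w⁻¹ • f) ≤ 1 := by
      refine (bvSize_smul_le hf _).trans (le_of_eq ?_)
      rw [abs_of_pos (inv_pos.2 h0)]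
      exact inv_mul_cancel₀ h0.ne'
    have h2 := h _ hg (by simp [integral_const_mul, hint]) h1
    have h3 : Q f =ᵐ[lebI] w • Q (w⁻¹ • f) := by
      refine .trans (.of_eq ?_) (hQ.smul w _ hg.1)
      rw [smul_smul, mul_inv_cancel₀ h0.ne', one_smul]
    rw [bvSize_congr h3]
    calc _ ≤ |w| * bvSize (Q (w⁻¹ • f)) := bvSize_smul_le (hBV _ hg) w
      _ ≤ |w| * c := by gcongr
      _ = c * w := by rw [abs_of_pos h0, mul_comm]

namespace SpectralSetting

variable {T : ℝ → ℝ} {α B₀ : ℝ}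

theorem div_one_sub_nonneg (hS : SpectralSetting T α B₀) : 0 ≤ B₀ / (1 - α) :=
  div_nonneg hS.nonneg (by linarith [hS.lt_one])

theorem isBV_iterate (hS : SpectralSetting T α B₀) (n : ℕ) {f : ℝ → ℝ} (hf : IsBV f) :
    IsBV ((transfer T)^[n] f) := hS.satisfiesLY.isBV_iterate hf n

theorem bvSize_iterate_le (hS : SpectralSetting T α B₀) (n : ℕ) {f : ℝ → ℝ} (hf : IsBV f) :
    bvSize ((transfer T)^[n] f) ≤ (1 + B₀ / (1 - α)) * bvSize f := by
  have h1 := hS.satisfiesLY.iterate_le' hS.isMarkov hS.pos.le hS.lt_one hS.nonneg hf n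
  have h2 := (hS.isMarkov.iterate n).l1Norm_le hf.1
  have h3 : α ^ n * (essVar f).toReal ≤ (essVar f).toReal :=
    mul_le_of_le_one_left ENNReal.toReal_nonneg (pow_le_one₀ hS.pos.le hS.lt_one.le)
  have h4 := mul_nonneg hS.div_one_sub_nonneg (ENNReal.toReal_nonneg (a := essVar f))
  unfold bvSize
  linarith

/-- The mean-zero part of the `BV` unit ball has a finite `ε/2`-net in `L¹`. One `n` serves the
whole net, and the `L¹` contraction carries the bound to every other function. -/
theorem exists_l1Norm_iterate_le (hS : SpectralSetting T α B₀) {ε : ℝ} (hε : 0 < ε) :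
    ∃ n, ∀ f, IsBV f → ∫ x, f x ∂lebI = 0 → bvSize f ≤ 1 → l1Norm ((transfer T)^[n] f) ≤ ε := by
  set S : Set (ℝ →₁[lebI] ℝ) :=
    {u | (essVar u ≤ ENNReal.ofReal 1 ∧ ‖u‖ ≤ 1) ∧ ∫ x, u x ∂lebI = 0}
  have hTB : TotallyBounded S := (totallyBounded_essVar_le 1).subset fun u hu => hu.1
  obtain ⟨t, htS, htf, hcov⟩ := Metric.finite_approx_of_totallyBounded hTB (ε / 2) (half_pos hε)
  have hev : ∀ᶠ n in atTop, ∀ y ∈ t, l1Norm ((transfer T)^[n] y) ≤ ε / 2 := by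
    refine (eventually_all_finite htf).2 fun y hy => ?_
    have hy' := htS hy
    exact (hS.tendsto_l1Norm_iterate ⟨L1.integrable_coeFn y,
      hy'.1.1.trans_lt ENNReal.ofReal_lt_top⟩ hy'.2).eventually_le_const (half_pos hε)
  obtain ⟨n, hn⟩ := hev.exists
  refine ⟨n, fun f hf hint hf1 => ?_⟩
  have hfv : (essVar f).toReal ≤ 1 := by
    have := l1Norm_nonneg f; unfold bvSize at hf1; linarith
  have hfl : l1Norm f ≤ 1 := (l1Norm_le_bvSize f).trans hf1
  have hmem : hf.1.toL1 f ∈ S := by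
    refine ⟨⟨?_, by rwa [norm_toL1_eq_l1Norm]⟩, by rwa [integral_congr_ae hf.1.coeFn_toL1]⟩
    rw [essVar_congr hf.1.coeFn_toL1, ← ENNReal.ofReal_toReal hf.2.ne]
    exact ENNReal.ofReal_le_ofReal hfv
  obtain ⟨y, hy, hfy⟩ := mem_iUnion₂.1 (hcov hmem)
  have hyi : Integrable y lebI := L1.integrable_coeFn y
  have h1 : l1Norm (f - y) < ε / 2 := by
    rw [Metric.mem_ball, dist_eq_norm, norm_L1_eq_l1Norm] at hfy
    refine lt_of_eq_of_lt (l1Norm_congr ?_) hfy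
    exact (hf.1.coeFn_toL1.symm.sub (ae_eq_refl _)).trans (Lp.coeFn_sub _ _).symm
  have hQ := hS.isMarkov.iterate n
  have h2 := hQ.l1Norm_le (hf.1.sub hyi)
  rw [l1Norm_congr (hQ.sub hf.1 hyi)] at h2
  have h3 := l1Norm_add_le ((hQ.integrable _ hf.1).sub (hQ.integrable _ hyi)) (hQ.integrable _ hyi)
  rw [sub_add_cancel] at h3
  linarith [hn y hy]

theorem exists_bvSize_iterate_le_half (hS : SpectralSetting T α B₀) :
    ∃ n, 0 < n ∧ ∀ f, IsBV f → ∫ x, f x ∂lebI = 0 →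
      bvSize ((transfer T)^[n] f) ≤ 1 / 2 * bvSize f := by
  set b := B₀ / (1 - α)
  have hb : 0 ≤ b := hS.div_one_sub_nonneg
  -- After `n` steps the variation is at most `1 + b` and the `L¹` norm is tiny. After `m` more, the
  -- size is at most `αᵐ (1 + b) + (1 + b) ‖Pⁿ f‖₁ ≤ 1/4 + 1/4`.
  obtain ⟨n, hn⟩ := hS.exists_l1Norm_iterate_le (ε := 1 / 4 / (1 + b)) (by positivity)
  have h1 : Tendsto (fun m => α ^ m * (1 + b)) atTop (𝓝 0) := by
    simpa using (tendsto_pow_atTop_nhds_zero_of_lt_one hS.pos.le hS.lt_one).mul_const (1 + b)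
  obtain ⟨m, hm, hm1⟩ := ((h1.eventually_le_const (show (0 : ℝ) < 1 / 4 by norm_num)).and
    (eventually_gt_atTop 0)).exists
  refine ⟨m + n, by omega, fun f hf hint => (hS.isMarkov.iterate (m + n)).bvSize_le_of_bvSize_le_one
    (fun f hf => hS.isBV_iterate _ hf) (fun f hf => hS.bvSize_iterate_le _ hf) ?_ hf hint⟩
  intro f hf hint hf1
  have hl := hn f hf hint hf1
  rw [Function.iterate_add_apply]
  have h2 := hS.satisfiesLY.iterate_le' hS.isMarkov hS.pos.le hS.lt_one hS.nonneg
    (hS.isBV_iterate n hf) m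
  have h3 := (hS.isMarkov.iterate m).l1Norm_le (hS.isBV_iterate n hf).1
  have h4 : (essVar ((transfer T)^[n] f)).toReal ≤ 1 + b := by
    have h5 := hS.bvSize_iterate_le n hf
    have h6 : (1 + b) * bvSize f ≤ 1 + b := mul_le_of_le_one_right (by positivity) hf1
    have h7 := l1Norm_nonneg ((transfer T)^[n] f)
    unfold bvSize at h5 h6
    linarith
  have h8 : α ^ m * (essVar ((transfer T)^[n] f)).toReal ≤ α ^ m * (1 + b) :=
    mul_le_mul_of_nonneg_left h4 (pow_nonneg hS.pos.le m)
  have h9 : (1 + b) * l1Norm ((transfer T)^[n] f) ≤ 1 / 4 := by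
    calc _ ≤ (1 + b) * (1 / 4 / (1 + b)) := by gcongr
      _ = 1 / 4 := by field_simp
  unfold bvSize
  linarith

/-- Exponential decay in `BV` on functions with zero mean. -/
theorem exists_decayBound (hS : SpectralSetting T α B₀) :
    ∃ C ρ : ℝ, 0 < C ∧ α < ρ ∧ ρ < 1 ∧ DecayBound T C ρ := by
  obtain ⟨N, hN, hhalf⟩ := hS.exists_bvSize_iterate_le_half
  -- Any `ρ < 1` close enough to 1 satisfies both demands; `ρᴺ ≥ 1/2` lets a halving over `N` steps
  -- be read as decay at rate `ρ`.
  obtain ⟨ρ, hαρ, hρ1, hρN⟩ : ∃ ρ, α < ρ ∧ ρ < 1 ∧ 1 / 2 ≤ ρ ^ N := by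
    have h1 : Tendsto (fun x : ℝ => x ^ N) (𝓝[<] 1) (𝓝 1) := by
      have := ((continuous_pow N).tendsto (1 : ℝ)).mono_left (nhdsWithin_le_nhds (s := Iio 1))
      simpa using this
    have h2 := h1.eventually_const_le (show (1 / 2 : ℝ) < 1 by norm_num)
    have h3 : ∀ᶠ x in 𝓝[<] (1 : ℝ), α < x :=
      nhdsWithin_le_nhds (eventually_gt_nhds hS.lt_one)
    obtain ⟨ρ, h4, h5, h6⟩ := (h3.and (h2.and self_mem_nhdsWithin)).exists
    exact ⟨ρ, h4, h6, h5⟩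
  have hρ0 : 0 < ρ := hS.pos.trans hαρ
  set C₀ := 1 + B₀ / (1 - α)
  have hC₀ : 0 < C₀ := by have := hS.div_one_sub_nonneg; positivity
  -- With `n = N q + r` and `r < N`, `C₀` pays for the last `r` steps, and the 2 comes from `ρ^r ≥
  -- ρᴺ ≥ 1/2`.
  refine ⟨2 * C₀, ρ, by positivity, hαρ, hρ1, fun f hf hint n => ?_⟩
  have hq : ∀ q : ℕ, bvSize ((transfer T)^[N * q] f) ≤ (1 / 2) ^ q * bvSize f := by
    intro q
    induction q with
    | zero => simp
    | succ q ih =>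
      rw [Nat.mul_succ, add_comm, Function.iterate_add_apply]
      have h1 := hhalf _ (hS.isBV_iterate (N * q) hf)
        (((hS.isMarkov.iterate (N * q)).integral f hf.1).trans hint)
      rw [pow_succ]
      linarith
  have hsize : bvSize ((transfer T)^[n] f) ≤ 2 * C₀ * ρ ^ n * bvSize f := by
    have hdiv := Nat.mod_add_div n N
    set q := n / N
    set r := n % N with hr
    have hrN : r < N := Nat.mod_lt _ hN
    have h1 : bvSize ((transfer T)^[n] f) ≤ C₀ * bvSize ((transfer T)^[N * q] f) := by
      rw [← hdiv, Function.iterate_add_apply]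
      exact hS.bvSize_iterate_le r (hS.isBV_iterate _ hf)
    have h2 : (1 / 2 : ℝ) ^ q ≤ 2 * ρ ^ n := by
      have h3 : (1 / 2 : ℝ) ^ q ≤ ρ ^ (N * q) := by
        rw [pow_mul]; exact pow_le_pow_left₀ (by norm_num) hρN q
      have h4 : ρ ^ (N * q) * (1 / 2) ≤ ρ ^ n := by
        calc ρ ^ (N * q) * (1 / 2) ≤ ρ ^ (N * q) * ρ ^ r := by
              gcongr
              exact hρN.trans (pow_le_pow_of_le_one hρ0.le hρ1.le hrN.le)
          _ = ρ ^ n := by rw [← pow_add, add_comm, hdiv]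
      linarith
    calc _ ≤ _ := h1
      _ ≤ C₀ * ((1 / 2) ^ q * bvSize f) := by gcongr; exact hq q
      _ ≤ C₀ * (2 * ρ ^ n * bvSize f) := by
          gcongr; exact bvSize_nonneg f
      _ = _ := by ring
  rw [hf.bvNorm_eq, (hS.isBV_iterate n hf).bvNorm_eq, ← ENNReal.ofReal_mul (by positivity)]
  exact ENNReal.ofReal_le_ofReal hsize

/-- Approximate `f` by `g ∈ BV` and subtract the mean `c` of `g`. Since `f` has mean zero, `|c| ≤ ‖g
- f‖₁`, so the corrected function is still close to `f`. -/
theorem tendsto_l1Norm_iterate_of_integrable (hS : SpectralSetting T α B₀) {f : ℝ → ℝ}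
    (hf : Integrable f lebI) (hint : ∫ x, f x ∂lebI = 0) :
    Tendsto (fun n => l1Norm ((transfer T)^[n] f)) atTop (𝓝 0) := by
  rw [Metric.tendsto_atTop]
  intro ε hε
  obtain ⟨g, hg, hgf⟩ := exists_isBV_l1Norm_sub_le hf (show 0 < ε / 4 by linarith)
  set c := ∫ x, g x ∂lebI with hc
  have hk : IsBV fun x => g x - c := hg.sub_const c
  have hkint : ∫ x, (g x - c) ∂lebI = 0 := by
    rw [integral_sub hg.1 (integrable_const c)]; simp [hc]
  have hcb : |c| ≤ ε / 4 := by
    have h1 := abs_integral_le_l1Norm (g - f)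
    simp only [Pi.sub_apply] at h1
    rw [integral_sub hg.1 hf, hint, sub_zero, l1Norm_sub_comm] at h1
    exact h1.trans hgf
  have hfk : l1Norm (f - fun x => g x - c) ≤ ε / 2 := by
    have h1 := l1Norm_sub_triangle hf hg.1 hk.1
    have h2 : l1Norm (g - fun x => g x - c) = |c| := by
      simp [l1Norm]
    linarith
  obtain ⟨N, hN⟩ := (hS.tendsto_l1Norm_iterate hk hkint).eventually_lt_const (half_pos hε)
    |> eventually_atTop.1
  refine ⟨N, fun n hn => ?_⟩
  rw [Real.dist_eq, sub_zero, abs_of_nonneg (l1Norm_nonneg _)]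
  have hQ := hS.isMarkov.iterate n
  have h2 := hQ.l1Norm_le (hf.sub hk.1)
  rw [l1Norm_congr (hQ.sub hf hk.1)] at h2
  have h3 := l1Norm_add_le ((hQ.integrable _ hf).sub (hQ.integrable _ hk.1)) (hQ.integrable _ hk.1)
  rw [sub_add_cancel] at h3
  linarith [hN n hn]

end SpectralSetting

/-! ### The unique absolutely continuous invariant probability measure. -/

/-- `h` is an invariant probability density of bounded variation. -/
structure IsInvariantDensity (T h : ℝ → ℝ) : Prop where
  isBV : IsBV h
  nonneg : 0 ≤ h
  integral : ∫ x, h x ∂lebI = 1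
  fixed : transfer T h =ᵐ[lebI] h

namespace SpectralSetting

variable {T : ℝ → ℝ} {α B₀ : ℝ} {h : ℝ → ℝ}

/-- The fixed function `g - c h` has mean zero: the norms of its iterates are constant and tend to
zero. -/
theorem fixed_eq_smul (hS : SpectralSetting T α B₀) (hh : IsInvariantDensity T h) {g : ℝ → ℝ}
    (hg : Integrable g lebI) (hfix : transfer T g =ᵐ[lebI] g) :
    g =ᵐ[lebI] (∫ x, g x ∂lebI) • h := by
  set c := ∫ x, g x ∂lebI
  have hch : Integrable (c • h) lebI := hh.isBV.1.smul c
  have hint : ∫ x, (g - c • h) x ∂lebI = 0 := by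
    simp only [Pi.sub_apply]
    rw [integral_sub hg hch]
    simp [integral_const_mul, hh.integral, c]
  have hfix' : transfer T (g - c • h) =ᵐ[lebI] g - c • h :=
    (hS.isMarkov.sub hg hch).trans
      (hfix.sub ((hS.isMarkov.smul c h hh.isBV.1).trans (hh.fixed.const_smul c)))
  have h1 := hS.tendsto_l1Norm_iterate_of_integrable (hg.sub hch) hint
  have h2 : l1Norm (g - c • h) = 0 :=
    tendsto_nhds_unique (tendsto_const_nhds.congr fun n =>
      l1Norm_congr (hS.isMarkov.iterate_of_fixed hfix' n).symm) h1
  exact ((l1Norm_eq_zero_iff (hg.sub hch)).1 h2).mono fun x hx => sub_eq_zero.1 hx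

theorem integral_withDensity (hh : IsInvariantDensity T h) (f : ℝ → ℝ) :
    ∫ x, f x ∂(lebI.withDensity fun x => ENNReal.ofReal (h x)) = ∫ x, f x * h x ∂lebI := by
  rw [integral_withDensity_eq_integral_toReal_smul₀ hh.isBV.1.1.aemeasurable.ennreal_ofReal
    (.of_forall fun _ => ENNReal.ofReal_lt_top)]
  refine integral_congr_ae (.of_forall fun x => ?_)
  simp [ENNReal.toReal_ofReal (hh.nonneg x), mul_comm]

theorem isACIP_withDensity (hS : SpectralSetting T α B₀) (hh : IsInvariantDensity T h) :
    IsACIP T (lebI.withDensity fun x => ENNReal.ofReal (h x)) where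
  prob := ⟨by
    rw [withDensity_apply _ .univ, Measure.restrict_univ,
      ← ofReal_integral_eq_lintegral_ofReal hh.isBV.1 (.of_forall hh.nonneg), hh.integral,
      ENNReal.ofReal_one]⟩
  absCont := withDensity_absolutelyContinuous _ _
  invariant := by
    refine ⟨hS.expanding.measurable, Measure.ext fun A hA => ?_⟩
    have hA' := hS.expanding.measurable hA
    rw [Measure.map_apply hS.expanding.measurable hA, withDensity_apply _ hA,
      withDensity_apply _ hA',
      ← ofReal_integral_eq_lintegral_ofReal hh.isBV.1.integrableOn (.of_forall hh.nonneg),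
      ← ofReal_integral_eq_lintegral_ofReal hh.isBV.1.integrableOn (.of_forall hh.nonneg)]
    congr 1
    have h1 := (isTransferOf_transfer hS.expanding hh.isBV.1).2 _ (memLp_top_indicator_one hA)
    rw [← integral_indicator hA, ← integral_indicator hA']
    have h2 : ∫ x, transfer T h x * A.indicator (fun _ => (1 : ℝ)) x ∂lebI =
        ∫ x, A.indicator h x ∂lebI := by
      refine integral_congr_ae (hh.fixed.mono fun x hx => ?_)
      by_cases hxA : x ∈ A <;> simp [hxA, hx]
    rw [← h2, ← h1]
    congr 1 with x
    by_cases hxA : T x ∈ A <;> simp [hxA]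

/-- Invariance of `ν` says that its density is fixed by `P`, and integrable fixed functions are
multiples of `h`. -/
theorem isACIP_unique (hS : SpectralSetting T α B₀) (hh : IsInvariantDensity T h) {ν : Measure ℝ}
    (hν : IsACIP T ν) : ν = lebI.withDensity fun x => ENNReal.ofReal (h x) := by
  have := hν.prob
  set g : ℝ → ℝ := fun x => (ν.rnDeriv lebI x).toReal
  have hg : Integrable g lebI := Measure.integrable_toReal_rnDeriv
  have hgint : ∀ φ : ℝ → ℝ, ∫ x, g x * φ x ∂lebI = ∫ x, φ x ∂ν := fun φ =>
    integral_rnDeriv_smul hν.absCont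
  have hfix : transfer T g =ᵐ[lebI] g := by
    refine transfer_ae_eq hS.expanding hg ⟨hg, fun φ hφ => ?_⟩
    rw [hgint, hgint]
    have h1 : AEStronglyMeasurable φ (ν.map T) := by
      rw [hν.invariant.map_eq]; exact hφ.1.mono_ac hν.absCont
    rw [← integral_map hS.expanding.measurable.aemeasurable h1, hν.invariant.map_eq]
  have hg1 : ∫ x, g x ∂lebI = 1 := by
    have := hgint fun _ => 1
    simpa using this
  have hgh := hS.fixed_eq_smul hh hg hfix
  rw [hg1, one_smul] at hgh
  rw [← Measure.withDensity_rnDeriv_eq ν lebI hν.absCont]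
  refine withDensity_congr_ae ?_
  filter_upwards [hgh, Measure.rnDeriv_lt_top ν lebI] with x h1 h2
  rw [← h1, ENNReal.ofReal_toReal h2.ne]

end SpectralSetting

/-! ### Densities and centered observables. -/

theorem supNorm_nonneg (f : ℝ → ℝ) : 0 ≤ supNorm f := ENNReal.toReal_nonneg

theorem l1Norm_mul_le {f g : ℝ → ℝ} {A : ℝ} (hf : ∀ᵐ x ∂lebI, |f x| ≤ A) (hfm : MemLp f ⊤ lebI)
    (hg : Integrable g lebI) : l1Norm (fun x => f x * g x) ≤ A * l1Norm g := by
  have hi : Integrable (fun x => f x * g x) lebI := by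
    simpa only [mul_comm] using integrable_mul_memLp_top hg hfm
  unfold l1Norm
  rw [← integral_const_mul]
  refine integral_mono_ae hi.abs (hg.abs.const_mul A) (hf.mono fun x hx => ?_)
  simp only [abs_mul]
  exact mul_le_mul_of_nonneg_right hx (abs_nonneg _)

theorem abs_integral_mul_le {f g : ℝ → ℝ} {A : ℝ} (hf : ∀ᵐ x ∂lebI, |f x| ≤ A)
    (hfm : MemLp f ⊤ lebI) (hg : Integrable g lebI) :
    |∫ x, g x * f x ∂lebI| ≤ A * l1Norm g := by
  simp only [mul_comm (g _)]
  exact (abs_integral_le_l1Norm _).trans (l1Norm_mul_le hf hfm hg)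

theorem essVar_mul_toReal_le {f g : ℝ → ℝ} {A B : ℝ} (hA : 0 ≤ A) (hB : 0 ≤ B)
    (hf : ∀ᵐ x ∂lebI, |f x| ≤ A) (hg : ∀ᵐ x ∂lebI, |g x| ≤ B) (hfv : IsBV f) (hgv : IsBV g) :
    (essVar (fun x => f x * g x)).toReal ≤ A * (essVar g).toReal + B * (essVar f).toReal := by
  have h := ENNReal.toReal_mono (by finiteness [hfv.2.ne, hgv.2.ne])
    (essVar_mul_le hA hB hf hg hfv.2 hgv.2)
  rwa [ENNReal.toReal_add (by finiteness [hgv.2.ne]) (by finiteness [hfv.2.ne]), ENNReal.toReal_mul,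
    ENNReal.toReal_mul, ENNReal.toReal_ofReal hA, ENNReal.toReal_ofReal hB] at h

/-- A probability density on the unit interval. -/
structure IsDensity (h : ℝ → ℝ) : Prop where
  integrable : Integrable h lebI
  nonneg : 0 ≤ᵐ[lebI] h
  integral : ∫ x, h x ∂lebI = 1

theorem IsInvariantDensity.isDensity {T h : ℝ → ℝ} (hh : IsInvariantDensity T h) : IsDensity h :=
  ⟨hh.isBV.1, .of_forall hh.nonneg, hh.integral⟩

namespace IsDensity

variable {h ψ : ℝ → ℝ}

theorem l1Norm_eq_one (hh : IsDensity h) : l1Norm h = 1 :=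
  (l1Norm_of_nonneg hh.nonneg).trans hh.integral

theorem abs_integral_mul_le (hh : IsDensity h) (hψ : IsBV ψ) :
    |∫ x, ψ x * h x ∂lebI| ≤ supNorm ψ := by
  have := _root_.abs_integral_mul_le (ae_abs_le_supNorm hψ.memLp_top) hψ.memLp_top hh.integrable
  rw [hh.l1Norm_eq_one, mul_one] at this
  simpa only [mul_comm] using this

theorem integrable_mul (hh : IsDensity h) (hψ : IsBV ψ) : Integrable (fun x => ψ x * h x) lebI := by
  simpa only [mul_comm] using integrable_mul_memLp_top hh.integrable hψ.memLp_top

theorem isBV_centered (_ : IsDensity h) (hψ : IsBV ψ) : IsBV (centered ψ h) := hψ.sub_const _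

theorem abs_centered_le (hh : IsDensity h) (hψ : IsBV ψ) :
    ∀ᵐ x ∂lebI, |centered ψ h x| ≤ 2 * supNorm ψ := by
  filter_upwards [ae_abs_le_supNorm hψ.memLp_top] with x hx
  have h1 := abs_sub (ψ x) (∫ y, ψ y * h y ∂lebI)
  have h2 := hh.abs_integral_mul_le hψ
  unfold centered
  linarith

theorem integral_centered_mul (hh : IsDensity h) (hψ : IsBV ψ) :
    ∫ x, centered ψ h x * h x ∂lebI = 0 := by
  simp only [centered, sub_mul]
  rw [integral_sub (hh.integrable_mul hψ) (hh.integrable.const_mul _), integral_const_mul,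
    hh.integral, mul_one, sub_self]

/-- In this form the variances for two densities can be compared although their centerings differ.
-/
theorem integral_centered_sq_mul (hh : IsDensity h) (hψ : IsBV ψ) :
    ∫ x, centered ψ h x ^ 2 * h x ∂lebI =
      ∫ x, ψ x ^ 2 * h x ∂lebI - (∫ x, ψ x * h x ∂lebI) ^ 2 := by
  set c := ∫ x, ψ x * h x ∂lebI with hc
  have h1 : Integrable (fun x => ψ x ^ 2 * h x) lebI := by
    simpa only [pow_two] using hh.integrable_mul (hψ.mul hψ)
  have h2 : (fun x => centered ψ h x ^ 2 * h x) =
      fun x => ψ x ^ 2 * h x - (2 * c * (ψ x * h x) - c ^ 2 * h x) := by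
    funext x; simp only [centered, ← hc]; ring
  have h3 : Integrable (fun x => 2 * c * (ψ x * h x)) lebI := (hh.integrable_mul hψ).const_mul _
  have h4 : Integrable (fun x => c ^ 2 * h x) lebI := hh.integrable.const_mul _
  have h5 : Integrable (fun x => 2 * c * (ψ x * h x) - c ^ 2 * h x) lebI := h3.sub h4
  rw [h2, integral_sub h1 h5, integral_sub h3 h4, integral_const_mul, integral_const_mul,
    ← hc, hh.integral]
  ring

theorem l1Norm_centered_mul_le (hh : IsDensity h) (hψ : IsBV ψ) :
    l1Norm (fun x => centered ψ h x * h x) ≤ 2 * supNorm ψ := by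
  have := l1Norm_mul_le (hh.abs_centered_le hψ) (hh.isBV_centered hψ).memLp_top hh.integrable
  rwa [hh.l1Norm_eq_one, mul_one] at this

end IsDensity

theorem DecayBound.l1Norm_le {T : ℝ → ℝ} {C ρ : ℝ} (hd : DecayBound T C ρ) (hC : 0 ≤ C)
    (hρ : 0 ≤ ρ) {f : ℝ → ℝ} (hf : IsBV f) (hfn : ∀ n, Integrable ((transfer T)^[n] f) lebI)
    (hint : ∫ x, f x ∂lebI = 0) (n : ℕ) : l1Norm ((transfer T)^[n] f) ≤ C * ρ ^ n * bvSize f := by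
  have h1 := hd f hf hint n
  rw [hf.bvNorm_eq, ← ENNReal.ofReal_mul (by positivity)] at h1
  have h2 := (le_add_self (a := eLpNorm ((transfer T)^[n] f) 1 lebI)).trans h1
  rw [eLpNorm_one_eq_ofReal_l1Norm (hfn n)] at h2
  exact (ENNReal.ofReal_le_ofReal_iff (by
    have := bvSize_nonneg f; unfold bvSize at this; positivity)).1 h2

theorem memLp_top_iterate_comp {T : ℝ → ℝ} (hT : IsPiecewiseC2Expanding T) {g : ℝ → ℝ}
    (hg : MemLp g ⊤ lebI) (k : ℕ) : MemLp (fun x => g (T^[k] x)) ⊤ lebI := by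
  induction k with
  | zero => exact hg
  | succ k ih => exact MemLp.comp_transfer hT ih

theorem integral_mul_iterate {T : ℝ → ℝ} (hT : IsPiecewiseC2Expanding T) {f g : ℝ → ℝ}
    (hf : Integrable f lebI) (hg : MemLp g ⊤ lebI) (k : ℕ) :
    ∫ x, f x * g (T^[k] x) ∂lebI = ∫ x, (transfer T)^[k] f x * g x ∂lebI := by
  induction k generalizing f with
  | zero => rfl
  | succ k ih =>
    rw [Function.iterate_succ_apply, ← ih ((isMarkov_transfer hT).integrable f hf)]
    exact (isTransferOf_transfer hT hf).2 _ (memLp_top_iterate_comp hT hg k)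

/-! ### Summable correlations, the truncation length and the variance formula. -/

namespace SpectralSetting

variable {T : ℝ → ℝ} {α B₀ : ℝ} {h ψ : ℝ → ℝ}

theorem essVar_density_le (hS : SpectralSetting T α B₀) (hh : IsInvariantDensity T h) :
    (essVar h).toReal ≤ B₀ / (1 - α) := by
  have := hS.satisfiesLY.essVar_fixed_le hS.lt_one hh.isBV hh.fixed
  rwa [hh.isDensity.l1Norm_eq_one, mul_one] at this

/-- Leibniz rule with `|centered ψ h| ≤ 2 ‖ψ‖_∞`, `V h ≤ B₀/(1-α)` and `|h| ≤ V h + ‖h‖₁ ≤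
(B₀+1-α)/(1-α)`. -/
theorem essVar_centered_mul_le (hS : SpectralSetting T α B₀) (hh : IsInvariantDensity T h)
    (hψ : IsBV ψ) : (essVar (fun x => centered ψ h x * h x)).toReal ≤
      2 * supNorm ψ * (B₀ / (1 - α)) + (B₀ + 1 - α) / (1 - α) * (essVar ψ).toReal := by
  have hα : 0 < 1 - α := by linarith [hS.lt_one]
  have hH : (B₀ + 1 - α) / (1 - α) = B₀ / (1 - α) + 1 := by field_simp; ring
  have h0 := hS.div_one_sub_nonneg
  have hv := hS.essVar_density_le hh
  have hsup : ∀ᵐ x ∂lebI, |h x| ≤ (B₀ + 1 - α) / (1 - α) := by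
    filter_upwards [ae_abs_le_essVar_add_l1Norm hh.isBV] with x hx
    rw [hh.isDensity.l1Norm_eq_one] at hx
    linarith
  have hS0 := supNorm_nonneg ψ
  have h1 := essVar_mul_toReal_le (by positivity) (by rw [hH]; positivity)
    (hh.isDensity.abs_centered_le hψ) hsup (hh.isDensity.isBV_centered hψ) hh.isBV
  have h2 : (essVar (centered ψ h)).toReal ≤ (essVar ψ).toReal :=
    ENNReal.toReal_mono hψ.2.ne (essVar_sub_const ψ _)
  refine h1.trans (add_le_add ?_ ?_)
  · gcongr
  · exact mul_le_mul_of_nonneg_left h2 (by rw [hH]; positivity)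

theorem isBV_centered_mul (hh : IsInvariantDensity T h) (hψ : IsBV ψ) :
    IsBV fun x => centered ψ h x * h x :=
  (hh.isDensity.isBV_centered hψ).mul hh.isBV

theorem bvSize_centered_mul_le (hS : SpectralSetting T α B₀) (hh : IsInvariantDensity T h)
    (hψ : IsBV ψ) : bvSize (fun x => centered ψ h x * h x) ≤
      (2 * supNorm ψ + (essVar ψ).toReal) * ((B₀ + 1 - α) / (1 - α)) := by
  have hα : 0 < 1 - α := by linarith [hS.lt_one]
  have h1 := hS.essVar_centered_mul_le hh hψ
  have h2 := hh.isDensity.l1Norm_centered_mul_le hψ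
  have hH : (B₀ + 1 - α) / (1 - α) = B₀ / (1 - α) + 1 := by field_simp; ring
  unfold bvSize
  rw [hH] at h1 ⊢
  linarith

theorem l1Norm_iterate_centered_le (hS : SpectralSetting T α B₀) (hh : IsInvariantDensity T h)
    (hψ : IsBV ψ) {C ρ : ℝ} (hC : 0 < C) (hρ : α < ρ) (hd : DecayBound T C ρ) (n : ℕ) :
    l1Norm ((transfer T)^[n] fun x => centered ψ h x * h x) ≤
      C * ρ ^ n * ((2 * supNorm ψ + (essVar ψ).toReal) * ((B₀ + 1 - α) / (1 - α))) := by
  have hρ0 : 0 < ρ := hS.pos.trans hρ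
  have hbv := isBV_centered_mul hh hψ
  refine (hd.l1Norm_le hC.le hρ0.le hbv (fun n => (hS.isBV_iterate n hbv).1)
    (hh.isDensity.integral_centered_mul hψ) n).trans ?_
  gcongr
  exact hS.bvSize_centered_mul_le hh hψ

theorem summable_l1Norm_iterate (hS : SpectralSetting T α B₀) (hh : IsInvariantDensity T h)
    (hψ : IsBV ψ) :
    Summable fun i : ℕ => l1Norm ((transfer T)^[i] fun x => centered ψ h x * h x) := by
  obtain ⟨C, ρ, hC, hρ, hρ1, hd⟩ := hS.exists_decayBound
  refine Summable.of_nonneg_of_le (fun _ => l1Norm_nonneg _)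
    (fun i => hS.l1Norm_iterate_centered_le hh hψ hC hρ hd i) ?_
  exact ((summable_geometric_of_lt_one (hS.pos.trans hρ).le hρ1).mul_left C).mul_right _

theorem abs_corr_le (hS : SpectralSetting T α B₀) (hh : IsInvariantDensity T h) (hψ : IsBV ψ)
    (i : ℕ) : |corr (transfer T) h ψ i| ≤
      2 * supNorm ψ * l1Norm ((transfer T)^[i] fun x => centered ψ h x * h x) :=
  abs_integral_mul_le (hh.isDensity.abs_centered_le hψ) (hh.isDensity.isBV_centered hψ).memLp_top
    (hS.isBV_iterate i (isBV_centered_mul hh hψ)).1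

theorem summable_abs_corr (hS : SpectralSetting T α B₀) (hh : IsInvariantDensity T h)
    (hψ : IsBV ψ) : Summable fun i => |corr (transfer T) h ψ i| :=
  Summable.of_nonneg_of_le (fun _ => abs_nonneg _) (fun i => hS.abs_corr_le hh hψ i)
    ((hS.summable_l1Norm_iterate hh hψ).mul_left _)

theorem summable_corr_succ (hS : SpectralSetting T α B₀) (hh : IsInvariantDensity T h)
    (hψ : IsBV ψ) : Summable fun i => corr (transfer T) h ψ (i + 1) :=
  (summable_nat_add_iff 1).2 (hS.summable_abs_corr hh hψ).of_abs

theorem tailBound_le (hS : SpectralSetting T α B₀) (hh : IsInvariantDensity T h) (hψ : IsBV ψ)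
    {C ρ : ℝ} (hC : 0 < C) (hρ : α < ρ) (hρ1 : ρ < 1) (hd : DecayBound T C ρ) (l : ℕ) :
    tailBound T h ψ l ≤ 4 * supNorm ψ * (2 * supNorm ψ + (essVar ψ).toReal) *
      ((B₀ + 1 - α) / ((1 - α) * (1 - ρ))) * C * ρ ^ l := by
  have hρ0 : 0 < ρ := hS.pos.trans hρ
  set W := (2 * supNorm ψ + (essVar ψ).toReal) * ((B₀ + 1 - α) / (1 - α)) with hW
  have hgeo := hasSum_geometric_of_lt_one hρ0.le hρ1
  have hsum : HasSum (fun i : ℕ => C * ρ ^ l * W * ρ ^ i) (C * ρ ^ l * W * (1 - ρ)⁻¹) :=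
    hgeo.mul_left _
  have hle : ∑' i : ℕ, l1Norm ((transfer T)^[l + i] fun y => centered ψ h y * h y) ≤
      C * ρ ^ l * W * (1 - ρ)⁻¹ := by
    rw [← hsum.tsum_eq]
    refine Summable.tsum_le_tsum (fun i => ?_) ?_ hsum.summable
    · refine (hS.l1Norm_iterate_centered_le hh hψ hC hρ hd (l + i)).trans (le_of_eq ?_)
      rw [pow_add]; ring
    · simp only [add_comm l]
      exact (summable_nat_add_iff l).2 (hS.summable_l1Norm_iterate hh hψ)
  have h1 : 1 - α ≠ 0 := by linarith [hS.lt_one]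
  have h2 : 1 - ρ ≠ 0 := by linarith
  calc tailBound T h ψ l ≤ 4 * supNorm ψ * (C * ρ ^ l * W * (1 - ρ)⁻¹) :=
        mul_le_mul_of_nonneg_left hle (mul_nonneg (by norm_num) (supNorm_nonneg ψ))
    _ = _ := by rw [hW]; field_simp

theorem tailBound_truncationLength_le (hS : SpectralSetting T α B₀) (hh : IsInvariantDensity T h)
    (hψ : IsBV ψ) {C ρ : ℝ} (hC : 0 < C) (hρ : α < ρ) (hρ1 : ρ < 1) (hd : DecayBound T C ρ)
    {τ : ℝ} (hτ : 0 < τ) : tailBound T h ψ (truncationLength α B₀ C ρ ψ τ) ≤ τ / 2 := by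
  have hρ0 : 0 < ρ := hS.pos.trans hρ
  refine (hS.tailBound_le hh hψ hC hρ hρ1 hd _).trans ?_
  rw [truncationLength]
  set M := 4 * supNorm ψ * (2 * supNorm ψ + (essVar ψ).toReal) *
    ((B₀ + 1 - α) / ((1 - α) * (1 - ρ))) * C with hM
  set x := (Real.log (τ / 2) - Real.log M) / Real.log ρ with hx
  have hM0 : 0 ≤ M := by
    have h1 := supNorm_nonneg ψ
    have h2 : 0 ≤ (essVar ψ).toReal := ENNReal.toReal_nonneg
    have h3 : 0 ≤ (B₀ + 1 - α) / ((1 - α) * (1 - ρ)) :=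
      div_nonneg (by linarith [hS.nonneg, hS.lt_one])
        (mul_nonneg (by linarith [hS.lt_one]) (by linarith))
    positivity
  -- The tail is at most `M ρ^l`. If `M = 0` any `l` will do, whatever value the logarithm of zero
  -- takes.
  rcases hM0.eq_or_lt with h0 | hMpos
  · rw [← h0, zero_mul]; positivity
  have hlog : Real.log ρ < 0 := Real.log_neg hρ0 hρ1
  have hl : x ≤ ((max 1 ⌈x⌉₊ : ℕ) : ℝ) :=
    (Nat.le_ceil x).trans (by exact_mod_cast le_max_right _ _)
  -- Since `log ρ < 0`, multiplying by it reverses the inequality: `l log ρ ≤ log (τ/2) - log M`,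
  -- that is, `M ρ^l ≤ τ/2`.
  rw [hx, div_le_iff_of_neg hlog] at hl
  have hpow : 0 < ρ ^ (max 1 ⌈x⌉₊) := by positivity
  refine (Real.log_le_log_iff (by positivity) (by positivity)).1 ?_
  rw [Real.log_mul hMpos.ne' hpow.ne', Real.log_pow]
  linarith

/-- With `s (n+1) = φ + s n ∘ T`, invariance of `h m` shows that the second moments `v n` of the
Birkhoff sums grow at step `n` by the `n`-th partial sum of the claimed series. Thus `v n / n` is a
Cesàro mean of these partial sums. -/
theorem tendsto_birkhoffVariance (hS : SpectralSetting T α B₀) (hh : IsInvariantDensity T h)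
    (hψ : IsBV ψ) :
    Tendsto (birkhoffVariance T (lebI.withDensity fun x => ENNReal.ofReal (h x)) ψ) atTop
      (𝓝 ((∫ x, centered ψ h x ^ 2 * h x ∂lebI) +
        2 * ∑' i : ℕ, corr (transfer T) h ψ (i + 1))) := by
  have hT := hS.expanding
  set φ := centered ψ h with hφ
  have hφm : MemLp φ ⊤ lebI := (hh.isDensity.isBV_centered hψ).memLp_top
  set s : ℕ → ℝ → ℝ := fun n x => ∑ i ∈ Finset.range n, φ (T^[i] x) with hs
  have hsm : ∀ n, MemLp (s n) ⊤ lebI := fun n =>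
    memLp_finsetSum _ fun i _ => memLp_top_iterate_comp hT hφm i
  have hmul : ∀ {f g : ℝ → ℝ}, MemLp f ⊤ lebI → MemLp g ⊤ lebI →
      MemLp (fun x => f x * g x) ⊤ lebI := fun hf hg => hg.mul (r := ⊤) hf
  set v : ℕ → ℝ := fun n => ∫ x, s n x ^ 2 * h x ∂lebI with hv
  set a : ℕ → ℝ := fun i => corr (transfer T) h ψ i with ha
  have hrec : ∀ n, v (n + 1) =
      v n + ((∫ x, φ x ^ 2 * h x ∂lebI) + 2 * ∑ i ∈ Finset.range n, a (i + 1)) := by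
    intro n
    have hi0 : Integrable (fun x => h x * (φ x * φ x)) lebI :=
      integrable_mul_memLp_top hh.isBV.1 (hmul hφm hφm)
    have hsT := MemLp.comp_transfer hT (hsm n)
    have hi1 : Integrable (fun x => h x * (φ x * s n (T x))) lebI :=
      integrable_mul_memLp_top hh.isBV.1 (hmul hφm hsT)
    have hi2 : Integrable (fun x => h x * (s n (T x) * s n (T x))) lebI :=
      integrable_mul_memLp_top hh.isBV.1 (hmul hsT hsT)
    have hsucc : ∀ x, s (n + 1) x = φ x + s n (T x) := fun x => by
      simp only [hs, Finset.sum_range_succ', Function.iterate_succ_apply, Function.iterate_zero, id]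
      ring
    have h1 : v (n + 1) = ∫ x, (h x * (φ x * φ x) + (2 * (h x * (φ x * s n (T x))) +
        h x * (s n (T x) * s n (T x)))) ∂lebI := by
      simp only [hv, hsucc]
      congr 1 with x
      ring
    have hi3 : Integrable (fun x => 2 * (h x * (φ x * s n (T x))) +
        h x * (s n (T x) * s n (T x))) lebI := (hi1.const_mul 2).add hi2
    rw [h1, integral_add hi0 hi3, integral_add (hi1.const_mul 2) hi2,
      integral_const_mul]
    have h2 : ∫ x, h x * (s n (T x) * s n (T x)) ∂lebI = v n := by
      have h3 := (isTransferOf_transfer hT hh.isBV.1).2 (fun x => s n x * s n x)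
        (hmul (hsm n) (hsm n))
      rw [h3, hv]
      refine integral_congr_ae (hh.fixed.mono fun x hx => ?_)
      simp only [hx]; ring
    -- Duality moves `T^(i+1)` from the observable onto `φ h`, turning the cross terms into
    -- correlations.
    have h4 : ∫ x, h x * (φ x * s n (T x)) ∂lebI = ∑ i ∈ Finset.range n, a (i + 1) := by
      have h5 : ∀ i, a (i + 1) = ∫ x, φ x * h x * φ (T^[i + 1] x) ∂lebI := fun i =>
        (integral_mul_iterate hT (isBV_centered_mul hh hψ).1 hφm (i + 1)).symm
      simp only [h5]
      rw [← integral_finsetSum _ fun i _ => integrable_mul_memLp_top (isBV_centered_mul hh hψ).1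
        (memLp_top_iterate_comp hT hφm (i + 1))]
      congr 1 with x
      simp only [hs, Function.iterate_succ_apply, ← Finset.mul_sum]
      ring
    have h6 : ∫ x, h x * (φ x * φ x) ∂lebI = ∫ x, φ x ^ 2 * h x ∂lebI := by
      congr 1 with x; ring
    rw [h2, h4, h6]
    ring
  have hvn : ∀ n, v n = ∑ m ∈ Finset.range n,
      ((∫ x, φ x ^ 2 * h x ∂lebI) + 2 * ∑ i ∈ Finset.range m, a (i + 1)) := by
    intro n
    induction n with
    | zero => simp [hv, hs]
    | succ n ih => rw [hrec, Finset.sum_range_succ, ih]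
  have hlim := ((((hS.summable_corr_succ hh hψ).hasSum.tendsto_sum_nat).const_mul 2).const_add
    (∫ x, φ x ^ 2 * h x ∂lebI)).cesaro
  refine hlim.congr fun n => ?_
  rw [birkhoffVariance, ← hvn, one_div]
  congr 1
  rw [integral_withDensity hh, integral_withDensity hh]
  refine integral_congr_ae (.of_forall fun x => ?_)
  simp [hs, hφ, centered, Finset.sum_sub_distrib]

end SpectralSetting

/-! ### Fixed densities of Ulam operators: existence. -/

namespace IntervalPartition

variable (η : IntervalPartition)

theorem avg_add {f g : ℝ → ℝ} (hf : Integrable f lebI) (hg : Integrable g lebI) :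
    η.avg (f + g) = η.avg f + η.avg g := by
  funext k
  simp only [avg, Pi.add_apply]
  rw [intervalIntegral.integral_add (η.intervalIntegrable_cell hf k)
    (η.intervalIntegrable_cell hg k), mul_add]

theorem avg_smul (a : ℝ) (f : ℝ → ℝ) : η.avg (a • f) = a • η.avg f := by
  funext k
  simp only [avg, Pi.smul_apply, smul_eq_mul, intervalIntegral.integral_const_mul]
  ring

theorem proj_proj (f : ℝ → ℝ) : η.proj (η.proj f) = η.proj f :=
  condExp_of_stronglyMeasurable η.sigmaAlg_le_borel stronglyMeasurable_condExp integrable_condExp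

theorem isMarkov_ulam {T : ℝ → ℝ} (hT : IsPiecewiseC2Expanding T) : IsMarkov (η.ulam T) :=
  η.isMarkov_proj.comp ((isMarkov_transfer hT).comp η.isMarkov_proj)

theorem proj_of_ulam_fixed {T g : ℝ → ℝ} (hfix : η.ulam T g =ᵐ[lebI] g) :
    η.proj g =ᵐ[lebI] g := by
  refine (η.isMarkov_proj.congr _ _ hfix.symm).trans (.trans (.of_eq ?_) hfix)
  rw [ulam, proj_proj]

theorem IsUlamDensity.isDensity {η : IntervalPartition} {T g : ℝ → ℝ} (hg : η.IsUlamDensity T g) :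
    IsDensity g := ⟨hg.integrable, hg.nonneg, hg.integral_eq_one⟩

/-- On coefficients of step functions, `P_η` is a matrix `A` preserving the mass `∑ len k * c k`.
The range of `A - 1` consists of vectors of mass zero, so `A - 1` is not surjective, hence in finite
dimension not injective. -/
theorem exists_ulam_fixed {T : ℝ → ℝ} (hT : IsPiecewiseC2Expanding T) :
    ∃ u, Integrable u lebI ∧ η.ulam T u =ᵐ[lebI] u ∧ ¬ u =ᵐ[lebI] 0 := by
  have hP := isMarkov_transfer hT
  let A : (Fin η.d → ℝ) →ₗ[ℝ] (Fin η.d → ℝ) :=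
    { toFun := fun c => η.avg (transfer T (η.step c))
      map_add' := fun c c' => by
        have hc := η.integrable_step c
        have hc' := η.integrable_step c'
        rw [step_add, ← η.avg_add (hP.integrable _ hc) (hP.integrable _ hc')]
        funext k
        exact η.avg_congr (hP.add _ _ hc hc') k
      map_smul' := fun a c => by
        rw [step_smul, RingHom.id_apply, ← η.avg_smul]
        funext k
        exact η.avg_congr (hP.smul _ _ (η.integrable_step c)) k }
  have hmass : ∀ c : Fin η.d → ℝ, ∑ k, η.len k * A c k = ∑ k, η.len k * c k := by
    intro c
    have h1 := hP.integral _ (η.integrable_step c)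
    rw [η.integral_eq_sum (hP.integrable _ (η.integrable_step c)),
      η.integral_eq_sum (η.integrable_step c)] at h1
    simp only [setIntegral_cell_eq_len_mul_avg, avg_step] at h1
    exact h1
  let D : (Fin η.d → ℝ) →ₗ[ℝ] (Fin η.d → ℝ) := A - LinearMap.id
  have hnsurj : ¬ Function.Surjective D := by
    intro hsurj
    obtain ⟨c, hc⟩ := hsurj fun _ => 1
    have h1 : ∑ k, η.len k * (A c k - c k) = ∑ k, η.len k * 1 :=
      Finset.sum_congr rfl fun k _ => by
        have := congrFun hc k
        simp only [D, LinearMap.sub_apply, LinearMap.id_apply, Pi.sub_apply] at this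
        rw [this]
    simp only [mul_sub, Finset.sum_sub_distrib, hmass, sub_self] at h1
    have h2 : 0 < ∑ k, η.len k * 1 :=
      Finset.sum_pos (fun k _ => by simpa using η.len_pos k) ⟨⟨0, η.d_pos⟩, Finset.mem_univ _⟩
    linarith
  have hninj : ¬ Function.Injective D := fun h =>
    hnsurj (LinearMap.injective_iff_surjective.1 h)
  rw [injective_iff_map_eq_zero] at hninj
  push Not at hninj
  obtain ⟨c, hc, hc0⟩ := hninj
  have hAc : A c = c := sub_eq_zero.1 hc
  refine ⟨η.step c, η.integrable_step c, ?_, fun h => hc0 ?_⟩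
  · have h1 : η.proj (η.step c) =ᵐ[lebI] η.step c := by
      have := η.proj_ae_eq_step (η.integrable_step c)
      rwa [show η.avg (η.step c) = c from funext (η.avg_step c)] at this
    have h2 : η.ulam T (η.step c) =ᵐ[lebI] η.proj (transfer T (η.step c)) :=
      (η.isMarkov_proj.comp hP).congr _ _ h1
    refine h2.trans ?_
    have h3 := η.proj_ae_eq_step (hP.integrable _ (η.integrable_step c))
    rwa [show η.avg (transfer T (η.step c)) = c from hAc] at h3
  · funext k
    rw [← η.avg_step c k, η.avg_congr h]
    simp [avg]

theorem exists_isUlamDensity {T : ℝ → ℝ} (hT : IsPiecewiseC2Expanding T) :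
    ∃ g, η.IsUlamDensity T g := by
  obtain ⟨u, hu, hfix, hu0⟩ := η.exists_ulam_fixed hT
  have hpos : 0 < l1Norm u := lt_of_le_of_ne (l1Norm_nonneg u)
    fun h => hu0 ((l1Norm_eq_zero_iff hu).1 h.symm)
  refine ⟨(l1Norm u)⁻¹ • fun x => |u x|, hu.abs.smul _, .of_forall fun x =>
    mul_nonneg (inv_nonneg.2 hpos.le) (abs_nonneg _), ?_, ?_⟩
  · simp only [Pi.smul_apply, smul_eq_mul, integral_const_mul]
    exact inv_mul_cancel₀ hpos.ne'
  · exact ((η.isMarkov_ulam hT).smul _ _ hu.abs).trans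
      (((η.isMarkov_ulam hT).fixed_abs hu hfix).const_smul _)

end IntervalPartition

/-! ### Fixed densities of Ulam operators: uniqueness. -/

/-- `P` maps functions vanishing off the support of `p` to functions vanishing off that support,
as soon as it does so for `p ≥ 0` itself. -/
theorem transfer_eq_zero_on {T : ℝ → ℝ} (hT : IsPiecewiseC2Expanding T) {p u : ℝ → ℝ} {B : Set ℝ}
    (hB : MeasurableSet B) (hp : Integrable p lebI) (hp0 : 0 ≤ᵐ[lebI] p)
    (hpB : ∀ᵐ x ∂lebI, p x = 0 → x ∈ B) (hPp : ∀ᵐ x ∂lebI, x ∈ B → transfer T p x = 0)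
    (hu : Integrable u lebI) (huB : ∀ᵐ x ∂lebI, x ∈ B → u x = 0) :
    ∀ᵐ x ∂lebI, x ∈ B → transfer T u x = 0 := by
  set k : ℝ → ℝ := B.indicator fun _ => 1 with hk
  have hk0 : ∀ x, 0 ≤ k x := fun x => indicator_nonneg (fun _ _ => zero_le_one) x
  have hkm : MemLp k ⊤ lebI := memLp_top_indicator_one hB
  -- No `p`-mass enters `B`, so almost every `x` with `T x ∈ B` satisfies `p x = 0` and thus lies in
  -- `B`, where `u` vanishes.
  have h1 : ∫ x, p x * k (T x) ∂lebI = 0 := by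
    rw [(isTransferOf_transfer hT hp).2 k hkm]
    refine integral_eq_zero_of_ae (hPp.mono fun x hx => ?_)
    by_cases hxB : x ∈ B
    · simp [hx hxB]
    · simp [hk, hxB]
  have h2 : (fun x => p x * k (T x)) =ᵐ[lebI] 0 :=
    (integral_eq_zero_iff_of_nonneg_ae (hp0.mono fun x hx => mul_nonneg hx (hk0 _))
      (integrable_mul_memLp_top hp (MemLp.comp_transfer hT hkm))).1 h1
  have h3 : ∫ x, |u x| * k (T x) ∂lebI = 0 := by
    refine integral_eq_zero_of_ae ?_
    filter_upwards [h2, hpB, huB] with x e1 e2 e3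
    rcases mul_eq_zero.1 e1 with h | h
    · simp [e3 (e2 h)]
    · simp [h]
  have hP := isMarkov_transfer hT
  rw [(isTransferOf_transfer hT hu.abs).2 k hkm] at h3
  have hPu0 := hP.nonneg _ hu.abs (.of_forall fun x => abs_nonneg (u x))
  have h4 := (integral_eq_zero_iff_of_nonneg_ae (hPu0.mono fun x hx => mul_nonneg hx (hk0 _))
    (integrable_mul_memLp_top (hP.integrable _ hu.abs) hkm)).1 h3
  filter_upwards [h4, hP.abs_le hu] with x e1 e2 hxB
  have e3 : transfer T (fun y => |u y|) x = 0 := by simpa [hk, hxB] using e1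
  rw [e3] at e2
  exact abs_nonpos_iff.1 e2

namespace SpectralSetting

variable {T : ℝ → ℝ} {α B₀ : ℝ} {h ψ : ℝ → ℝ}

/-- The invariant density vanishes off the support of every nonzero nonnegative fixed function of
an Ulam operator. -/
theorem density_eq_zero_of_ulam_fixed (hS : SpectralSetting T α B₀) (hh : IsInvariantDensity T h)
    (η : IntervalPartition) {p : ℝ → ℝ} (hp : Integrable p lebI) (hp0 : 0 ≤ᵐ[lebI] p)
    (hfix : η.ulam T p =ᵐ[lebI] p) (hne : ¬ p =ᵐ[lebI] 0) : ∀ᵐ x ∂lebI, p x = 0 → h x = 0 := by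
  have hT := hS.expanding
  have hP := hS.isMarkov
  set q := transfer T p with hq
  have hqi : Integrable q lebI := hP.integrable p hp
  have hq0 : 0 ≤ᵐ[lebI] q := hP.nonneg p hp hp0
  have hpq : η.proj q =ᵐ[lebI] p :=
    ((η.isMarkov_proj.comp hP).congr _ _ (η.proj_of_ulam_fixed hfix)).symm.trans hfix
  set B : Set ℝ := {x | η.proj q x = 0} with hB
  have hBm' : MeasurableSet[η.sigmaAlg] B :=
    (stronglyMeasurable_condExp (m := η.sigmaAlg)).measurable (measurableSet_singleton 0)
  have hBm : MeasurableSet B := η.sigmaAlg_le_borel _ hBm'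
  -- `B` belongs to the partition `σ`-algebra, so `q` and its projection have the same integral over
  -- it, namely zero; and `q ≥ 0`.
  have hqB : ∀ᵐ x ∂lebI, x ∈ B → q x = 0 := by
    have h1 : ∫ x in B, q x ∂lebI = 0 := by
      rw [← setIntegral_condExp η.sigmaAlg_le_borel hqi hBm']
      exact setIntegral_eq_zero_of_forall_eq_zero fun x hx => hx
    have h2 := (setIntegral_eq_zero_iff_of_nonneg_ae (ae_restrict_of_ae hq0)
      hqi.integrableOn).1 h1
    exact (ae_restrict_iff' hBm).1 h2
  have hpB : ∀ᵐ x ∂lebI, p x = 0 → x ∈ B := hpq.mono fun x hx hx0 => hx.trans hx0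
  have hiter : ∀ n, ∀ᵐ x ∂lebI, x ∈ B → (transfer T)^[n] p x = 0 := by
    intro n
    induction n with
    | zero => exact hpq.mono fun x hx hxB => hx.symm.trans hxB
    | succ n ih =>
      rw [Function.iterate_succ_apply']
      exact transfer_eq_zero_on hT hBm hp hp0 hpB hqB ((hP.iterate n).integrable p hp) ih
  set c := ∫ x, p x ∂lebI with hc
  have hc0 : c ≠ 0 := fun h0 => hne ((integral_eq_zero_iff_of_nonneg_ae hp0 hp).1 h0)
  have hch : Integrable (c • h) lebI := hh.isBV.1.smul c
  have hint : ∫ x, (p - c • h) x ∂lebI = 0 := by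
    simp only [Pi.sub_apply]
    rw [integral_sub hp hch]
    simp [integral_const_mul, hh.integral, hc]
  have hlim := hS.tendsto_l1Norm_iterate_of_integrable (hp.sub hch) hint
  -- On `B` all iterates of `p` vanish, so `Pⁿ (p - c h) = -c h` there, while the whole norm tends
  -- to zero.
  have hle : ∀ n, ∫ x in B, |c * h x| ∂lebI ≤ l1Norm ((transfer T)^[n] (p - c • h)) := by
    intro n
    have hQ := hP.iterate n
    have hfixc : (transfer T)^[n] (c • h) =ᵐ[lebI] c • h :=
      hP.iterate_of_fixed ((hP.smul c h hh.isBV.1).trans (hh.fixed.const_smul c)) n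
    have hi := (hQ.integrable _ (hp.sub hch)).abs
    calc ∫ x in B, |c * h x| ∂lebI = ∫ x in B, |(transfer T)^[n] (p - c • h) x| ∂lebI := by
          refine setIntegral_congr_ae hBm ?_
          filter_upwards [hQ.sub hp hch, hfixc, hiter n] with x e1 e2 e3 hxB
          rw [e1, Pi.sub_apply, e2, e3 hxB]
          simp
      _ ≤ _ := setIntegral_le_integral hi (.of_forall fun _ => abs_nonneg _)
  have hzero : ∫ x in B, |c * h x| ∂lebI = 0 :=
    le_antisymm (ge_of_tendsto' hlim hle) (integral_nonneg fun _ => abs_nonneg _)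
  have h2 := (ae_restrict_iff' hBm).1 ((setIntegral_eq_zero_iff_of_nonneg_ae
    (.of_forall fun _ => abs_nonneg _) hch.abs.integrableOn).1 hzero)
  filter_upwards [h2, hpB] with x e1 e2 hx0
  have e3 : |c * h x| = 0 := e1 (e2 hx0)
  exact (mul_eq_zero.1 (abs_eq_zero.1 e3)).resolve_left hc0

/-- Let `w` be the difference, fixed and of mean zero. If `w ≠ 0`, then `|w| + w` and `|w| - w` are
nonnegative, fixed and of positive mass. At every point one of them vanishes, so `h` would vanish
almost everywhere. -/
theorem ulam_fixed_unique (hS : SpectralSetting T α B₀) (hh : IsInvariantDensity T h)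
    (η : IntervalPartition) {hη g : ℝ → ℝ} (hd : η.IsUlamDensity T hη) (hg : Integrable g lebI)
    (hfix : η.ulam T g =ᵐ[lebI] g) : g =ᵐ[lebI] (∫ x, g x ∂lebI) • hη := by
  have hU := η.isMarkov_ulam hS.expanding
  set c := ∫ x, g x ∂lebI with hc
  have hch : Integrable (c • hη) lebI := hd.integrable.smul c
  set w := g - c • hη with hw
  have hwi : Integrable w lebI := hg.sub hch
  have hwint : ∫ x, w x ∂lebI = 0 := by
    simp only [hw, Pi.sub_apply]
    rw [integral_sub hg hch]
    simp [integral_const_mul, hd.integral_eq_one, hc]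
  have hwfix : η.ulam T w =ᵐ[lebI] w :=
    (hU.sub hg hch).trans (hfix.sub ((hU.smul c hη hd.integrable).trans (hd.fixed.const_smul c)))
  have habs := hU.fixed_abs hwi hwfix
  by_contra hne
  have hw0 : ¬ w =ᵐ[lebI] 0 := fun h0 => hne (h0.mono fun x hx => sub_eq_zero.1 hx)
  have habs0 : ∫ x, |w x| ∂lebI ≠ 0 := fun h0 => hw0 ((l1Norm_eq_zero_iff hwi).1 h0)
  have key : ∀ s : ℝ, |s| = 1 → ∀ᵐ x ∂lebI, |w x| + s * w x = 0 → h x = 0 := by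
    intro s hs
    have hsw : Integrable (s • w) lebI := hwi.smul s
    refine hS.density_eq_zero_of_ulam_fixed hh η (p := (fun x => |w x|) + s • w)
      (hwi.abs.add hsw) (.of_forall fun x => ?_)
      ((hU.add _ _ hwi.abs hsw).trans (habs.add ((hU.smul s w hwi).trans (hwfix.const_smul s))))
      fun h0 => habs0 ?_
    · have h1 := neg_abs_le (s * w x)
      rw [abs_mul, hs, one_mul] at h1
      simp only [Pi.zero_apply, Pi.add_apply, Pi.smul_apply, smul_eq_mul]
      linarith
    · have h1 := integral_congr_ae h0
      simp only [Pi.add_apply, Pi.smul_apply, smul_eq_mul, Pi.zero_apply, integral_zero] at h1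
      rw [integral_add hwi.abs (hwi.const_mul s), integral_const_mul, hwint] at h1
      simpa using h1
  have hzero : h =ᵐ[lebI] 0 := by
    filter_upwards [key 1 (by simp), key (-1) (by simp)] with x e1 e2
    rcases le_total 0 (w x) with h0 | h0
    · exact e2 (by rw [abs_of_nonneg h0]; ring)
    · exact e1 (by rw [abs_of_nonpos h0]; ring)
  have := integral_congr_ae hzero
  rw [hh.integral] at this
  simp at this

/-! ### Operator error and convergence of the Ulam densities. -/

theorem isBV_proj (η : IntervalPartition) {f : ℝ → ℝ} (hf : IsBV f) : IsBV (η.proj f) :=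
  ⟨η.isMarkov_proj.integrable f hf.1, (η.essVar_proj_le hf.1).trans_lt hf.2⟩

theorem essVar_proj_toReal_le (η : IntervalPartition) {f : ℝ → ℝ} (hf : IsBV f) :
    (essVar (η.proj f)).toReal ≤ (essVar f).toReal :=
  ENNReal.toReal_mono hf.2.ne (η.essVar_proj_le hf.1)

/-- `Π_η` increases neither `V` nor the `L¹` norm, so the constants do not depend on `η`. -/
theorem satisfiesLY_ulam (hS : SpectralSetting T α B₀) (η : IntervalPartition) :
    SatisfiesLY (η.ulam T) α B₀ := by
  intro f hf
  have h1 := isBV_proj η hf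
  obtain ⟨h2, h3⟩ := hS.satisfiesLY _ h1
  refine ⟨isBV_proj η h2, (essVar_proj_toReal_le η h2).trans (h3.trans ?_)⟩
  have h4 := mul_le_mul_of_nonneg_left (essVar_proj_toReal_le η hf) hS.pos.le
  have h5 := mul_le_mul_of_nonneg_left (η.isMarkov_proj.l1Norm_le hf.1) hS.nonneg
  linarith

theorem isBV_ulamDensity (η : IntervalPartition) {hη : ℝ → ℝ} (hd : η.IsUlamDensity T hη) :
    IsBV hη :=
  (η.isBV_step _).congr ((η.proj_ae_eq_step hd.integrable).symm.trans (η.proj_of_ulam_fixed hd.fixed))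

theorem bvSize_ulamDensity_le (hS : SpectralSetting T α B₀) (η : IntervalPartition) {hη : ℝ → ℝ}
    (hd : η.IsUlamDensity T hη) : bvSize hη ≤ B₀ / (1 - α) + 1 := by
  have := (hS.satisfiesLY_ulam η).essVar_fixed_le hS.lt_one (isBV_ulamDensity η hd) hd.fixed
  rw [hd.isDensity.l1Norm_eq_one, mul_one] at this
  rw [bvSize, hd.isDensity.l1Norm_eq_one]
  linarith

theorem l1Norm_ulam_sub_le_two_mul (hS : SpectralSetting T α B₀) (η : IntervalPartition)
    {f : ℝ → ℝ} (hf : Integrable f lebI) : l1Norm (η.ulam T f - transfer T f) ≤ 2 * l1Norm f := by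
  have hU := η.isMarkov_ulam hS.expanding
  have h1 := l1Norm_sub_le (hU.integrable f hf) (hS.isMarkov.integrable f hf)
  linarith [hU.l1Norm_le hf, hS.isMarkov.l1Norm_le hf]

theorem ulamError_le (hS : SpectralSetting T α B₀) (η : IntervalPartition) {c : ℝ}
    (H : ∀ f, IsBV f → bvSize f ≤ 1 → l1Norm (η.ulam T f - transfer T f) ≤ c) :
    (⨆ (f : ℝ → ℝ) (_ : IsBV f) (_ : bvNorm f ≤ 1),
      eLpNorm (η.ulam T f - transfer T f) 1 lebI) ≤ ENNReal.ofReal c := by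
  refine iSup_le fun f => iSup_le fun hf => iSup_le fun hf1 => ?_
  have hi := ((η.isMarkov_ulam hS.expanding).integrable f hf.1).sub
    (hS.isMarkov.integrable f hf.1)
  rw [eLpNorm_one_eq_ofReal_l1Norm hi]
  refine ENNReal.ofReal_le_ofReal (H f hf ?_)
  rw [hf.bvNorm_eq] at hf1
  exact ENNReal.ofReal_le_one.1 hf1

theorem l1Norm_ulam_sub_le (hS : SpectralSetting T α B₀) (η : IntervalPartition) {f : ℝ → ℝ}
    (hf : IsBV f) : l1Norm (η.ulam T f - transfer T f) ≤ ulamError T η * bvSize f := by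
  have hU := η.isMarkov_ulam hS.expanding
  have hP := hS.isMarkov
  -- The supremum must be finite: `toReal` would turn an infinite one into zero.
  have hfin := hS.ulamError_le η (c := 2) fun f hf hf1 => by
    have h1 := hS.l1Norm_ulam_sub_le_two_mul η hf.1
    have h2 := l1Norm_le_bvSize f
    linarith
  have hunit : ∀ g, IsBV g → bvSize g ≤ 1 → l1Norm (η.ulam T g - transfer T g) ≤ ulamError T η := by
    intro g hg hg1
    have hi := (hU.integrable g hg.1).sub (hP.integrable g hg.1)
    have hle : eLpNorm (η.ulam T g - transfer T g) 1 lebI ≤ ⨆ (f : ℝ → ℝ) (_ : IsBV f)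
        (_ : bvNorm f ≤ 1), eLpNorm (η.ulam T f - transfer T f) 1 lebI :=
      le_iSup₂_of_le g hg (le_iSup_of_le
        (by rw [hg.bvNorm_eq]; exact ENNReal.ofReal_le_one.2 hg1) le_rfl)
    have := ENNReal.toReal_mono (ne_top_of_le_ne_top ENNReal.ofReal_ne_top hfin) hle
    rwa [eLpNorm_one_eq_ofReal_l1Norm hi, ENNReal.toReal_ofReal (l1Norm_nonneg _)] at this
  rcases (bvSize_nonneg f).eq_or_lt with h0 | h0
  · have h1 := hS.l1Norm_ulam_sub_le_two_mul η hf.1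
    have h2 := l1Norm_le_bvSize f
    rw [← h0] at h2 ⊢
    linarith
  · set w := bvSize f with hw
    have hg : IsBV (w⁻¹ • f) := hf.smul _
    have h1 : bvSize (w⁻¹ • f) ≤ 1 := by
      refine (bvSize_smul_le hf _).trans (le_of_eq ?_)
      rw [abs_of_pos (inv_pos.2 h0)]
      exact inv_mul_cancel₀ h0.ne'
    have h2 := hunit _ hg h1
    have h3 : η.ulam T (w⁻¹ • f) - transfer T (w⁻¹ • f) =ᵐ[lebI]
        w⁻¹ • (η.ulam T f - transfer T f) := by
      rw [smul_sub]
      exact (hU.smul _ f hf.1).sub (hP.smul _ f hf.1)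
    rw [l1Norm_congr h3, l1Norm_smul, abs_of_pos (inv_pos.2 h0), inv_mul_le_iff₀ h0] at h2
    linarith

/-- Split `P_η f - P f = Π P (Π f - f) + (Π P f - P f)`. The two terms are at most the mesh times `V
f` and times `V (P f) ≤ α V f + B₀ ‖f‖₁`. -/
theorem ulamError_le_of_meshLE (hS : SpectralSetting T α B₀) {η : IntervalPartition} {ε : ℝ}
    (hη : η.MeshLE ε) : ulamError T η ≤ ε * (1 + α + B₀) := by
  have hε : 0 < ε := (η.len_pos ⟨0, η.d_pos⟩).trans_le (hη _)
  have hP := hS.isMarkov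
  have hα := hS.pos
  have hB := hS.nonneg
  have hc : 0 ≤ ε * (1 + α + B₀) := by positivity
  refine ENNReal.toReal_le_of_le_ofReal hc (hS.ulamError_le η fun f hf hf1 => ?_)
  have hpf := isBV_proj η hf
  have hPf := (hS.satisfiesLY f hf).1
  have hi1 := hP.integrable _ hpf.1
  have hi2 := η.isMarkov_proj.integrable _ hi1
  have hi3 := η.isMarkov_proj.integrable _ hPf.1
  have h1 := l1Norm_sub_triangle hi2 hi3 hPf.1
  have h2 : l1Norm (η.proj (transfer T (η.proj f)) - η.proj (transfer T f)) ≤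
      ε * (essVar f).toReal := by
    have hC := η.isMarkov_proj.comp hP
    rw [← l1Norm_congr (hC.sub hpf.1 hf.1)]
    refine (hC.l1Norm_le (hpf.1.sub hf.1)).trans ?_
    rw [l1Norm_sub_comm]
    exact η.l1Norm_sub_proj_le hf hη
  have h3 := η.l1Norm_sub_proj_le hPf hη
  rw [l1Norm_sub_comm] at h3
  have h4 := mul_le_mul_of_nonneg_left (hS.satisfiesLY f hf).2 hε.le
  have h5 := l1Norm_nonneg f
  have h6 : 0 ≤ (essVar f).toReal := ENNReal.toReal_nonneg
  have h7 : (essVar f).toReal ≤ 1 := by unfold bvSize at hf1; linarith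
  have h8 : l1Norm f ≤ 1 := (l1Norm_le_bvSize f).trans hf1
  have h9 : (1 + α) * (essVar f).toReal ≤ 1 + α := mul_le_of_le_one_right (by positivity) h7
  have h10 : B₀ * l1Norm f ≤ B₀ := mul_le_of_le_one_right hB h8
  calc l1Norm (η.ulam T f - transfer T f) ≤ ε * (essVar f).toReal +
        ε * (α * (essVar f).toReal + B₀ * l1Norm f) := by
        refine h1.trans (add_le_add h2 (h3.trans h4))
    _ = ε * ((1 + α) * (essVar f).toReal + B₀ * l1Norm f) := by ring
    _ ≤ ε * (1 + α + B₀) := by gcongr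

/-- One step costs `‖(P - P_η) h_η‖₁`, bounded by the uniform `BV` bound on `h_η`; contraction lets
`n` such costs add up. -/
theorem l1Norm_iterate_ulamDensity_sub_le (hS : SpectralSetting T α B₀) (η : IntervalPartition)
    {hη : ℝ → ℝ} (hd : η.IsUlamDensity T hη) (n : ℕ) :
    l1Norm ((transfer T)^[n] hη - hη) ≤ n * (ulamError T η * (B₀ / (1 - α) + 1)) := by
  have hP := hS.isMarkov
  have hi := hd.integrable
  have hone : l1Norm (transfer T hη - hη) ≤ ulamError T η * (B₀ / (1 - α) + 1) := by
    rw [l1Norm_sub_comm, ← l1Norm_congr (hd.fixed.sub (ae_eq_refl (transfer T hη)))]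
    exact (hS.l1Norm_ulam_sub_le η (isBV_ulamDensity η hd)).trans
      (mul_le_mul_of_nonneg_left (hS.bvSize_ulamDensity_le η hd) ENNReal.toReal_nonneg)
  induction n with
  | zero => simp [l1Norm]
  | succ n ih =>
    have hQ := hP.iterate n
    have h1 := hQ.l1Norm_le ((hP.integrable _ hi).sub hi)
    rw [l1Norm_congr (hQ.sub (hP.integrable _ hi) hi)] at h1
    have h2 := l1Norm_sub_triangle (hQ.integrable _ (hP.integrable _ hi)) (hQ.integrable _ hi) hi
    rw [Function.iterate_succ_apply]
    push_cast
    linarith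

/-- The Ulam densities converge to the invariant density as the mesh goes to zero. -/
theorem exists_mesh_l1Norm_le (hS : SpectralSetting T α B₀) (hh : IsInvariantDensity T h) {δ : ℝ}
    (hδ : 0 < δ) : ∃ ε : ℝ, 0 < ε ∧ ∀ η : IntervalPartition, η.MeshLE ε → ∀ hη : ℝ → ℝ,
      η.IsUlamDensity T hη → l1Norm (fun x => hη x - h x) ≤ δ := by
  obtain ⟨C, ρ, hC, hρ, hρ1, hdec⟩ := hS.exists_decayBound
  have hρ0 : 0 < ρ := hS.pos.trans hρ
  have hα := hS.pos
  have hB := hS.nonneg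
  set H := B₀ / (1 - α) + 1
  have hH : 0 < H := by have := hS.div_one_sub_nonneg; positivity
  have hlim : Tendsto (fun n : ℕ => C * ρ ^ n * (2 * H)) atTop (𝓝 0) := by
    simpa using ((tendsto_pow_atTop_nhds_zero_of_lt_one hρ0.le hρ1).const_mul C).mul_const (2 * H)
  obtain ⟨n, hn⟩ := (hlim.eventually_le_const (half_pos hδ)).exists
  -- First `n` is fixed by decay, so that `Pⁿ h_η` is within `δ/2` of `h` for every `η`. Then the
  -- mesh is made small in terms of `n`.
  refine ⟨δ / 2 / ((n + 1) * ((1 + α + B₀) * H)), by positivity, fun η hη hη' hd => ?_⟩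
  have hP := hS.isMarkov
  have hQ := hP.iterate n
  have hbvη := isBV_ulamDensity η hd
  have hbv : IsBV (hη' - h) := hbvη.sub hh.isBV
  have hint : ∫ x, (hη' - h) x ∂lebI = 0 := by
    simp only [Pi.sub_apply]
    rw [integral_sub hd.integrable hh.isBV.1, hd.integral_eq_one, hh.integral, sub_self]
  have h1 := hdec.l1Norm_le hC.le hρ0.le hbv (fun n => (hS.isBV_iterate n hbv).1) hint n
  have hsize : bvSize (hη' - h) ≤ 2 * H := by
    have e1 : bvSize (hη' - h) ≤ bvSize hη' + bvSize ((-1 : ℝ) • h) := by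
      have e2 := essVar_add_le hη' ((-1 : ℝ) • h)
      have e3 := ENNReal.toReal_mono (ENNReal.add_ne_top.2 ⟨hbvη.2.ne, (hh.isBV.smul (-1)).2.ne⟩) e2
      rw [ENNReal.toReal_add hbvη.2.ne (hh.isBV.smul (-1)).2.ne] at e3
      have e4 := l1Norm_add_le hbvη.1 (hh.isBV.smul (-1)).1
      rw [show hη' - h = hη' + (-1 : ℝ) • h by simp [sub_eq_add_neg]]
      unfold bvSize
      linarith
    have e5 := bvSize_smul_le hh.isBV (-1)
    rw [abs_neg, abs_one, one_mul] at e5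
    have e6 := hS.bvSize_ulamDensity_le η hd
    have e7 : bvSize h ≤ H := by
      have := hS.essVar_density_le hh
      rw [bvSize, hh.isDensity.l1Norm_eq_one]
      linarith
    linarith
  have h2 : l1Norm ((transfer T)^[n] hη' - h) ≤ δ / 2 := by
    have e1 : (transfer T)^[n] (hη' - h) =ᵐ[lebI] (transfer T)^[n] hη' - h :=
      (hQ.sub hbvη.1 hh.isBV.1).trans ((ae_eq_refl _).sub (hP.iterate_of_fixed hh.fixed n))
    rw [← l1Norm_congr e1]
    refine h1.trans (le_trans ?_ hn)
    gcongr
  have h3 : l1Norm (hη' - (transfer T)^[n] hη') ≤ δ / 2 := by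
    rw [l1Norm_sub_comm]
    refine (hS.l1Norm_iterate_ulamDensity_sub_le η hd n).trans ?_
    have e1 := hS.ulamError_le_of_meshLE hη
    calc (n : ℝ) * (ulamError T η * H) ≤ (n + 1) *
          (δ / 2 / ((n + 1) * ((1 + α + B₀) * H)) * (1 + α + B₀) * H) := by
          have : 0 ≤ ulamError T η := ENNReal.toReal_nonneg
          gcongr
          linarith
      _ = δ / 2 := by field_simp
  have h4 := l1Norm_sub_triangle hbvη.1 (hQ.integrable _ hbvη.1) hh.isBV.1
  change l1Norm (hη' - h) ≤ δ
  linarith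

theorem exists_mesh_discretizationBound_le (hS : SpectralSetting T α B₀)
    (hh : IsInvariantDensity T h) {τ : ℝ} (hτ : 0 < τ) {l : ℕ} (hl : 1 ≤ l) :
    ∃ ε : ℝ, 0 < ε ∧ ∀ η : IntervalPartition, η.MeshLE ε → ∀ hη : ℝ → ℝ,
      η.IsUlamDensity T hη → discretizationBound T α B₀ η hη h ψ l ≤ τ / 2 := by
  have hα := hS.pos
  have hα1 : 0 < 1 - α := by linarith [hS.lt_one]
  have hB := hS.nonneg
  set a := (16 * ((l : ℝ) - 1) + 8) * supNorm ψ ^ 2 with ha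
  set b := 4 * supNorm ψ * (∑ i ∈ Finset.Ico 1 l, ∑ j ∈ Finset.range i,
      (2 * supNorm ψ * ((∑ k ∈ Finset.range j, α ^ k * B₀) + 1 + α ^ j * B₀ / (1 - α)) +
        α ^ j * (B₀ + 1 - α) / (1 - α) * (essVar ψ).toReal)) with hb
  have hψ0 := supNorm_nonneg ψ
  have ha0 : 0 ≤ a := by
    have : (1 : ℝ) ≤ l := by exact_mod_cast hl
    exact mul_nonneg (by linarith) (by positivity)
  have hb0 : 0 ≤ b := by
    refine mul_nonneg (by positivity) (Finset.sum_nonneg fun i _ => Finset.sum_nonneg fun j _ => ?_)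
    have e1 : 0 ≤ ∑ k ∈ Finset.range j, α ^ k * B₀ := Finset.sum_nonneg fun k _ => by positivity
    have e2 : 0 ≤ B₀ + 1 - α := by linarith
    have e3 : 0 ≤ (essVar ψ).toReal := ENNReal.toReal_nonneg
    positivity
  -- The coefficients `a` and `b` do not depend on `η`, so each of the two terms can be made at most
  -- `τ/4`.
  obtain ⟨ε, hε, H⟩ := hS.exists_mesh_l1Norm_le hh (δ := τ / 4 / (a + 1)) (by positivity)
  refine ⟨min ε (τ / 4 / ((b + 1) * (1 + α + B₀))), by positivity, fun η hη hη' hd => ?_⟩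
  have h1 := H η (fun k => (hη k).trans (min_le_left _ _)) hη' hd
  have h2 := hS.ulamError_le_of_meshLE (η := η) fun k => (hη k).trans (min_le_right _ _)
  have h3 : a * l1Norm (fun x => hη' x - h x) ≤ τ / 4 := by
    calc _ ≤ (a + 1) * (τ / 4 / (a + 1)) :=
          mul_le_mul (by linarith) h1 (l1Norm_nonneg _) (by positivity)
      _ = τ / 4 := by field_simp
  have h4 : b * ulamError T η ≤ τ / 4 := by
    calc _ ≤ (b + 1) * (τ / 4 / ((b + 1) * (1 + α + B₀)) * (1 + α + B₀)) :=
          mul_le_mul (by linarith) h2 ENNReal.toReal_nonneg (by positivity)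
      _ = τ / 4 := by field_simp
  unfold discretizationBound
  linarith

end SpectralSetting

/-! ### Comparison of the truncated Ulam sum with the diffusion coefficient. -/

theorem IsDensity.abs_integral_mul_sub_le {g h ψ : ℝ → ℝ} (hg : IsDensity g) (hh : IsDensity h)
    (hψ : IsBV ψ) : |∫ x, ψ x * g x ∂lebI - ∫ x, ψ x * h x ∂lebI| ≤ supNorm ψ * l1Norm (g - h) := by
  have := _root_.abs_integral_mul_le (ae_abs_le_supNorm hψ.memLp_top) hψ.memLp_top
    (hg.integrable.sub hh.integrable)
  rw [← integral_sub (hg.integrable_mul hψ) (hh.integrable_mul hψ)]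
  refine le_of_eq_of_le (congrArg abs (integral_congr_ae (.of_forall fun x => ?_))) this
  simp only [Pi.sub_apply]
  ring

/-- Second moments contribute 1 to the constant and `a² - b² = (a + b)(a - b)`, for the means `a`
and `b`, contributes 2. -/
theorem IsDensity.abs_integral_centered_sq_sub_le {g h ψ : ℝ → ℝ} (hg : IsDensity g)
    (hh : IsDensity h) (hψ : IsBV ψ) :
    |∫ x, centered ψ g x ^ 2 * g x ∂lebI - ∫ x, centered ψ h x ^ 2 * h x ∂lebI| ≤
      3 * supNorm ψ ^ 2 * l1Norm (g - h) := by
  rw [hg.integral_centered_sq_mul hψ, hh.integral_centered_sq_mul hψ]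
  have h1 := hg.abs_integral_mul_sub_le hh hψ
  have h2 := hg.abs_integral_mul_le hψ
  have h3 := hh.abs_integral_mul_le hψ
  have hm : ∀ᵐ x ∂lebI, |ψ x ^ 2| ≤ supNorm ψ ^ 2 := by
    filter_upwards [ae_abs_le_supNorm hψ.memLp_top] with x hx
    rw [abs_pow]
    gcongr
  have hsq : IsBV fun x => ψ x ^ 2 := by simpa only [pow_two] using hψ.mul hψ
  have h4 : |∫ x, ψ x ^ 2 * g x ∂lebI - ∫ x, ψ x ^ 2 * h x ∂lebI| ≤
      supNorm ψ ^ 2 * l1Norm (g - h) := by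
    have := _root_.abs_integral_mul_le hm hsq.memLp_top (hg.integrable.sub hh.integrable)
    rw [← integral_sub (hg.integrable_mul hsq) (hh.integrable_mul hsq)]
    refine le_of_eq_of_le (congrArg abs (integral_congr_ae (.of_forall fun x => ?_))) this
    simp only [Pi.sub_apply]
    ring
  set a := ∫ x, ψ x * g x ∂lebI
  set b := ∫ x, ψ x * h x ∂lebI
  have h5 : |a ^ 2 - b ^ 2| ≤ 2 * supNorm ψ * (supNorm ψ * l1Norm (g - h)) := by
    rw [sq_sub_sq, abs_mul]
    exact mul_le_mul ((abs_add_le a b).trans (by linarith)) h1 (abs_nonneg _)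
      (by linarith [supNorm_nonneg ψ])
  have h6 := abs_sub (∫ x, ψ x ^ 2 * g x ∂lebI - ∫ x, ψ x ^ 2 * h x ∂lebI) (a ^ 2 - b ^ 2)
  rw [show ∀ p q r s : ℝ, p - r - (q - s) = p - q - (r - s) by intros; ring]
  refine h6.trans ((add_le_add h4 h5).trans (le_of_eq (by ring)))

theorem IsDensity.integrable_centered_mul {h ψ : ℝ → ℝ} (hh : IsDensity h) (hψ : IsBV ψ) :
    Integrable (fun x => centered ψ h x * h x) lebI :=
  hh.integrable_mul (hh.isBV_centered hψ)

/-- The difference is `centered ψ g * (g - h) + (b - a) h`; the two terms give `2 + 1` in the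
constant. -/
theorem IsDensity.l1Norm_centered_mul_sub_le {g h ψ : ℝ → ℝ} (hg : IsDensity g)
    (hh : IsDensity h) (hψ : IsBV ψ) :
    l1Norm ((fun x => centered ψ g x * g x) - fun x => centered ψ h x * h x) ≤
      3 * supNorm ψ * l1Norm (g - h) := by
  set a := ∫ x, ψ x * g x ∂lebI with ha
  set b := ∫ x, ψ x * h x ∂lebI with hb
  have h1 := l1Norm_mul_le (hg.abs_centered_le hψ) (hg.isBV_centered hψ).memLp_top
    (hg.integrable.sub hh.integrable)
  have h2 : l1Norm ((b - a) • h) ≤ supNorm ψ * l1Norm (g - h) := by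
    rw [l1Norm_smul, hh.l1Norm_eq_one, mul_one, abs_sub_comm]
    exact hg.abs_integral_mul_sub_le hh hψ
  have hi : Integrable (fun x => centered ψ g x * (g - h) x) lebI := by
    simpa only [mul_comm] using integrable_mul_memLp_top (hg.integrable.sub hh.integrable)
      (hg.isBV_centered hψ).memLp_top
  have h3 := l1Norm_add_le hi (hh.integrable.smul (b - a))
  refine (le_of_eq (congrArg l1Norm ?_)).trans (h3.trans ((add_le_add h1 h2).trans
    (le_of_eq (by ring))))
  funext x
  simp only [centered, Pi.sub_apply, Pi.add_apply, Pi.smul_apply, smul_eq_mul, ← ha, ← hb]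
  ring

namespace SpectralSetting

variable {T : ℝ → ℝ} {α B₀ : ℝ} {h ψ : ℝ → ℝ}

theorem bvSize_iterate_centered_le (hS : SpectralSetting T α B₀) (hh : IsInvariantDensity T h)
    (hψ : IsBV ψ) (j : ℕ) : bvSize ((transfer T)^[j] fun x => centered ψ h x * h x) ≤
      2 * supNorm ψ * ((∑ k ∈ Finset.range j, α ^ k * B₀) + 1 + α ^ j * B₀ / (1 - α)) +
        α ^ j * (B₀ + 1 - α) / (1 - α) * (essVar ψ).toReal := by
  have hbv := isBV_centered_mul hh hψ
  have h1 := hS.satisfiesLY.iterate_le hS.isMarkov hS.pos.le hS.nonneg hbv j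
  have h2 := (hS.isMarkov.iterate j).l1Norm_le hbv.1
  have h3 := hh.isDensity.l1Norm_centered_mul_le hψ
  have h4 := mul_le_mul_of_nonneg_left (hS.essVar_centered_mul_le hh hψ) (pow_nonneg hS.pos.le j)
  have h5 : 0 ≤ ∑ k ∈ Finset.range j, α ^ k * B₀ :=
    Finset.sum_nonneg fun k _ => mul_nonneg (pow_nonneg hS.pos.le k) hS.nonneg
  have h6 := mul_le_mul_of_nonneg_left h3 h5
  calc _ ≤ α ^ j * (2 * supNorm ψ * (B₀ / (1 - α)) +
        (B₀ + 1 - α) / (1 - α) * (essVar ψ).toReal) +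
        (∑ k ∈ Finset.range j, α ^ k * B₀) * (2 * supNorm ψ) + 2 * supNorm ψ := by
        unfold bvSize
        linarith
    _ = _ := by ring

/-- Telescoping `P_ηⁱ - Pⁱ = ∑ⱼ P_η^(i-1-j) (P_η - P) Pʲ`: the outer factors contract in `L¹`, and
only iterates of the exact operator need `BV` bounds. -/
theorem l1Norm_ulam_iterate_sub_le (hS : SpectralSetting T α B₀) (η : IntervalPartition)
    {u : ℝ → ℝ} (hu : IsBV u) (i : ℕ) :
    l1Norm ((η.ulam T)^[i] u - (transfer T)^[i] u) ≤
      ∑ j ∈ Finset.range i, ulamError T η * bvSize ((transfer T)^[j] u) := by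
  have hU := η.isMarkov_ulam hS.expanding
  induction i with
  | zero => simp [l1Norm]
  | succ i ih =>
    rw [Finset.sum_range_succ, Function.iterate_succ_apply', Function.iterate_succ_apply']
    have hi := (hU.iterate i).integrable _ hu.1
    have hbv := hS.isBV_iterate i hu
    have h1 := l1Norm_sub_triangle (hU.integrable _ hi) (hU.integrable _ hbv.1)
      (hS.isMarkov.integrable _ hbv.1)
    have h2 := hU.l1Norm_le (hi.sub hbv.1)
    rw [l1Norm_congr (hU.sub hi hbv.1)] at h2
    linarith [hS.l1Norm_ulam_sub_le η hbv]

/-- `P_ηⁱ (φ_η h_η)` has mean zero, so the observable it is tested against may be recentered at no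
cost. -/
theorem corr_ulam_eq (hS : SpectralSetting T α B₀) (hh : IsInvariantDensity T h) (hψ : IsBV ψ)
    (η : IntervalPartition) {hη : ℝ → ℝ} (hd : η.IsUlamDensity T hη) (i : ℕ) :
    corr (η.ulam T) hη ψ i =
      ∫ x, (η.ulam T)^[i] (fun y => centered ψ hη y * hη y) x * centered ψ h x ∂lebI := by
  have hQ := (η.isMarkov_ulam hS.expanding).iterate i
  have hu := hd.isDensity.integrable_centered_mul hψ
  have hF := hQ.integrable _ hu
  have h0 := (hQ.integral _ hu).trans (hd.isDensity.integral_centered_mul hψ)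
  unfold corr
  rw [← sub_eq_zero, ← integral_sub
    (integrable_mul_memLp_top hF (hd.isDensity.isBV_centered hψ).memLp_top)
    (integrable_mul_memLp_top hF (hh.isDensity.isBV_centered hψ).memLp_top)]
  simp only [← mul_sub, centered, sub_sub_sub_cancel_left]
  rw [integral_mul_const]
  exact mul_eq_zero_of_left h0 _

theorem abs_corr_ulam_sub_le (hS : SpectralSetting T α B₀) (hh : IsInvariantDensity T h)
    (hψ : IsBV ψ) (η : IntervalPartition) {hη : ℝ → ℝ} (hd : η.IsUlamDensity T hη) (i : ℕ) :
    |corr (η.ulam T) hη ψ i - corr (transfer T) h ψ i| ≤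
      2 * supNorm ψ * (3 * supNorm ψ * l1Norm (hη - h) +
        (∑ j ∈ Finset.range i,
          (2 * supNorm ψ * ((∑ k ∈ Finset.range j, α ^ k * B₀) + 1 + α ^ j * B₀ / (1 - α)) +
            α ^ j * (B₀ + 1 - α) / (1 - α) * (essVar ψ).toReal)) * ulamError T η) := by
  have hQ := (η.isMarkov_ulam hS.expanding).iterate i
  have hbv := isBV_centered_mul hh hψ
  have hu := hd.isDensity.integrable_centered_mul hψ
  have hF := hQ.integrable _ hu
  have hG := (hS.isMarkov.iterate i).integrable _ hbv.1
  have hm := (hh.isDensity.isBV_centered hψ).memLp_top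
  rw [hS.corr_ulam_eq hh hψ η hd]
  unfold corr
  rw [← integral_sub (integrable_mul_memLp_top hF hm) (integrable_mul_memLp_top hG hm)]
  simp only [← sub_mul]
  refine (abs_integral_mul_le (hh.isDensity.abs_centered_le hψ) hm (hF.sub hG)).trans
    (mul_le_mul_of_nonneg_left ?_ (by linarith [supNorm_nonneg ψ]))
  refine (l1Norm_sub_triangle hF (hQ.integrable _ hbv.1) hG).trans (add_le_add ?_ ?_)
  · have h1 := hQ.l1Norm_le (hu.sub hbv.1)
    rw [l1Norm_congr (hQ.sub hu hbv.1)] at h1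
    exact h1.trans (hd.isDensity.l1Norm_centered_mul_sub_le hh.isDensity hψ)
  · refine (hS.l1Norm_ulam_iterate_sub_le η hbv i).trans ?_
    rw [Finset.sum_mul]
    refine Finset.sum_le_sum fun j _ => ?_
    rw [mul_comm]
    exact mul_le_mul_of_nonneg_right (hS.bvSize_iterate_centered_le hh hψ j) ENNReal.toReal_nonneg

/-- The 4 in `tailBound` is the 2 before the series times the 2 in `|centered ψ h| ≤ 2 ‖ψ‖_∞`. -/
theorem two_mul_abs_tsum_corr_le (hS : SpectralSetting T α B₀) (hh : IsInvariantDensity T h)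
    (hψ : IsBV ψ) (l : ℕ) :
    2 * |∑' i : ℕ, corr (transfer T) h ψ (l + i)| ≤ tailBound T h ψ l := by
  have h1 : Summable fun i : ℕ => |corr (transfer T) h ψ (l + i)| := by
    simpa only [add_comm] using (summable_nat_add_iff l).2 (hS.summable_abs_corr hh hψ)
  have h2 : Summable fun i : ℕ =>
      l1Norm ((transfer T)^[l + i] fun y => centered ψ h y * h y) := by
    simpa only [add_comm] using (summable_nat_add_iff l).2 (hS.summable_l1Norm_iterate hh hψ)
  have h3 : |∑' i : ℕ, corr (transfer T) h ψ (l + i)| ≤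
      2 * supNorm ψ * ∑' i : ℕ, l1Norm ((transfer T)^[l + i] fun y => centered ψ h y * h y) := by
    rw [← tsum_mul_left]
    refine le_trans ?_ (h1.tsum_le_tsum (fun i => hS.abs_corr_le hh hψ (l + i)) (h2.mul_left _))
    have := norm_tsum_le_tsum_norm (f := fun i : ℕ => corr (transfer T) h ψ (l + i)) h1
    exact this
  unfold tailBound
  linarith

theorem tsum_corr_succ_eq (hS : SpectralSetting T α B₀) (hh : IsInvariantDensity T h)
    (hψ : IsBV ψ) {l : ℕ} (hl : 1 ≤ l) : ∑' i : ℕ, corr (transfer T) h ψ (i + 1) =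
      ∑ i ∈ Finset.Ico 1 l, corr (transfer T) h ψ i + ∑' i : ℕ, corr (transfer T) h ψ (l + i) := by
  rw [← (hS.summable_corr_succ hh hψ).sum_add_tsum_nat_add (l - 1), Finset.sum_Ico_eq_sum_range]
  congr 1
  · exact Finset.sum_congr rfl fun i _ => by rw [add_comm]
  · congr 1 with i
    congr 1
    omega

theorem abs_ulamDiffusion_sub_le (hS : SpectralSetting T α B₀) (hh : IsInvariantDensity T h)
    (hψ : IsBV ψ) {l : ℕ} (hl : 1 ≤ l) (η : IntervalPartition) {hη : ℝ → ℝ}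
    (hd : η.IsUlamDensity T hη) :
    |ulamDiffusion T η hη ψ l - ((∫ x, centered ψ h x ^ 2 * h x ∂lebI) +
        2 * ∑' i : ℕ, corr (transfer T) h ψ (i + 1))| ≤
      tailBound T h ψ l + discretizationBound T α B₀ η hη h ψ l := by
  have h1 := hd.isDensity.abs_integral_centered_sq_sub_le hh.isDensity hψ
  have h2 := hS.two_mul_abs_tsum_corr_le hh hψ l
  have h3 := (Finset.abs_sum_le_sum_abs _ _).trans
    (Finset.sum_le_sum fun i (_ : i ∈ Finset.Ico 1 l) => hS.abs_corr_ulam_sub_le hh hψ η hd i)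
  rw [Finset.sum_sub_distrib, ← Finset.mul_sum, Finset.sum_add_distrib, Finset.sum_const,
    ← Finset.sum_mul, Nat.card_Ico, nsmul_eq_mul, Nat.cast_sub hl, Nat.cast_one] at h3
  rw [hS.tsum_corr_succ_eq hh hψ hl, ulamDiffusion, discretizationBound]
  change _ ≤ _ + ((16 * ((l : ℝ) - 1) + 8) * supNorm ψ ^ 2 * l1Norm (hη - h) + _)
  set δ := l1Norm (hη - h)
  set s := supNorm ψ
  set A := ∑ i ∈ Finset.Ico 1 l, corr (η.ulam T) hη ψ i
  set A' := ∑ i ∈ Finset.Ico 1 l, corr (transfer T) h ψ i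
  set R := ∑' i : ℕ, corr (transfer T) h ψ (l + i)
  set W := ∑ i ∈ Finset.Ico 1 l, ∑ j ∈ Finset.range i,
    (2 * s * ((∑ k ∈ Finset.range j, α ^ k * B₀) + 1 + α ^ j * B₀ / (1 - α)) +
      α ^ j * (B₀ + 1 - α) / (1 - α) * (essVar ψ).toReal)
  -- The estimates give `12 (l-1) + 3` where the bound has `16 (l-1) + 8`; these two nonnegative
  -- quantities absorb the difference.
  have hδ : 0 ≤ s ^ 2 * δ := mul_nonneg (sq_nonneg _) (l1Norm_nonneg _)
  have hlδ : 0 ≤ ((l : ℝ) - 1) * (s ^ 2 * δ) :=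
    mul_nonneg (sub_nonneg.2 (by exact_mod_cast hl)) hδ
  rw [abs_le] at h1 h3 ⊢
  have hR := le_abs_self R
  have hR' := neg_abs_le R
  constructor
  <;> linarith

end SpectralSetting

/-! ### The theorem. -/

theorem theorem2p2 (T : ℝ → ℝ) (hT : IsPiecewiseC2Expanding T)
    (α B₀ : ℝ) (hα₀ : 0 < α) (hα₁ : α < 1) (hB₀ : 0 ≤ B₀)
    (hA1 : LasotaYorke T α B₀) (hA2 : SimpleDominantEigenvalue T)
    (ψ : ℝ → ℝ) (hψ : IsBV ψ) :
    ∃ (ν : Measure ℝ) (h : ℝ → ℝ) (σ2 : ℝ),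
      -- the unique absolutely continuous invariant probability measure, with a density in BV
      (IsACIP T ν ∧ ∀ ν' : Measure ℝ, IsACIP T ν' → ν' = ν) ∧
      (IsBV h ∧ 0 ≤ᵐ[lebI] h ∧ ν = lebI.withDensity (fun x => ENNReal.ofReal (h x))) ∧
      -- the diffusion coefficient, as a limit and as a convergent series
      Tendsto (birkhoffVariance T ν ψ) atTop (𝓝 σ2) ∧
      Summable (fun i : ℕ => corr (transfer T) h ψ (i + 1)) ∧
      σ2 = (∫ x, centered ψ h x ^ 2 * h x ∂lebI) +
        2 * ∑' i : ℕ, corr (transfer T) h ψ (i + 1) ∧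
      -- every Ulam operator has a fixed density, and it is its only fixed point up to scaling
      (∀ η : IntervalPartition, ∃ hη : ℝ → ℝ, η.IsUlamDensity T hη ∧
        ∀ g : ℝ → ℝ, Integrable g lebI → η.ulam T g =ᵐ[lebI] g →
          ∃ c : ℝ, g =ᵐ[lebI] c • hη) ∧
      -- the approximation theorem
      (∀ τ : ℝ, 0 < τ → ∃ l : ℕ, 1 ≤ l ∧ ∃ ε : ℝ, 0 < ε ∧
        ∀ η : IntervalPartition, η.MeshLE ε → ∀ hη : ℝ → ℝ, η.IsUlamDensity T hη →
          |ulamDiffusion T η hη ψ l - σ2| ≤ τ) ∧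
      -- the explicit truncation length
      Summable (fun i : ℕ =>
        l1Norm ((transfer T)^[i] (fun y => centered ψ h y * h y))) ∧
      (∃ C ρ : ℝ, 0 < C ∧ α < ρ ∧ ρ < 1 ∧ DecayBound T C ρ) ∧
      (∀ C ρ : ℝ, 0 < C → α < ρ → ρ < 1 → DecayBound T C ρ → ∀ τ : ℝ, 0 < τ →
        tailBound T h ψ (truncationLength α B₀ C ρ ψ τ) ≤ τ / 2) ∧
      -- the criterion for the mesh is met by all sufficiently fine partitions
      (∀ τ : ℝ, 0 < τ → ∀ l : ℕ, 1 ≤ l → ∃ ε : ℝ, 0 < ε ∧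
        ∀ η : IntervalPartition, η.MeshLE ε → ∀ hη : ℝ → ℝ, η.IsUlamDensity T hη →
          discretizationBound T α B₀ η hη h ψ l ≤ τ / 2) ∧
      -- correctness of the resulting algorithm
      (∀ τ : ℝ, 0 < τ → ∀ l : ℕ, 1 ≤ l → tailBound T h ψ l ≤ τ / 2 →
        ∀ η : IntervalPartition, ∀ hη : ℝ → ℝ, η.IsUlamDensity T hη →
          discretizationBound T α B₀ η hη h ψ l ≤ τ / 2 →
          |ulamDiffusion T η hη ψ l - σ2| ≤ τ) := by

  have hS : SpectralSetting T α B₀ := ⟨hT, hα₀, hα₁, hB₀, hA1, hA2⟩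
  obtain ⟨h, hbv, hnn, hint, hfix⟩ := hS.exists_density
  have hh : IsInvariantDensity T h := ⟨hbv, hnn, hint, hfix⟩
  have hmesh := fun {τ : ℝ} (hτ : 0 < τ) {l : ℕ} (hl : 1 ≤ l) =>
    hS.exists_mesh_discretizationBound_le (ψ := ψ) hh hτ hl
  refine ⟨_, h, _, ⟨hS.isACIP_withDensity hh, fun ν' hν' => hS.isACIP_unique hh hν'⟩,
    ⟨hbv, .of_forall hnn, rfl⟩, hS.tendsto_birkhoffVariance hh hψ, hS.summable_corr_succ hh hψ, rfl,
    fun η => ?_, fun τ hτ => ?_, hS.summable_l1Norm_iterate hh hψ, hS.exists_decayBound,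
    fun C ρ hC hρ hρ1 hd τ hτ => hS.tailBound_truncationLength_le hh hψ hC hρ hρ1 hd hτ,
    fun τ hτ l hl => hmesh hτ hl, fun τ hτ l hl hE η hη hd hD => ?_⟩
  · obtain ⟨hη, hd⟩ := η.exists_isUlamDensity hT
    exact ⟨hη, hd, fun g hg hgfix => ⟨_, hS.ulam_fixed_unique hh η hd hg hgfix⟩⟩
  -- The existence of a suitable `l` and mesh follows from the explicit choices, for any decay
  -- constants.
  · obtain ⟨C, ρ, hC, hρ, hρ1, hdec⟩ := hS.exists_decayBound
    have hl : 1 ≤ truncationLength α B₀ C ρ ψ τ := le_max_left _ _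
    have hE := hS.tailBound_truncationLength_le hh hψ hC hρ hρ1 hdec hτ
    obtain ⟨ε, hε, H⟩ := hmesh hτ hl
    refine ⟨_, hl, ε, hε, fun η hη g hg => ?_⟩
    linarith [hS.abs_ulamDiffusion_sub_le hh hψ hl η hg, H η hη g hg]
  · linarith [hS.abs_ulamDiffusion_sub_le hh hψ hl η hd]
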